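/- **Theorem.** Let $m\ge 0$ and let $K$ be a simplicial complex on the set $[m]=\{1,\dots,m\}$: a collection of subsets of $[m]$, closed under passing to subsets and containing $\emptyset$ (not every point of $[m]$ has to be a vertex). Let $$\mathcal Z_K=\bigcup_{J\in K}\{z\in (D^2)^m : |z_j|=1 \text{ for } j\notin J\}\subset\mathbb C^m$$ be the moment-angle complex, on which $T^m=(S^1)^m$ acts coordinatewise. Let $ET^m=(S^\infty)^m\to BT^m=(\mathbb CP^\infty)^m$ be the universal principal $T^m$-bundle, where $S^\infty=\bigcup_n S^{2n-1}$ has the colimit topology and $\mathbb CP^\infty=S^\infty/S^1$. Let $B_T\mathcal Z_K=ET^m\times_{T^m}\mathcal Z_K$ be the quotient of $ET^m\times\mathcal Z_K$ by $(e,x)\sim(eg,g^{-1}x)$, $g\in T^m$, with projection $p\colon B_T\mathcal Z_K\to BT^m$, $[e,x]\mapsto[e]$. Let $i\colon SR(K)\hookrightarrow BT^m$ be the inclusion of the Stanley–Reisner space $SR(K)=\bigcup_{I\in K}BT_I$, where $BT_I\subset BT^m$ consists of the points whose coordinates outside $I$ equal the base point $*=[1:0:0:\cdots]$ of $\mathbb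 CP^\infty$. Then the map $p$ is homotopy equivalent to the inclusion $i$. More precisely, there are continuous maps $h\colon SR(K)\to B_T\mathcal Z_K$ and $r\colon B_T\mathcal Z_K\to SR(K)$ such that: 1. $p\circ h=i$, $\;r\circ h=\mathrm{id}$, and $h\circ r$ is homotopic to $\mathrm{id}$ relative to $h(SR(K))$. That is, $h$ embeds $SR(K)$ in $B_T\mathcal Z_K$ over $BT^m$, and $r$ is a (strong) deformation retraction onto it. 2. $i\circ r$ is homotopic to $p$. That is, $r$ commutes with the maps to $BT^m$ up to homotopy. 3. $\mathcal Z_K$ is the homotopy fibre of $i$. For every $e\in ET^m$ there is a homotopy equivalence from $\mathcal Z_K$ to the space of pairs $(x,\gamma)$, where $x\in SR(K)$ and $\gamma$ is a path in $BT^m$ from $i(x)$ to $[e]$ (compact-open topology on paths). Its composite with $(x,\gamma)\mapsto x$ is homotopic to $z\mapsto r([e,z])$. Moreover, for every commutative ring $\mathbf k$ with unit, the singular cohomology algebra $H^*(B_T\mathcal Z_K;\mathbf k)$ (with the cup product) is isomorphic, as a graded $\mathbf k$-algebra, to the face ring $$\mathbf k(K)=\mathbf k[v_1,\dots,v_m]/\bigl(v_{i_1}\cdots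 v_{i_s} : i_1<\dots<i_s,\ \{i_1,\dots,i_s\}\notin K\bigr),\qquad \deg v_i=2.$$ -/

import Mathlib

noncomputable section

/-! ### Singular cohomology with its cup product -/

namespace SingCoh

open CategoryTheory
variable (k : Type*) [CommRing k] (S : SSet.{0})

/-- Cochains of degree `n` of a simplicial set: arbitrary functions on `n`-simplices. -/
abbrev Cochain (n : ℕ) : Type _ := S.obj (.op (.mk n)) → k

variable {S}
/-- The coboundary `(δf)(σ) = ∑ (-1)^i f(d_i σ)`. -/
def coboundary (n : ℕ) : Cochain k S n →ₗ[k] Cochain k S (n + 1) where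
  toFun f := fun σ => ∑ i : Fin (n + 2), (-1) ^ (i : ℕ) * f (S.δ i σ)
  map_add' f g := by
    funext σ
    simp [mul_add, Finset.sum_add_distrib]
  map_smul' c f := by
    funext σ
    simp [Finset.mul_sum, mul_left_comm]

/-- The front `p`-face `[p] → [n]`, `i ↦ i`. -/
def front {p q n : ℕ} (h : p + q = n) : SimplexCategory.mk p ⟶ SimplexCategory.mk n :=
  SimplexCategory.mkHom
    ⟨fun i => ⟨i, by have := i.2; omega⟩, fun a b hab => by simpa using hab⟩

/-- The back `q`-face `[q] → [n]`, `i ↦ p + i`. -/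
def back {p q n : ℕ} (h : p + q = n) : SimplexCategory.mk q ⟶ SimplexCategory.mk n :=
  SimplexCategory.mkHom
    ⟨fun i => ⟨p + i, by have := i.2; omega⟩, fun a b hab => by simpa using hab⟩

variable {k}
/-- The Alexander–Whitney cup product of cochains,
`(f ∪ g)(σ) = f(front p-face of σ) * g(back q-face of σ)`. -/
def cup {p q n : ℕ} (h : p + q = n) (f : Cochain k S p) (g : Cochain k S q) : Cochain k S n :=
  fun σ => f (S.map (front h).op σ) * g (S.map (back h).op σ)

theorem front_δ_le {p q n : ℕ} (h : p + q = n) (h' : p + 1 + q = n + 1) (i : Fin (n + 2))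
    (j : Fin (p + 2)) (hij : (i : ℕ) = j) :
    front h ≫ SimplexCategory.δ i = SimplexCategory.δ j ≫ front h' := by
  ext x
  change Fin (p + 1) at x
  have hx := x.2
  change ((i.succAbove (⟨x.1, by omega⟩ : Fin (n + 1)) : Fin (n + 2)) : ℕ) =
    ((j.succAbove x : Fin (p + 2)) : ℕ)
  simp only [Fin.succAbove, Fin.lt_def, Fin.val_castSucc, hij]
  split_ifs <;> rfl

theorem front_δ_gt {p q n : ℕ} (h : p + q = n) (h' : p + (q + 1) = n + 1) (i : Fin (n + 2))
    (hi : p < (i : ℕ)) :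
    front h ≫ SimplexCategory.δ i = front h' := by
  ext x
  change Fin (p + 1) at x
  have hx := x.2
  change ((i.succAbove (⟨x.1, by omega⟩ : Fin (n + 1)) : Fin (n + 2)) : ℕ) = (x : ℕ)
  simp only [Fin.succAbove, Fin.lt_def, Fin.val_castSucc]
  rw [if_pos (by omega)]
  rfl

theorem back_δ_le {p q n : ℕ} (h : p + q = n) (h' : p + 1 + q = n + 1) (i : Fin (n + 2))
    (hi : (i : ℕ) ≤ p) :
    back h ≫ SimplexCategory.δ i = back h' := by
  ext x
  change Fin (q + 1) at x
  have hx := x.2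
  change ((i.succAbove (⟨p + x.1, by omega⟩ : Fin (n + 1)) : Fin (n + 2)) : ℕ) = p + 1 + (x : ℕ)
  simp only [Fin.succAbove, Fin.lt_def, Fin.val_castSucc]
  rw [if_neg (by omega), Fin.val_succ]
  simp only
  omega

theorem back_δ_ge {p q n : ℕ} (h : p + q = n) (h' : p + (q + 1) = n + 1) (i : Fin (n + 2))
    (j : Fin (q + 2)) (hij : (i : ℕ) = p + j) :
    back h ≫ SimplexCategory.δ i = SimplexCategory.δ j ≫ back h' := by
  ext x
  change Fin (q + 1) at x
  have hx := x.2
  change ((i.succAbove (⟨p + x.1, by omega⟩ : Fin (n + 1)) : Fin (n + 2)) : ℕ) =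
    p + ((j.succAbove x : Fin (q + 2)) : ℕ)
  simp only [Fin.succAbove, Fin.lt_def, Fin.val_castSucc, hij, add_lt_add_iff_left]
  split_ifs <;> simp [add_assoc]

theorem δ_last_front {p q n : ℕ} (h₁ : p + 1 + q = n + 1) (h₂ : p + (q + 1) = n + 1) :
    SimplexCategory.δ (Fin.last (p + 1)) ≫ front h₁ = front h₂ := by
  ext x
  change Fin (p + 1) at x
  change (((Fin.last (p + 1)).succAbove x : Fin (p + 2)) : ℕ) = (x : ℕ)
  simp

theorem δ_zero_back {p q n : ℕ} (h₁ : p + 1 + q = n + 1) (h₂ : p + (q + 1) = n + 1) :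
    SimplexCategory.δ (0 : Fin (q + 2)) ≫ back h₂ = back h₁ := by
  ext x
  change Fin (q + 1) at x
  change p + (((0 : Fin (q + 2)).succAbove x : Fin (q + 2)) : ℕ) = p + 1 + (x : ℕ)
  simp
  omega

theorem map_δ {a n : ℕ} (u : SimplexCategory.mk a ⟶ SimplexCategory.mk n) (i : Fin (n + 2)) (σ : S.obj (.op (.mk (n + 1)))) :
    S.map u.op (S.δ i σ) = S.map (u ≫ SimplexCategory.δ i).op σ := by
  simp [SimplicialObject.δ]

theorem δ_map {a n : ℕ} (u : SimplexCategory.mk (a + 1) ⟶ SimplexCategory.mk n) (i : Fin (a + 2)) (σ : S.obj (.op (.mk n))) :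
    S.δ i (S.map u.op σ) = S.map (SimplexCategory.δ i ≫ u).op σ := by
  simp [SimplicialObject.δ]

/-- The Leibniz rule. -/
theorem coboundary_cup {p q n : ℕ} (h : p + q = n) (h₁ : p + 1 + q = n + 1)
    (h₂ : p + (q + 1) = n + 1) (f : Cochain k S p) (g : Cochain k S q) :
    coboundary k n (cup h f g) =
      cup h₁ (coboundary k p f) g + (-1 : k) ^ p • cup h₂ f (coboundary k q g) := by
  funext σ
  have hn : (p + 1) + (q + 1) = n + 2 := by omega
  simp only [coboundary, cup, LinearMap.coe_mk, AddHom.coe_mk, Pi.add_apply, Pi.smul_apply,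
    smul_eq_mul, δ_map, map_δ]
  rw [← Fin.sum_congr' _ hn, Fin.sum_univ_add, Fin.sum_univ_castSucc (n := p + 1),
    Fin.sum_univ_succ (n := q + 1), add_mul, Finset.sum_mul, mul_add, mul_add, Finset.mul_sum,
    Finset.mul_sum]
  have e1 : ∀ i : Fin (p + 1),
      (-1 : k) ^ ((Fin.cast hn (Fin.castAdd (q + 1) i) : Fin (n + 2)) : ℕ) *
        (f (S.map (front h ≫ SimplexCategory.δ (Fin.cast hn (Fin.castAdd (q + 1) i))).op σ) *
          g (S.map (back h ≫ SimplexCategory.δ (Fin.cast hn (Fin.castAdd (q + 1) i))).op σ)) =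
      (-1) ^ (i.castSucc : ℕ) * f (S.map (SimplexCategory.δ i.castSucc ≫ front h₁).op σ) *
        g (S.map (back h₁).op σ) := by
    intro i
    rw [front_δ_le h h₁ _ i.castSucc (by simp), back_δ_le h h₁ _ (by have := i.2; simp; omega)]
    simp [mul_assoc]
  have e2 : ∀ i : Fin (q + 1),
      (-1 : k) ^ ((Fin.cast hn (Fin.natAdd (p + 1) i) : Fin (n + 2)) : ℕ) *
        (f (S.map (front h ≫ SimplexCategory.δ (Fin.cast hn (Fin.natAdd (p + 1) i))).op σ) *
          g (S.map (back h ≫ SimplexCategory.δ (Fin.cast hn (Fin.natAdd (p + 1) i))).op σ)) =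
      (-1) ^ p * (f (S.map (front h₂).op σ) *
        ((-1) ^ (i.succ : ℕ) * g (S.map (SimplexCategory.δ i.succ ≫ back h₂).op σ))) := by
    intro i
    rw [front_δ_gt h h₂ _ (by simp; omega), back_δ_ge h h₂ _ i.succ (by simp; omega)]
    simp [pow_add, pow_succ]
    ring
  rw [Finset.sum_congr rfl fun i _ => e1 i, Finset.sum_congr rfl fun i _ => e2 i,
    δ_last_front h₁ h₂, δ_zero_back h₁ h₂]
  simp [pow_succ]
  ring

theorem cup_add_left {p q n : ℕ} (h : p + q = n) (f f' : Cochain k S p) (g : Cochain k S q) :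
    cup h (f + f') g = cup h f g + cup h f' g := by
  funext σ; simp [cup, add_mul]

theorem cup_add_right {p q n : ℕ} (h : p + q = n) (f : Cochain k S p) (g g' : Cochain k S q) :
    cup h f (g + g') = cup h f g + cup h f g' := by
  funext σ; simp [cup, mul_add]

theorem cup_smul_left {p q n : ℕ} (h : p + q = n) (c : k) (f : Cochain k S p)
    (g : Cochain k S q) : cup h (c • f) g = c • cup h f g := by
  funext σ; simp [cup, mul_assoc]

theorem cup_smul_right {p q n : ℕ} (h : p + q = n) (c : k) (f : Cochain k S p)
    (g : Cochain k S q) : cup h f (c • g) = c • cup h f g := by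
  funext σ; simp [cup, mul_left_comm]

variable (k S) in
/-- Cocycles. -/
def cocycles (n : ℕ) : Submodule k (Cochain k S n) := LinearMap.ker (coboundary k n)

variable (k S) in
/-- Coboundaries (zero in degree `0`). -/
def coboundaries : (n : ℕ) → Submodule k (Cochain k S n)
  | 0 => ⊥
  | n + 1 => LinearMap.range (coboundary k n)

theorem cup_mem_cocycles {p q n : ℕ} (h : p + q = n) {f : Cochain k S p} {g : Cochain k S q}
    (hf : f ∈ cocycles k S p) (hg : g ∈ cocycles k S q) : cup h f g ∈ cocycles k S n := by
  simp only [cocycles, LinearMap.mem_ker] at *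
  rw [coboundary_cup h (by omega) (by omega), hf, hg]
  funext σ; simp [cup]

theorem cup_mem_coboundaries_left {p q n : ℕ} (h : p + q = n) {f : Cochain k S p}
    {g : Cochain k S q} (hf : f ∈ coboundaries k S p) (hg : g ∈ cocycles k S q) :
    cup h f g ∈ coboundaries k S n := by
  cases p with
  | zero =>
    have hf' : f = 0 := hf
    have h0 : cup h f g = 0 := by funext σ; simp [cup, hf']
    rw [h0]; exact zero_mem _
  | succ p =>
    obtain ⟨f', rfl⟩ := hf
    obtain ⟨n, rfl⟩ : ∃ r, n = r + 1 := ⟨p + q, by omega⟩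
    have hg' : coboundary k q g = 0 := hg
    refine ⟨cup (by omega : p + q = n) f' g, ?_⟩
    rw [coboundary_cup _ h (by omega), hg']
    funext σ; simp [cup]

theorem cup_mem_coboundaries_right {p q n : ℕ} (h : p + q = n) {f : Cochain k S p}
    {g : Cochain k S q} (hf : f ∈ cocycles k S p) (hg : g ∈ coboundaries k S q) :
    cup h f g ∈ coboundaries k S n := by
  cases q with
  | zero =>
    have hg' : g = 0 := hg
    have h0 : cup h f g = 0 := by funext σ; simp [cup, hg']
    rw [h0]; exact zero_mem _
  | succ q =>
    obtain ⟨g', rfl⟩ := hg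
    obtain ⟨n, rfl⟩ : ∃ r, n = r + 1 := ⟨p + q, by omega⟩
    have hf' : coboundary k p f = 0 := hf
    refine ⟨(-1 : k) ^ p • cup (by omega : p + q = n) f g', ?_⟩
    rw [map_smul, coboundary_cup _ (by omega) h, hf', smul_add, smul_smul, ← mul_pow]
    funext σ; simp [cup]

variable (k S) in
/-- The cohomology `Hⁿ(S; k)`: cocycles modulo coboundaries. -/
abbrev Cohomology (n : ℕ) : Type _ :=
  cocycles k S n ⧸ (coboundaries k S n).comap (cocycles k S n).subtype

/-- The cup product of cocycles, as a bilinear map. -/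
def cupCocycles (p q : ℕ) : cocycles k S p →ₗ[k] cocycles k S q →ₗ[k] cocycles k S (p + q) :=
  LinearMap.mk₂ k (fun f g => ⟨cup rfl f.1 g.1, cup_mem_cocycles rfl f.2 g.2⟩)
    (fun f f' g => Subtype.ext (cup_add_left rfl f.1 f'.1 g.1))
    (fun c f g => Subtype.ext (cup_smul_left rfl c f.1 g.1))
    (fun f g g' => Subtype.ext (cup_add_right rfl f.1 g.1 g'.1))
    (fun c f g => Subtype.ext (cup_smul_right rfl c f.1 g.1))

/-- The cup product `H^p × H^q → H^{p+q}`. -/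
def cupProduct (p q : ℕ) :
    Cohomology k S p →ₗ[k] Cohomology k S q →ₗ[k] Cohomology k S (p + q) :=
  Submodule.liftQ _
    (LinearMap.flip (Submodule.liftQ _
      (LinearMap.flip ((cupCocycles p q).compr₂ (Submodule.mkQ
        ((coboundaries k S (p + q)).comap (cocycles k S (p + q)).subtype))))
      (by
        intro g hg
        rw [LinearMap.mem_ker]
        ext f
        exact (Submodule.Quotient.mk_eq_zero _).2 (cup_mem_coboundaries_right rfl f.2 hg))))
    (by
      intro f hf
      rw [LinearMap.mem_ker]
      ext g
      exact (Submodule.Quotient.mk_eq_zero _).2 (cup_mem_coboundaries_left rfl hf g.2))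

/-- The unit of the cohomology algebra: the class of the constant cochain `1`. -/
def oneClass : Cohomology k S 0 :=
  Submodule.Quotient.mk ⟨fun _ => 1, by
    rw [cocycles, LinearMap.mem_ker]
    funext σ
    simp [coboundary, Fin.sum_univ_succ]⟩

/-- The `n`-th singular cohomology `Hⁿ(X; k)` of a topological space. -/
abbrev SingularCohomology (k : Type*) [CommRing k] (X : Type) [TopologicalSpace X] (n : ℕ) :
    Type _ :=
  Cohomology k (TopCat.toSSet.obj (TopCat.of X)) n

variable (k) in
/-- The cup product in singular cohomology. -/
def singularCup (X : Type) [TopologicalSpace X] (p q : ℕ) :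
    SingularCohomology k X p →ₗ[k] SingularCohomology k X q →ₗ[k]
      SingularCohomology k X (p + q) :=
  cupProduct p q

variable (k) in
/-- The unit of the singular cohomology algebra. -/
def singularOne (X : Type) [TopologicalSpace X] : SingularCohomology k X 0 := oneClass

end SingCoh

end


noncomputable section

namespace MomentAngle

/-- The simplices of a simplicial complex on `[m]`: its faces and the empty simplex. (Mathlib's
faces are the nonempty ones; not every point of `[m]` has to be a vertex.) -/
def simplices {m : ℕ} (K : PreAbstractSimplicialComplex (Fin m)) : Set (Finset (Fin m)) :=
  {I | I = ∅ ∨ I ∈ K}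

/-! ### The universal bundle `ET^m → BT^m` -/

/-- The unit sphere `S^{2n-1}` of `ℂⁿ`, with the subspace topology. -/
abbrev FinSphere (n : ℕ) : Type := {v : Fin n → ℂ // ∑ i, ‖v i‖ ^ 2 = 1}

/-- The infinite-dimensional sphere `S^∞ = ⋃ₙ S^{2n-1}`: finitely supported complex sequences of
norm one. -/
def SInf : Type := {z : ℕ →₀ ℂ // (z.sum fun _ w => ‖w‖ ^ 2) = 1}

/-- The inclusion `S^{2n-1} ⊂ S^∞`, extending a vector by zeros. -/
def FinSphere.incl (n : ℕ) (v : FinSphere n) : SInf :=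
  ⟨(Finsupp.equivFunOnFinite.symm v.1).embDomain Fin.valEmbedding, by
    rw [Finsupp.sum_embDomain, Finsupp.sum_fintype _ _ (by simp)]
    exact v.2⟩

/-- `S^∞` carries the colimit (CW) topology of the spheres `S^{2n-1}`. -/
instance : TopologicalSpace SInf :=
  ⨆ n : ℕ, TopologicalSpace.coinduced (FinSphere.incl n) inferInstance

/-- The circle acts on `S^∞` by scalar multiplication. -/
instance : MulAction Circle SInf where
  smul g z := ⟨(g : ℂ) • z.1, by
    rw [Finsupp.sum_of_support_subset (s := z.1.support) _ Finsupp.support_smul _ (by simp)]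
    simpa [Finsupp.sum, Circle.norm_coe] using z.2⟩
  one_smul z := Subtype.ext (by change ((1 : Circle) : ℂ) • z.1 = z.1; simp)
  mul_smul g h z := Subtype.ext (by
    change ((g * h : Circle) : ℂ) • z.1 = (g : ℂ) • (h : ℂ) • z.1
    rw [Circle.coe_mul, mul_smul])

/-- Infinite-dimensional complex projective space `ℂP^∞ = S^∞ / S¹`, with the quotient topology. -/
abbrev CPInf : Type := Quotient (MulAction.orbitRel Circle SInf)

/-- The `0`-cell `[1 : 0 : 0 : ⋯]` of `ℂP^∞`. -/
def CPInf.base : CPInf := Quotient.mk _ (FinSphere.incl 1 ⟨fun _ => 1, by simp⟩)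

/-- The torus `T^m`. -/
abbrev Torus (m : ℕ) : Type := Fin m → Circle

/-- The total space `ET^m = (S^∞)^m`, on which `T^m` acts coordinatewise. -/
abbrev ET (m : ℕ) : Type := Fin m → SInf

/-- The classifying space `BT^m = (ℂP^∞)^m`. -/
abbrev BT (m : ℕ) : Type := Fin m → CPInf

/-- The universal principal bundle `ET^m → BT^m`. -/
def universalProj (m : ℕ) : C(ET m, BT m) where
  toFun e := fun i => Quotient.mk _ (e i)
  continuous_toFun := continuous_pi fun i => continuous_quotient_mk'.comp (continuous_apply i)

/-! ### The Borel construction -/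

/-- The relation `(e, x) ∼ (e g, g⁻¹ x)`, `g ∈ T^m`, on `ET^m × X`. -/
def borelSetoid (m : ℕ) (X : Type) [MulAction (Torus m) X] : Setoid (ET m × X) where
  r a b := ∃ g : Torus m, b = (g • a.1, g⁻¹ • a.2)
  iseqv :=
    { refl := fun a => ⟨1, by simp⟩
      symm := by
        rintro a b ⟨g, rfl⟩
        exact ⟨g⁻¹, by simp⟩
      trans := by
        rintro a b c ⟨g, rfl⟩ ⟨h, rfl⟩
        exact ⟨h * g, by rw [mul_smul, mul_inv, mul_smul]⟩ }

/-- The Borel construction `B_T X = ET^m ×_{T^m} X`, with the quotient topology. -/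
abbrev Borel (m : ℕ) (X : Type) [TopologicalSpace X] [MulAction (Torus m) X] : Type :=
  Quotient (borelSetoid m X)

section
variable {m : ℕ} {X : Type} [TopologicalSpace X] [MulAction (Torus m) X]

variable (m X) in
/-- The projection `p : B_T X → BT^m`, `[e, x] ↦ [e]`. -/
def borelProj : C(Borel m X, BT m) where
  toFun := Quotient.lift (fun a => universalProj m a.1) (by
    rintro a b ⟨g, rfl⟩
    funext i
    exact Quotient.sound ((MulAction.orbitRel Circle SInf).symm ⟨g i, rfl⟩))
  continuous_toFun := ((universalProj m).continuous.comp continuous_fst).quotient_lift _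

/-- The inclusion `X → B_T X`, `x ↦ [e, x]`, of the fibre of `p` over the class of `e`. -/
def fibreIncl (e : ET m) : C(X, Borel m X) where
  toFun x := Quotient.mk _ (e, x)
  continuous_toFun := continuous_quotient_mk'.comp (by fun_prop)

end

/-! ### The moment-angle complex and the Stanley–Reisner space -/

section
variable {m : ℕ} (K : PreAbstractSimplicialComplex (Fin m))

/-- The moment-angle complex `Z_K = ⋃_{J ∈ K} B_J ⊆ (D²)^m`, where
`B_J = {z ∈ (D²)^m : |z_j| = 1 for j ∉ J}`. -/
def momentAngle : Set (Fin m → ℂ) :=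
  {z | (∀ i, ‖z i‖ ≤ 1) ∧ ∃ J ∈ simplices K, ∀ j, j ∉ J → ‖z j‖ = 1}

/-- The torus acts on `Z_K` by coordinatewise multiplication. -/
instance : MulAction (Torus m) (momentAngle K) where
  smul g z := ⟨fun i => (g i : ℂ) * z.1 i, by
    obtain ⟨h1, J, hJ, h2⟩ := z.2
    exact ⟨fun i => by simpa [Circle.norm_coe] using h1 i, J, hJ, fun j hj => by simpa [Circle.norm_coe] using h2 j hj⟩⟩
  one_smul z := Subtype.ext (funext fun i => by
    change ((1 : Circle) : ℂ) * z.1 i = z.1 i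
    simp)
  mul_smul g h z := Subtype.ext (funext fun i => by
    change ((g i * h i : Circle) : ℂ) * z.1 i = (g i : ℂ) * ((h i : ℂ) * z.1 i)
    rw [Circle.coe_mul, mul_assoc])

/-- The Stanley–Reisner space `SR(K) = ⋃_{I ∈ K} BT_I ⊆ BT^m`, where `BT_I` is the set of points
whose coordinates outside `I` are the base point. -/
def stanleyReisnerSpace : Set (BT m) :=
  {b | ∃ I ∈ simplices K, ∀ i, i ∉ I → b i = CPInf.base}

/-- The inclusion `i : SR(K) → BT^m`. -/
def stanleyReisnerIncl : C(stanleyReisnerSpace K, BT m) := ⟨Subtype.val, continuous_subtype_val⟩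

end

/-! ### Homotopy fibres -/

section
variable {X Y : Type} [TopologicalSpace X] [TopologicalSpace Y]

/-- The homotopy fibre of `f` over `b`: pairs of a point `x` and a path from `f x` to `b`, with the
compact-open topology on paths. -/
abbrev HomotopyFibre (f : C(X, Y)) (b : Y) : Type :=
  {c : X × C(unitInterval, Y) // c.2 0 = f c.1 ∧ c.2 1 = b}

/-- The canonical map from the homotopy fibre of `f : X → Y` to `X`. -/
def HomotopyFibre.proj (f : C(X, Y)) (b : Y) : C(HomotopyFibre f b, X) :=
  ⟨fun c => c.1.1, by fun_prop⟩

end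

/-! ### The face ring -/

section
variable (k : Type*) [CommRing k] {m : ℕ} (K : PreAbstractSimplicialComplex (Fin m))

/-- The ideal of `k[v_1, …, v_m]` generated by the square-free monomials of the non-simplices. -/
def stanleyReisnerIdeal : Ideal (MvPolynomial (Fin m) k) :=
  Ideal.span {f | ∃ I : Finset (Fin m), I ∉ simplices K ∧ f = ∏ i ∈ I, MvPolynomial.X i}

/-- The face ring (Stanley–Reisner ring) `k(K)`. -/
abbrev FaceRing : Type _ := MvPolynomial (Fin m) k ⧸ stanleyReisnerIdeal k K

/-- The degree `n` component of the face ring, graded by `deg v_i = 2`. -/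
def faceRingDegree (n : ℕ) : Submodule k (FaceRing k K) :=
  (MvPolynomial.weightedHomogeneousSubmodule k (fun _ : Fin m => 2) n).map
    (Ideal.Quotient.mkₐ k (stanleyReisnerIdeal k K)).toLinearMap

instance : SetLike.GradedMonoid (faceRingDegree k K) where
  one_mem := ⟨1, MvPolynomial.isWeightedHomogeneous_one k _, by simp⟩
  mul_mem := by
    rintro p q _ _ ⟨a, ha, rfl⟩ ⟨b, hb, rfl⟩
    exact ⟨a * b, MvPolynomial.IsWeightedHomogeneous.mul ha hb, by simp⟩

end

end MomentAngle

end

/-!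
Homotopy theory of the Borel construction. For `e ∈ S^∞` and `w` in the unit disc there is a path
in `S^∞` from `e` to a point `SInf.move e w` with first coordinate `w`. It is constant if already
`e 0 = w`, it is equivariant for the circle, and it is continuous in all variables
(`SInf.movePath`). Applied with `w = conj z_i` in each coordinate, the endpoint lies over the base
point wherever `|z_i| = 1`, since a unit vector with first coordinate of modulus one is in the orbit
of the first basis vector. Hence `[e, z] ↦ [move e (conj z)]` is a map `retr` from the Borel
construction of `Z_K` to `SR(K)`, with section `emb : [e] ↦ [e, conj e_0]`; the paths themselves
give both homotopies. Continuity of a map *into* the colimit `S^∞` is deduced from continuity of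
the coordinates, when locally only boundedly many of them are nonzero (`FinCont`); all the
constructions have this property on products of finite-dimensional spheres with the parameters.

The homotopy fibre. Two points of `ℂP^∞` whose representatives have a nonzero Hermitian product are
related by a canonical isomorphism of their circles, the phase of this product. Dividing a path into
steps which depend continuously on the path, and composing these transports, gives a continuous
path lifting for `S^∞ → ℂP^∞` (`CPInf.lift`). The map from `Z_K` to the homotopy fibre sends `z` to
the path in `BT^m` covered by the one from `e` to `move e (conj z)`. A homotopy inverse sends
`(x, γ)` to the conjugates of the first coordinates of the end point of the lift of `γ` that starts
at `e`. One composite differs from the identity by the holonomy of the first construction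
relative to the lift; the other one is deformed to the identity through the rays of a surface that
both paths bound, the retraction homotopy applied along the lift of `γ` (`Fib.surface`).

Cohomology. All degrees are treated at once in the differential ring `Tot` of cochain sequences,
with cohomology `TotCoh`. Operators on functions of tuples of vertices, defined by coning, yield
homotopy invariance and, through barycentric subdivision, small simplices
(`exists_primitive_of_van`); from these follows the part of the Mayer–Vietoris sequence that is
needed (`mayerVietoris_injective`). Classes of degree two commute because of the cup-one product of
cocycles (`exists_d_eq_commutator`), so polynomials can be evaluated at them.

The circle bundle `S^∞ → ℂP^∞` has a connection cochain `a`, counting the turns of a path relative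
to a chosen lift of its image; its coboundary is pulled back from the Euler cochain `c`. For the
pullback `P → B` of the bundle, the cochains `(x, y, z)` in `C(B) ⊕ C(B) ⊕ C(P)` with the
differential `(d x ± y c, d y, π^* x + π^* y a - d z)` form a complex `coneD`, whose acyclicity is
the Gysin sequence. It is acyclic for trivial bundles (`exists_coneD_eq`), where the total space is
covered by `B × ℝ`; small simplices and passage to increasing unions extend this to
`X × S^∞ → X × ℂP^∞`. As `S^∞` is contractible, the Euler class of `X × ℂP^∞` is a
non-zero-divisor, and its multiples are exactly the classes that vanish on `X × {*}`
(`exists_eq_mul_eulerClass`, `eq_zero_of_mul_eulerClass`).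

The face ring. Let `nearSR` be the open neighbourhood of `SR(K)` of the points whose coordinates
away from a small ball about the base point are indexed by a simplex. Split off the first vertex:
`nearSR K` is covered by the open sets `nearSR (deletion K) × U`, with `U` contractible, and
`nearSR (link K) × ℂP^∞`, which meet in `nearSR (link K) × U`. A class is then determined by its
restrictions to both sets, and by the Gysin sequence, a class that vanishes on the first set is on
the second set a multiple of the Euler class. Induction on the number of vertices shows that every
homogeneous class is a polynomial in the coordinate classes, and that such a polynomial vanishes if
and only if all its monomials are supported on non-simplices (`nearSR_cohomology`). These monomials
span the Stanley–Reisner ideal (`mem_stanleyReisnerIdeal_iff`), and homotopy equivalences carry the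
result to the Borel construction (`borel_cohomology`).
-/

noncomputable section

/-! ### Cochains on tuples: subdivision and homotopy operators -/

namespace TupleCochain

/-- The terms of `d ∘ d` cancel in pairs. -/
theorem alternating_sum_sum_eq_zero {k : Type*} [CommRing k] {n : ℕ}
    (F : Fin (n + 3) → Fin (n + 2) → k)
    (h : ∀ i j : Fin (n + 2), i ≤ j → F j.succ i = F i.castSucc j) :
    ∑ i : Fin (n + 3), ∑ j : Fin (n + 2), (-1 : k) ^ ((i : ℕ) + (j : ℕ)) * F i j = 0 := by
  rw [← Finset.sum_product', Finset.univ_product_univ,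
    ← Finset.sum_filter_add_sum_filter_not Finset.univ
      (fun x : Fin (n + 3) × Fin (n + 2) => (x.2 : ℕ) < (x.1 : ℕ)), ← eq_neg_iff_add_eq_zero,
    ← Finset.sum_neg_distrib]
  refine Finset.sum_bij'
    (fun x hx => (x.2.castSucc, ⟨x.1 - 1, by have := x.1.2; omega⟩))
    (fun x hx => (x.2.succ, ⟨x.1, by
      simp only [Finset.mem_filter, Finset.mem_univ, true_and, not_lt] at hx
      have := x.2.2; omega⟩)) ?_ ?_ ?_ ?_ ?_
  · rintro ⟨i, j⟩ hx
    simp only [Finset.mem_filter, Finset.mem_univ, true_and, not_lt] at hx ⊢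
    simp only [Fin.val_castSucc]
    omega
  · rintro ⟨i, j⟩ hx
    simp only [Finset.mem_filter, Finset.mem_univ, true_and, not_lt] at hx ⊢
    simp only [Fin.val_succ]
    omega
  · rintro ⟨i, j⟩ hx
    simp only [Finset.mem_filter, Finset.mem_univ, true_and] at hx
    ext <;> simp
    omega
  · rintro ⟨i, j⟩ hx
    ext <;> simp
  · rintro ⟨i, j⟩ hx
    simp only [Finset.mem_filter, Finset.mem_univ, true_and] at hx
    obtain ⟨i', rfl⟩ : ∃ i' : Fin (n + 2), i = i'.succ :=
      ⟨⟨i - 1, by have := i.2; omega⟩, by ext; simp; omega⟩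
    have hle : j ≤ i' := by
      rw [Fin.le_def]; simp only [Fin.val_succ] at hx; omega
    rw [h j i' hle]
    simp only [Fin.val_succ, Fin.val_castSucc, Nat.add_sub_cancel, Fin.eta]
    ring

variable {k : Type*} [CommRing k] {V W : Type*}

/-- The simplicial coboundary of functions on tuples. -/
def delta (n : ℕ) : ((Fin (n + 1) → V) → k) →ₗ[k] ((Fin (n + 2) → V) → k) where
  toFun f v := ∑ i : Fin (n + 2), (-1) ^ (i : ℕ) * f (fun j => v (i.succAbove j))
  map_add' f g := by funext v; simp [mul_add, Finset.sum_add_distrib]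
  map_smul' c f := by funext v; simp [Finset.mul_sum, mul_left_comm]

theorem delta_apply (n : ℕ) (f : (Fin (n + 1) → V) → k) (v : Fin (n + 2) → V) :
    delta n f v = ∑ i : Fin (n + 2), (-1) ^ (i : ℕ) * f (fun j => v (i.succAbove j)) := rfl

theorem delta_delta (n : ℕ) (f : (Fin (n + 1) → V) → k) : delta (n + 1) (delta n f) = 0 := by
  funext v
  simp only [delta_apply, Finset.mul_sum, ← mul_assoc, ← pow_add, Pi.zero_apply]
  refine alternating_sum_sum_eq_zero
    (fun i j => f (fun l => v (i.succAbove (j.succAbove l)))) fun i j hij => ?_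
  congr 1
  funext l
  congr 1
  ext
  rw [Fin.le_def] at hij
  simp only [Fin.succAbove, Fin.lt_def, Fin.val_castSucc, Fin.val_succ]
  split_ifs <;> simp at * <;> omega

/-- The dual of the cone on tuples with apex `b`. -/
def cone (b : V) (n : ℕ) : ((Fin (n + 2) → V) → k) →ₗ[k] ((Fin (n + 1) → V) → k) where
  toFun f w := f (Fin.cons b w)
  map_add' _ _ := rfl
  map_smul' _ _ := rfl

theorem cone_apply (b : V) (n : ℕ) (f : (Fin (n + 2) → V) → k) (w : Fin (n + 1) → V) :
    cone b n f w = f (Fin.cons b w) := rfl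

theorem cons_succAbove_succ {n : ℕ} (b : V) (w : Fin (n + 2) → V) (i : Fin (n + 2)) :
    (fun j : Fin (n + 2) => (Fin.cons b w : Fin (n + 3) → V) (i.succ.succAbove j)) =
      Fin.cons b (fun j => w (i.succAbove j)) := by
  funext j
  refine Fin.cases ?_ (fun j => ?_) j
  · simp
  · simp [Fin.succ_succAbove_succ]

theorem cone_delta_succ (b : V) (n : ℕ) (f : (Fin (n + 2) → V) → k) :
    cone b (n + 1) (delta (n + 1) f) = f - delta n (cone b n f) := by
  funext w
  rw [cone_apply, delta_apply, Fin.sum_univ_succ, Pi.sub_apply, delta_apply]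
  simp only [cons_succAbove_succ, Fin.val_zero, pow_zero, one_mul, Fin.zero_succAbove,
    Fin.cons_succ, Fin.val_succ, pow_succ, cone_apply, mul_neg, mul_one, neg_mul,
    Finset.sum_neg_distrib, sub_eq_add_neg]

theorem cone_delta_zero (b : V) (f : (Fin 1 → V) → k) (w : Fin 1 → V) :
    cone b 0 (delta 0 f) w = f w - f (fun _ => b) := by
  rw [cone_apply, delta_apply, Fin.sum_univ_two]
  have h1 : (fun j : Fin 1 => (Fin.cons b w : Fin 2 → V) ((1 : Fin 2).succAbove j)) =
      fun _ => b := by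
    funext j; fin_cases j; rfl
  simp [h1, sub_eq_add_neg]

/-- The subdivision operator on functions on tuples, with cone points `b v`: the dual of the
recursion `Sd v = b v · Sd (∂ v)` for chains. -/
def sd (b : ∀ n, (Fin (n + 1) → V) → V) :
    ∀ n, ((Fin (n + 1) → V) → k) →ₗ[k] ((Fin (n + 1) → V) → k)
  | 0 => LinearMap.id
  | n + 1 =>
    { toFun := fun f v => delta n (sd b n (cone (b (n + 1) v) n f)) v
      map_add' := fun f g => by funext v; simp
      map_smul' := fun c f => by funext v; simp }

theorem sd_succ_apply (b : ∀ n, (Fin (n + 1) → V) → V) (n : ℕ) (f : (Fin (n + 2) → V) → k)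
    (v : Fin (n + 2) → V) :
    sd b (n + 1) f v = delta n (sd b n (cone (b (n + 1) v) n f)) v := rfl

theorem sd_delta (b : ∀ n, (Fin (n + 1) → V) → V) (n : ℕ) (f : (Fin (n + 1) → V) → k) :
    sd b (n + 1) (delta n f) = delta n (sd b n f) := by
  induction n with
  | zero =>
    funext v
    rw [sd_succ_apply]
    simp only [sd, LinearMap.id_coe, id_eq, delta_apply, cone_delta_zero]
    simp [sub_eq_add_neg]
  | succ n ih =>
    funext v
    rw [sd_succ_apply, cone_delta_succ, map_sub, map_sub, ih, delta_delta, sub_zero]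

/-- The chain homotopy built by coning with apex `b v`, between natural operators with
difference `Q`: the dual of the recursion `D v = b v · (Q v - D (∂ v))` for chains. -/
def htpy (b : ∀ n, (Fin (n + 1) → V) → W)
    (Q : ∀ n, ((Fin (n + 1) → W) → k) →ₗ[k] ((Fin (n + 1) → V) → k)) :
    ∀ n, ((Fin (n + 2) → W) → k) →ₗ[k] ((Fin (n + 1) → V) → k)
  | 0 =>
    { toFun := fun f v => Q 0 (cone (b 0 v) 0 f) v
      map_add' := fun f g => by funext v; simp
      map_smul' := fun c f => by funext v; simp }
  | n + 1 =>
    { toFun := fun f v => Q (n + 1) (cone (b (n + 1) v) (n + 1) f) v -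
        delta n (htpy b Q n (cone (b (n + 1) v) (n + 1) f)) v
      map_add' := fun f g => by funext v; simp; ring
      map_smul' := fun c f => by funext v; simp; ring }

variable {b : ∀ n, (Fin (n + 1) → V) → W}
  {Q : ∀ n, ((Fin (n + 1) → W) → k) →ₗ[k] ((Fin (n + 1) → V) → k)}

theorem htpy_zero_apply (f : (Fin 2 → W) → k) (v : Fin 1 → V) :
    htpy b Q 0 f v = Q 0 (cone (b 0 v) 0 f) v := rfl

theorem htpy_succ_apply (n : ℕ) (f : (Fin (n + 3) → W) → k) (v : Fin (n + 2) → V) :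
    htpy b Q (n + 1) f v = Q (n + 1) (cone (b (n + 1) v) (n + 1) f) v -
      delta n (htpy b Q n (cone (b (n + 1) v) (n + 1) f)) v := rfl

theorem htpy_delta_zero (hQ0 : ∀ c : k, Q 0 (fun _ => c) = 0) (f : (Fin 1 → W) → k) :
    htpy b Q 0 (delta 0 f) = Q 0 f := by
  funext v
  have : cone (b 0 v) 0 (delta 0 f) = f - fun _ => f (fun _ => b 0 v) := by
    funext w; rw [cone_delta_zero]; rfl
  rw [htpy_zero_apply, this, map_sub, hQ0, sub_zero]

/-- The homotopy formula: the coboundary of the homotopy is the difference `Q`. -/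
theorem htpy_delta_succ (hQ0 : ∀ c : k, Q 0 (fun _ => c) = 0)
    (hQ : ∀ n f, Q (n + 1) (delta n f) = delta n (Q n f)) (n : ℕ) (f : (Fin (n + 2) → W) → k) :
    htpy b Q (n + 1) (delta (n + 1) f) + delta n (htpy b Q n f) = Q (n + 1) f := by
  induction n with
  | zero =>
    funext v
    rw [Pi.add_apply, htpy_succ_apply, cone_delta_succ, map_sub, map_sub, map_sub,
      htpy_delta_zero hQ0, hQ]
    simp
  | succ n ih =>
    funext v
    have h2 := congrArg (delta (n + 1)) (ih (cone (b (n + 2) v) (n + 1) f))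
    rw [map_add, delta_delta, add_zero] at h2
    rw [Pi.add_apply, htpy_succ_apply, cone_delta_succ, map_sub, map_sub, map_sub, h2, hQ]
    simp

/-! #### Naturality and locality of the operators -/

theorem delta_comp {V' : Type*} (φ : V → V') (n : ℕ) (f : (Fin (n + 1) → V') → k)
    (v : Fin (n + 2) → V) :
    delta n (fun w => f (φ ∘ w)) v = delta n f (φ ∘ v) := rfl

theorem cone_comp {V' : Type*} (φ : V → V') (c : V) (n : ℕ) (f : (Fin (n + 2) → V') → k) :
    cone c n (fun w => f (φ ∘ w)) = fun w => cone (φ c) n f (φ ∘ w) := by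
  funext w
  rw [cone_apply, cone_apply]
  congr 1
  funext j
  refine Fin.cases ?_ (fun j => ?_) j <;> simp

theorem sd_comp {V' : Type*} {b : ∀ n, (Fin (n + 1) → V) → V}
    {b' : ∀ n, (Fin (n + 1) → V') → V'} (φ : V → V') (hb : ∀ n v, b' n (φ ∘ v) = φ (b n v))
    (n : ℕ) (f : (Fin (n + 1) → V') → k) (v : Fin (n + 1) → V) :
    sd b n (fun w => f (φ ∘ w)) v = sd b' n f (φ ∘ v) := by
  induction n with
  | zero => rfl
  | succ n ih =>
    rw [sd_succ_apply, sd_succ_apply, cone_comp, hb, ← delta_comp]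
    simp only [delta_apply]
    refine Finset.sum_congr rfl fun i _ => ?_
    rw [ih]

theorem htpy_comp {V' W' : Type*} {b' : ∀ n, (Fin (n + 1) → V') → W'}
    {Q' : ∀ n, ((Fin (n + 1) → W') → k) →ₗ[k] ((Fin (n + 1) → V') → k)} (φ : V → V') (ψ : W → W')
    (hb : ∀ n v, b' n (φ ∘ v) = ψ (b n v))
    (hQ : ∀ n f v, Q n (fun w => f (ψ ∘ w)) v = Q' n f (φ ∘ v))
    (n : ℕ) (f : (Fin (n + 2) → W') → k) (v : Fin (n + 1) → V) :
    htpy b Q n (fun w => f (ψ ∘ w)) v = htpy b' Q' n f (φ ∘ v) := by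
  induction n with
  | zero => rw [htpy_zero_apply, htpy_zero_apply, cone_comp, hb, hQ]
  | succ n ih =>
    rw [htpy_succ_apply, htpy_succ_apply, cone_comp, hb, hQ, ← delta_comp]
    simp only [delta_apply]
    congr 1
    refine Finset.sum_congr rfl fun i _ => ?_
    rw [ih]

theorem delta_eq_zero_of {n : ℕ} {f : (Fin (n + 1) → V) → k} {v : Fin (n + 2) → V}
    (h : ∀ i : Fin (n + 2), f (fun j => v (i.succAbove j)) = 0) : delta n f v = 0 := by
  rw [delta_apply]
  exact Finset.sum_eq_zero fun i _ => by rw [h i, mul_zero]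

theorem cons_mem {n : ℕ} {P : Set V} {c : V} {w : Fin n → V} (hc : c ∈ P) (hw : ∀ j, w j ∈ P)
    (j : Fin (n + 1)) : (Fin.cons c w : Fin (n + 1) → V) j ∈ P := by
  refine Fin.cases ?_ (fun j => ?_) j
  · simpa using hc
  · simpa using hw j

/-- If the cone points of tuples in `P` lie in `P'`, then `htpy f` on tuples in `P` depends only on
`f` on tuples in `P'`. -/
theorem htpy_eq_zero_of (P : Set V) (P' : Set W)
    (hb : ∀ n v, (∀ j, v j ∈ P) → b n v ∈ P')
    (hQ : ∀ n f v, (∀ j, v j ∈ P) → (∀ w, (∀ j, w j ∈ P') → f w = 0) → Q n f v = 0)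
    (n : ℕ) (f : (Fin (n + 2) → W) → k) (hf : ∀ w, (∀ j, w j ∈ P') → f w = 0)
    (v : Fin (n + 1) → V) (hv : ∀ j, v j ∈ P) : htpy b Q n f v = 0 := by
  induction n with
  | zero =>
    rw [htpy_zero_apply]
    exact hQ _ _ _ hv fun w hw => hf _ (cons_mem (hb _ _ hv) hw)
  | succ n ih =>
    have h0 : Q (n + 1) (cone (b (n + 1) v) (n + 1) f) v = 0 :=
      hQ _ _ _ hv fun w hw => hf _ (cons_mem (hb _ _ hv) hw)
    rw [htpy_succ_apply, h0, zero_sub, neg_eq_zero]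
    exact delta_eq_zero_of fun i =>
      ih _ (fun w hw => hf _ (cons_mem (hb _ _ hv) hw)) _ fun j => hv _

theorem sd_eq_zero_of {b : ∀ n, (Fin (n + 1) → V) → V} (P : Set V)
    (hb : ∀ n v, (∀ j, v j ∈ P) → b n v ∈ P)
    (n : ℕ) (f : (Fin (n + 1) → V) → k) (hf : ∀ w, (∀ j, w j ∈ P) → f w = 0)
    (v : Fin (n + 1) → V) (hv : ∀ j, v j ∈ P) : sd b n f v = 0 := by
  induction n with
  | zero => exact hf v hv
  | succ n ih =>
    rw [sd_succ_apply]
    exact delta_eq_zero_of fun i =>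
      ih _ (fun w hw => hf _ (cons_mem (hb _ _ hv) hw)) _ fun j => hv _

end TupleCochain
end

noncomputable section

/-! ### The total cochain ring of a simplicial set and its cohomology ring -/

namespace SingCoh

open CategoryTheory

/-- The front face `[p] → [n]`, `i ↦ i`, extended to all pairs `p`, `n` by truncation. -/
def frontFace (p n : ℕ) : SimplexCategory.mk p ⟶ SimplexCategory.mk n :=
  SimplexCategory.mkHom ⟨fun i => ⟨min i n, by omega⟩, fun a b hab => by
    rw [Fin.le_def] at hab ⊢; simp only; omega⟩

/-- The back face `[q] → [n]`, `i ↦ n - q + i`, extended to all pairs `q`, `n` by truncation. -/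
def backFace (q n : ℕ) : SimplexCategory.mk q ⟶ SimplexCategory.mk n :=
  SimplexCategory.mkHom ⟨fun i => ⟨n - (q - i), by omega⟩, fun a b hab => by
    rw [Fin.le_def] at hab ⊢; simp only; omega⟩

theorem frontFace_eq_front {p q n : ℕ} (h : p + q = n) : frontFace p n = front h := by
  ext x
  change Fin (p + 1) at x
  have hx := x.2
  change min (x : ℕ) n = (x : ℕ)
  omega

theorem backFace_eq_back {p q n : ℕ} (h : p + q = n) : backFace q n = back h := by
  ext x
  change Fin (q + 1) at x
  have hx := x.2
  change n - (q - (x : ℕ)) = p + (x : ℕ)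
  omega

theorem frontFace_self (n : ℕ) : frontFace n n = 𝟙 _ := by
  ext x
  change Fin (n + 1) at x
  have hx := x.2
  change min (x : ℕ) n = (x : ℕ)
  omega

theorem backFace_self (n : ℕ) : backFace n n = 𝟙 _ := by
  ext x
  change Fin (n + 1) at x
  have hx := x.2
  change n - (n - (x : ℕ)) = (x : ℕ)
  omega

theorem frontFace_comp {p a n : ℕ} (h : p ≤ a) (h' : a ≤ n) :
    frontFace p a ≫ frontFace a n = frontFace p n := by
  ext x
  change Fin (p + 1) at x
  have hx := x.2
  change min (min (x : ℕ) a) n = min (x : ℕ) n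
  omega

theorem backFace_comp {r b n : ℕ} (h : r ≤ b) (h' : b ≤ n) :
    backFace r b ≫ backFace b n = backFace r n := by
  ext x
  change Fin (r + 1) at x
  have hx := x.2
  change n - (b - (b - (r - (x : ℕ)))) = n - (r - (x : ℕ))
  omega

theorem backFace_comp_frontFace {p q r : ℕ} :
    backFace q (p + q) ≫ frontFace (p + q) (p + q + r) =
      frontFace q (q + r) ≫ backFace (q + r) (p + q + r) := by
  ext x
  change Fin (q + 1) at x
  have hx := x.2
  change min (p + q - (q - (x : ℕ))) (p + q + r) = p + q + r - (q + r - min (x : ℕ) (q + r))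
  omega

/-- The product over all degrees of the cochain groups of a simplicial set. It is a differential
ring under the cup product; the degree enters through the projections `Tot.comp`. -/
structure Tot (k : Type*) (S : SSet.{0}) where
  /-- The component in degree `n`. -/
  ev : ∀ n, Cochain k S n

namespace Tot

section
variable {k : Type*} {S : SSet.{0}}

instance : CoeFun (Tot k S) (fun _ => ∀ n, Cochain k S n) := ⟨ev⟩

@[ext] theorem ext {x y : Tot k S} (h : ∀ n σ, x n σ = y n σ) : x = y := by
  cases x; cases y
  congr 1
  exact funext fun n => funext fun σ => h n σ

theorem ext_deg {x y : Tot k S} (h : ∀ n, x n = y n) : x = y :=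
  ext fun n σ => by rw [h]

theorem ev_injective : Function.Injective (ev : Tot k S → ∀ n, Cochain k S n) :=
  fun _ _ h => ext fun n σ => congrFun (congrFun h n) σ
end

variable {k : Type*} [CommRing k] {S S' S'' : SSet.{0}}

instance : Zero (Tot k S) := ⟨⟨0⟩⟩
instance : Add (Tot k S) := ⟨fun x y => ⟨x.ev + y.ev⟩⟩
instance : Neg (Tot k S) := ⟨fun x => ⟨-x.ev⟩⟩
instance : Sub (Tot k S) := ⟨fun x y => ⟨x.ev - y.ev⟩⟩
instance {R : Type*} [SMul R k] : SMul R (Tot k S) := ⟨fun c x => ⟨c • x.ev⟩⟩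

instance : AddCommGroup (Tot k S) :=
  Function.Injective.addCommGroup ev ev_injective rfl (fun _ _ => rfl) (fun _ => rfl)
    (fun _ _ => rfl) (fun _ _ => rfl) (fun _ _ => rfl)

instance : Module k (Tot k S) :=
  Function.Injective.module k (⟨⟨ev, rfl⟩, fun _ _ => rfl⟩ : Tot k S →+ ∀ n, Cochain k S n)
    ev_injective (fun _ _ => rfl)

@[simp] theorem add_apply (x y : Tot k S) (n σ) : (x + y) n σ = x n σ + y n σ := rfl
@[simp] theorem sub_apply (x y : Tot k S) (n σ) : (x - y) n σ = x n σ - y n σ := rfl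
@[simp] theorem neg_apply (x : Tot k S) (n σ) : (-x) n σ = -x n σ := rfl
@[simp] theorem zero_apply (n σ) : (0 : Tot k S) n σ = 0 := rfl
@[simp] theorem smul_apply (c : k) (x : Tot k S) (n σ) : (c • x) n σ = c * x n σ := rfl

instance : Mul (Tot k S) where
  mul x y := ⟨fun n σ => ∑ p ∈ Finset.HasAntidiagonal.antidiagonal n,
    x p.1 (S.map (frontFace p.1 n).op σ) * y p.2 (S.map (backFace p.2 n).op σ)⟩

theorem mul_apply (x y : Tot k S) (n σ) : (x * y) n σ = ∑ p ∈ Finset.HasAntidiagonal.antidiagonal n,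
    x p.1 (S.map (frontFace p.1 n).op σ) * y p.2 (S.map (backFace p.2 n).op σ) := rfl

instance : One (Tot k S) where
  one := ⟨fun n _ => if n = 0 then 1 else 0⟩

theorem one_apply (n σ) : (1 : Tot k S) n σ = if n = 0 then 1 else 0 := rfl

theorem one_mul' (x : Tot k S) : 1 * x = x := by
  ext n σ
  rw [mul_apply, Finset.sum_eq_single (0, n)]
  · simp [one_apply, backFace_self]
  · rintro ⟨p, q⟩ h1 h2
    rw [one_apply, if_neg, zero_mul]
    rintro rfl
    simp at h1
    exact h2 (by simp [h1])
  · simp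

theorem mul_one' (x : Tot k S) : x * 1 = x := by
  ext n σ
  rw [mul_apply, Finset.sum_eq_single (n, 0)]
  · simp [one_apply, frontFace_self]
  · rintro ⟨p, q⟩ h1 h2
    rw [one_apply, if_neg, mul_zero]
    rintro rfl
    simp at h1
    exact h2 (by simp [h1])
  · simp

theorem map_map {a b c : ℕ} (f : SimplexCategory.mk a ⟶ SimplexCategory.mk b)
    (g : SimplexCategory.mk b ⟶ SimplexCategory.mk c) (σ : S.obj (.op (.mk c))) :
    S.map f.op (S.map g.op σ) = S.map (f ≫ g).op σ := by
  simp

theorem mul_assoc' (x y z : Tot k S) : x * y * z = x * (y * z) := by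
  ext n σ
  simp only [mul_apply, Finset.sum_mul, Finset.mul_sum, Finset.sum_sigma']
  refine Finset.sum_nbij' (fun u => ⟨(u.2.1, u.2.2 + u.1.2), (u.2.2, u.1.2)⟩)
    (fun u => ⟨(u.1.1 + u.2.1, u.2.2), (u.1.1, u.2.1)⟩) ?_ ?_ ?_ ?_ ?_
  · rintro ⟨⟨a, r⟩, ⟨p, q⟩⟩ h
    simp at h ⊢; omega
  · rintro ⟨⟨a, r⟩, ⟨p, q⟩⟩ h
    simp at h ⊢; omega
  · rintro ⟨⟨a, r⟩, ⟨p, q⟩⟩ h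
    simp at h ⊢; omega
  · rintro ⟨⟨a, r⟩, ⟨p, q⟩⟩ h
    simp at h ⊢; omega
  · rintro ⟨⟨a, r⟩, ⟨p, q⟩⟩ h
    simp only [Finset.mem_sigma, Finset.HasAntidiagonal.mem_antidiagonal] at h
    obtain ⟨rfl, rfl⟩ := h
    simp only [map_map]
    rw [frontFace_comp (by omega) (by omega), backFace_comp (by omega) (by omega),
      backFace_comp_frontFace, mul_assoc]

instance : Ring (Tot k S) :=
  { (inferInstance : AddCommGroup (Tot k S)), (inferInstance : Mul (Tot k S)),
    (inferInstance : One (Tot k S)) with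
    mul_assoc := mul_assoc'
    one_mul := one_mul'
    mul_one := mul_one'
    zero_mul := fun x => by ext n σ; simp [mul_apply]
    mul_zero := fun x => by ext n σ; simp [mul_apply]
    left_distrib := fun x y z => by ext n σ; simp [mul_apply, mul_add, Finset.sum_add_distrib]
    right_distrib := fun x y z => by ext n σ; simp [mul_apply, add_mul, Finset.sum_add_distrib] }

instance : Algebra k (Tot k S) :=
  Algebra.ofModule (fun c x y => by ext n σ; simp [mul_apply, Finset.mul_sum, mul_assoc])
    (fun c x y => by ext n σ; simp [mul_apply, Finset.mul_sum, mul_left_comm])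

/-- The coboundary. -/
def d : Tot k S →ₗ[k] Tot k S where
  toFun x := ⟨fun n => match n with
    | 0 => 0
    | n + 1 => coboundary k n (x n)⟩
  map_add' x y := by
    refine ext_deg fun n => ?_
    cases n with
    | zero => exact (add_zero _).symm
    | succ n => exact map_add (coboundary k n) (x n) (y n)
  map_smul' c x := by
    refine ext_deg fun n => ?_
    cases n with
    | zero => exact (smul_zero c).symm
    | succ n => exact map_smul (coboundary k n) c (x n)

theorem d_zero_apply (x : Tot k S) : d x 0 = 0 := rfl
theorem d_succ_apply (x : Tot k S) (n : ℕ) : d x (n + 1) = coboundary k n (x n) := rfl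
theorem d_apply (x : Tot k S) (n : ℕ) (σ : S.obj (.op (.mk (n + 1)))) :
    d x (n + 1) σ = ∑ i : Fin (n + 2), (-1) ^ (i : ℕ) * x n (S.δ i σ) := rfl

theorem d_d (x : Tot k S) : d (d x) = 0 := by
  refine ext_deg fun n => ?_
  match n with
  | 0 => rfl
  | 1 =>
    rw [d_succ_apply, d_zero_apply, map_zero]; rfl
  | n + 2 =>
    funext σ
    simp only [d_apply, Finset.mul_sum, ← mul_assoc, ← pow_add, zero_apply]
    refine TupleCochain.alternating_sum_sum_eq_zero
      (fun i j => x n (S.δ j (S.δ i σ))) fun i j hij => ?_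
    have := congrArg (fun f => f σ) (S.δ_comp_δ hij)
    exact congrArg (x n) this

/-- The sign automorphism `x ↦ (-1)^{deg x} x`. -/
def eps : Tot k S →ₗ[k] Tot k S where
  toFun x := ⟨fun n => (-1 : k) ^ n • x n⟩
  map_add' x y := by
    ext n σ
    exact mul_add _ _ _
  map_smul' c x := by
    ext n σ
    exact mul_left_comm _ _ _

theorem eps_apply (x : Tot k S) (n σ) : eps x n σ = (-1) ^ n * x n σ := rfl

@[simp] theorem eps_eps (x : Tot k S) : eps (eps x) = x := by
  ext n σ
  rw [eps_apply, eps_apply, ← mul_assoc, ← mul_pow]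
  simp

theorem eps_d (x : Tot k S) : eps (d x) = - d (eps x) := by
  ext n σ
  cases n with
  | zero => rw [eps_apply, neg_apply, d_zero_apply, d_zero_apply]; simp
  | succ n =>
    simp only [eps_apply, neg_apply, d_apply, Finset.mul_sum, ← Finset.sum_neg_distrib]
    refine Finset.sum_congr rfl fun i _ => ?_
    ring

theorem mul_eq_sum_cup (x y : Tot k S) (n : ℕ) : (x * y) n =
    ∑ p ∈ (Finset.HasAntidiagonal.antidiagonal n).attach,
      cup (Finset.HasAntidiagonal.mem_antidiagonal.1 p.2) (x p.1.1) (y p.1.2) := by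
  funext σ
  rw [mul_apply, Finset.sum_apply, ← Finset.sum_attach]
  refine Finset.sum_congr rfl fun p _ => ?_
  rw [cup, frontFace_eq_front (Finset.HasAntidiagonal.mem_antidiagonal.1 p.2),
    backFace_eq_back (Finset.HasAntidiagonal.mem_antidiagonal.1 p.2)]

theorem d_mul (x y : Tot k S) : d (x * y) = d x * y + eps x * d y := by
  refine ext_deg fun n => ?_
  cases n with
  | zero =>
    funext σ
    simp [mul_apply, d_zero_apply]
  | succ n =>
    rw [d_succ_apply, mul_eq_sum_cup, map_sum]
    funext σ
    rw [add_apply, mul_apply, mul_apply, Finset.Nat.sum_antidiagonal_succ,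
      Finset.Nat.sum_antidiagonal_succ', Finset.sum_apply]
    simp only [d_zero_apply, Pi.zero_apply, zero_mul, mul_zero, zero_add]
    rw [← Finset.sum_add_distrib, ← Finset.sum_attach (Finset.HasAntidiagonal.antidiagonal n)]
    refine Finset.sum_congr rfl fun p _ => ?_
    obtain ⟨⟨p, q⟩, h⟩ := p
    rw [Finset.HasAntidiagonal.mem_antidiagonal] at h
    simp only at h
    rw [coboundary_cup h (by omega) (by omega)]
    simp only [Pi.add_apply, Pi.smul_apply, cup, smul_eq_mul, d_succ_apply, eps_apply]
    rw [frontFace_eq_front (by omega : p + 1 + q = n + 1),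
      backFace_eq_back (by omega : p + 1 + q = n + 1),
      frontFace_eq_front (by omega : p + (q + 1) = n + 1),
      backFace_eq_back (by omega : p + (q + 1) = n + 1), mul_assoc]

/-- The component of degree `n`. -/
def comp (n : ℕ) : Tot k S →ₗ[k] Tot k S where
  toFun x := ⟨fun m => if m = n then x m else 0⟩
  map_add' x y := by
    ext m σ
    change (if m = n then (x + y) m else 0) σ =
      (if m = n then x m else 0) σ + (if m = n then y m else 0) σ
    split_ifs <;> simp
  map_smul' c x := by
    ext m σ
    change (if m = n then (c • x) m else 0) σ = c * (if m = n then x m else 0) σ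
    split_ifs <;> simp

theorem comp_apply (n : ℕ) (x : Tot k S) (m : ℕ) : comp n x m = if m = n then x m else 0 := rfl

theorem comp_d (n : ℕ) (x : Tot k S) : comp (n + 1) (d x) = d (comp n x) := by
  refine ext_deg fun m => ?_
  cases m with
  | zero => rw [comp_apply, if_neg (by omega)]; rfl
  | succ m =>
    rw [comp_apply, d_succ_apply, d_succ_apply, comp_apply]
    by_cases h : m = n <;> simp [h]

theorem comp_zero_d (x : Tot k S) : comp 0 (d x) = 0 := by
  refine ext_deg fun m => ?_
  rw [comp_apply]
  split_ifs with h
  · subst h; rfl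
  · rfl

theorem comp_comp_self (n : ℕ) (x : Tot k S) : comp n (comp n x) = comp n x := by
  refine ext_deg fun m => ?_
  simp only [comp_apply]
  split_ifs <;> rfl

theorem comp_mul_of_homogeneous {q : ℕ} {y : Tot k S} (hy : comp q y = y) (n : ℕ) (x : Tot k S) :
    comp (n + q) (x * y) = comp n x * y := by
  have hy0 : ∀ m, m ≠ q → y m = 0 := fun m hm => by rw [← hy, comp_apply, if_neg hm]
  ext m σ
  rw [comp_apply]
  split_ifs with h
  · subst h
    rw [mul_apply, mul_apply]
    refine Finset.sum_congr rfl fun p hp => ?_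
    rw [Finset.HasAntidiagonal.mem_antidiagonal] at hp
    by_cases h2 : p.2 = q
    · have : p.1 = n := by omega
      rw [comp_apply, if_pos this]
    · simp [hy0 _ h2]
  · rw [mul_apply, Finset.sum_eq_zero]
    · rfl
    rintro p hp
    rw [Finset.HasAntidiagonal.mem_antidiagonal] at hp
    by_cases h2 : p.2 = q
    · have : p.1 ≠ n := by omega
      rw [comp_apply, if_neg this]; simp
    · simp [hy0 _ h2]

theorem comp_mul_of_lt {q n : ℕ} {y : Tot k S} (hy : comp q y = y) (h : n < q) (x : Tot k S) :
    comp n (x * y) = 0 := by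
  have hy0 : ∀ m, m ≠ q → y m = 0 := fun m hm => by rw [← hy, comp_apply, if_neg hm]
  ext m σ
  rw [comp_apply]
  split_ifs with hm
  · subst hm
    rw [mul_apply, Finset.sum_eq_zero]
    · rfl
    rintro p hp
    rw [Finset.HasAntidiagonal.mem_antidiagonal] at hp
    rw [hy0 p.2 (by omega)]; simp
  · rfl

/-- Pullback of cochains along a simplicial map. -/
def pull (φ : S ⟶ S') : Tot k S' →ₐ[k] Tot k S :=
  AlgHom.ofLinearMap
    { toFun := fun x => ⟨fun n σ => x n (φ.app _ σ)⟩
      map_add' := fun x y => rfl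
      map_smul' := fun c x => rfl }
    (by ext n σ; rfl)
    (by
      intro x y
      ext n σ
      simp only [LinearMap.coe_mk, AddHom.coe_mk, mul_apply]
      simp only [NatTrans.naturality_apply])

theorem pull_apply (φ : S ⟶ S') (x : Tot k S') (n σ) : pull φ x n σ = x n (φ.app _ σ) := rfl

theorem pull_d (φ : S ⟶ S') (x : Tot k S') : pull φ (d x) = d (pull φ x) := by
  ext n σ
  cases n with
  | zero => rfl
  | succ n =>
    rw [pull_apply, d_apply, d_apply]
    refine Finset.sum_congr rfl fun i _ => ?_
    rw [pull_apply]
    congr 2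
    exact (NatTrans.naturality_apply φ _ _).symm

theorem pull_eps (φ : S ⟶ S') (x : Tot k S') : pull φ (eps x) = eps (pull φ x) := rfl

theorem pull_comp (φ : S ⟶ S') (n : ℕ) (x : Tot k S') :
    pull φ (comp n x) = comp n (pull φ x) := by
  ext m σ
  rw [pull_apply, comp_apply, comp_apply]
  split_ifs <;> rfl

theorem pull_pull (φ : S ⟶ S') (ψ : S' ⟶ S'') (x : Tot k S'') :
    pull φ (pull ψ x) = pull (φ ≫ ψ) x := rfl

theorem eps_one : eps (1 : Tot k S) = 1 := by
  ext n σ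
  rw [eps_apply, one_apply]
  split_ifs with h <;> simp [h]

theorem d_one : d (1 : Tot k S) = 0 := by
  have h := d_mul (1 : Tot k S) 1
  rw [mul_one, mul_one, eps_one, one_mul] at h
  simpa using h

theorem d_mul_eq_zero {x y : Tot k S} (hx : d x = 0) (hy : d y = 0) : d (x * y) = 0 := by
  rw [d_mul, hx, hy, zero_mul, mul_zero, add_zero]

theorem d_add_eq_zero {x y : Tot k S} (hx : d x = 0) (hy : d y = 0) : d (x + y) = 0 := by
  rw [map_add, hx, hy, add_zero]

end Tot

variable (k : Type*) [CommRing k] (S : SSet.{0})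

/-- The ring of cocycles. -/
def cocycleRing : Subalgebra k (Tot k S) where
  carrier := {x | Tot.d x = 0}
  mul_mem' := by
    intro x y hx hy
    simp only [Set.mem_ofPred_eq] at *
    rw [Tot.d_mul, hx, hy]; simp
  add_mem' := by
    intro x y hx hy
    simp only [Set.mem_ofPred_eq] at *
    rw [map_add, hx, hy, add_zero]
  algebraMap_mem' c := by
    simp only [Set.mem_ofPred_eq]
    rw [Algebra.algebraMap_eq_smul_one, map_smul, Tot.d_one, smul_zero]

/-- The two-sided ideal of coboundaries in the ring of cocycles. -/
def coboundaryIdeal : Ideal (cocycleRing k S) where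
  carrier := {x | ∃ y, Tot.d y = x.1}
  add_mem' := by
    rintro _ _ ⟨x, hx⟩ ⟨y, hy⟩
    exact ⟨x + y, by rw [map_add, hx, hy]; rfl⟩
  zero_mem' := ⟨0, map_zero _⟩
  smul_mem' := by
    rintro x y ⟨z, hz⟩
    have hx : Tot.d x.1 = 0 := x.2
    refine ⟨Tot.eps x.1 * z, ?_⟩
    have h2 : Tot.d (Tot.eps x.1) = 0 := by
      have := Tot.eps_d x.1
      rw [hx, map_zero] at this
      exact neg_eq_zero.1 this.symm
    rw [Tot.d_mul, h2, Tot.eps_eps, hz, zero_mul, zero_add]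
    rfl

instance : (coboundaryIdeal k S).IsTwoSided where
  mul_mem_of_left := by
    rintro x y ⟨z, hz⟩
    have hy : Tot.d y.1 = 0 := y.2
    exact ⟨z * y.1, by rw [Tot.d_mul, hy, hz, mul_zero, add_zero]; rfl⟩

/-- The total cohomology ring (the product over all degrees) of a simplicial set. -/
def TotCoh : Type _ := cocycleRing k S ⧸ coboundaryIdeal k S

instance : Ring (TotCoh k S) := inferInstanceAs (Ring (cocycleRing k S ⧸ coboundaryIdeal k S))
instance : Algebra k (TotCoh k S) :=
  inferInstanceAs (Algebra k (cocycleRing k S ⧸ coboundaryIdeal k S))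

namespace TotCoh
variable {k S} {S' S'' : SSet.{0}}

/-- The class of a cocycle. -/
def cls (x : Tot k S) (hx : Tot.d x = 0) : TotCoh k S := Ideal.Quotient.mk _ ⟨x, hx⟩

theorem exists_rep (h : TotCoh k S) : ∃ x hx, h = cls x hx := by
  obtain ⟨x, rfl⟩ := Ideal.Quotient.mk_surjective h
  exact ⟨x.1, x.2, rfl⟩

theorem cls_eq_zero {x : Tot k S} {hx : Tot.d x = 0} : cls x hx = 0 ↔ ∃ y, Tot.d y = x :=
  Ideal.Quotient.eq_zero_iff_mem

theorem cls_eq_cls {x y : Tot k S} {hx : Tot.d x = 0} {hy : Tot.d y = 0} :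
    cls x hx = cls y hy ↔ ∃ z, Tot.d z = x - y :=
  Ideal.Quotient.eq

theorem cls_mul {x y : Tot k S} (hx : Tot.d x = 0) (hy : Tot.d y = 0) :
    cls x hx * cls y hy = cls (x * y) (Tot.d_mul_eq_zero hx hy) := rfl

theorem cls_add {x y : Tot k S} (hx : Tot.d x = 0) (hy : Tot.d y = 0) :
    cls x hx + cls y hy = cls (x + y) (Tot.d_add_eq_zero hx hy) := rfl

/-- Pullback in cohomology. -/
def pull (k : Type*) [CommRing k] (φ : S ⟶ S') : TotCoh k S' →ₐ[k] TotCoh k S :=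
  Ideal.Quotient.liftₐ _
    ((Ideal.Quotient.mkₐ k (coboundaryIdeal k S)).comp
      (((Tot.pull φ).comp (cocycleRing k S').val).codRestrict (cocycleRing k S) (fun x => by
        change Tot.d (Tot.pull φ x.1) = 0
        rw [← Tot.pull_d, show Tot.d x.1 = 0 from x.2, map_zero])))
    (by
      rintro x ⟨y, hy⟩
      refine Ideal.Quotient.eq_zero_iff_mem.2 ⟨Tot.pull φ y, ?_⟩
      rw [← Tot.pull_d, hy]; rfl)

theorem pull_cls (φ : S ⟶ S') (x : Tot k S') (hx : Tot.d x = 0) :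
    pull k φ (cls x hx) = cls (Tot.pull φ x) (by rw [← Tot.pull_d, hx, map_zero]) := rfl

theorem pull_pull (φ : S ⟶ S') (ψ : S' ⟶ S'') (x : TotCoh k S'') :
    pull k φ (pull k ψ x) = pull k (φ ≫ ψ) x := by
  obtain ⟨x, hx, rfl⟩ := exists_rep x
  rfl

theorem comp_closed {x : Tot k S} (hx : Tot.d x = 0) (n : ℕ) : Tot.d (Tot.comp n x) = 0 := by
  rw [← Tot.comp_d, hx, map_zero]

/-- The classes of homogeneous cocycles of degree `n`. -/
def homogeneous (k : Type*) [CommRing k] (S : SSet.{0}) (n : ℕ) : Submodule k (TotCoh k S) where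
  carrier := {h | ∃ x hx, Tot.comp n x = x ∧ h = cls x hx}
  add_mem' := by
    rintro _ _ ⟨x, hx, h, rfl⟩ ⟨y, hy, h', rfl⟩
    exact ⟨x + y, _, by rw [map_add, h, h'], cls_add hx hy⟩
  zero_mem' := ⟨0, map_zero _, map_zero _, rfl⟩
  smul_mem' := by
    rintro c _ ⟨x, hx, h, rfl⟩
    exact ⟨c • x, by rw [map_smul, hx, smul_zero], by rw [map_smul, h], rfl⟩

theorem pull_mem_homogeneous (φ : S ⟶ S') {n : ℕ} {h : TotCoh k S'}
    (hh : h ∈ homogeneous k S' n) : pull k φ h ∈ homogeneous k S n := by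
  obtain ⟨x, hx, h, rfl⟩ := hh
  exact ⟨_, _, by rw [← Tot.pull_comp, h], pull_cls φ x hx⟩

theorem mul_mem_homogeneous {p q : ℕ} {a b : TotCoh k S}
    (ha : a ∈ homogeneous k S p) (hb : b ∈ homogeneous k S q) :
    a * b ∈ homogeneous k S (p + q) := by
  obtain ⟨x, hx, h, rfl⟩ := ha
  obtain ⟨y, hy, h', rfl⟩ := hb
  exact ⟨_, _, by rw [Tot.comp_mul_of_homogeneous h', h], cls_mul hx hy⟩

theorem one_mem_homogeneous : (1 : TotCoh k S) ∈ homogeneous k S 0 :=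
  ⟨1, Tot.d_one, by
    ext n σ
    rw [Tot.comp_apply]
    split_ifs with h
    · rfl
    · rw [Tot.one_apply, if_neg h]; rfl, rfl⟩

/-- If a homogeneous class is a multiple of a homogeneous class `c`, the cofactor can be chosen
homogeneous. -/
theorem exists_homogeneous_cofactor {n q : ℕ} {h y c : TotCoh k S}
    (hc : c ∈ homogeneous k S q) (hh : h ∈ homogeneous k S n) (e : h = y * c) :
    (n < q ∧ h = 0) ∨ ∃ p, p + q = n ∧ ∃ y' ∈ homogeneous k S p, h = y' * c := by
  obtain ⟨x, hx, h1, rfl⟩ := hh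
  obtain ⟨c, hc, h2, rfl⟩ := hc
  obtain ⟨y, hy, rfl⟩ := exists_rep y
  rw [cls_mul, cls_eq_cls] at e
  obtain ⟨z, hz⟩ := e
  have key : ∃ z', Tot.d z' = x - Tot.comp n (y * c) := by
    rw [← h1, ← map_sub, ← hz]
    cases n with
    | zero => exact ⟨0, by rw [Tot.comp_zero_d, map_zero]⟩
    | succ n => exact ⟨_, (Tot.comp_d _ _).symm⟩
  by_cases hn : n < q
  · refine .inl ⟨hn, ?_⟩
    rw [Tot.comp_mul_of_lt h2 hn, sub_zero] at key
    exact cls_eq_zero.2 key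
  · refine .inr ⟨n - q, by omega, cls (Tot.comp (n - q) y) (comp_closed hy _),
      ⟨_, _, Tot.comp_comp_self _ _, rfl⟩, ?_⟩
    rw [cls_mul, cls_eq_cls, ← Tot.comp_mul_of_homogeneous h2]
    rwa [show n - q + q = n by omega]

end TotCoh
end SingCoh
end

noncomputable section

/-! ### Singular simplices: affine simplices and homotopy invariance -/

namespace SingCoh

open CategoryTheory TupleCochain

/-- The standard topological `n`-simplex. -/
abbrev Simp (n : ℕ) : Type := stdSimplex ℝ (Fin (n + 1))

/-- The singular simplicial set of a space. -/
abbrev Sing (X : Type) [TopologicalSpace X] : SSet.{0} := TopCat.toSSet.obj (TopCat.of X)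

/-- The face map between standard simplices. -/
def faceMap {n : ℕ} (i : Fin (n + 2)) : C(Simp n, Simp (n + 1)) :=
  ⟨stdSimplex.map i.succAbove, stdSimplex.continuous_map _⟩

/-- The affine map of standard simplices induced by a map of vertices. -/
def vertexMap {a b : ℕ} (f : SimplexCategory.mk a ⟶ SimplexCategory.mk b) :
    C(Simp a, Simp b) :=
  ⟨stdSimplex.map (X := Fin (a + 1)) (Y := Fin (b + 1)) f.toOrderHom,
    stdSimplex.continuous_map _⟩

section
variable {X Y Z : Type} [TopologicalSpace X] [TopologicalSpace Y] [TopologicalSpace Z]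

/-- A continuous map from the standard simplex, as a simplex of the singular simplicial set. -/
def smp {n : ℕ} : C(Simp n, X) ≃ (Sing X).obj (.op (.mk n)) :=
  (TopCat.toSSetObjEquiv (TopCat.of X) (.op (.mk n))).symm

theorem map_smp {a b : ℕ} (f : SimplexCategory.mk a ⟶ SimplexCategory.mk b)
    (σ : C(Simp b, X)) : (Sing X).map f.op (smp σ) = smp (σ.comp (vertexMap f)) := rfl

theorem δ_smp {n : ℕ} (i : Fin (n + 2)) (σ : C(Simp (n + 1), X)) :
    (Sing X).δ i (smp σ) = smp (σ.comp (faceMap i)) := rfl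

/-- The simplicial map induced by a continuous map. -/
def singMap (g : C(X, Y)) : Sing X ⟶ Sing Y := TopCat.toSSet.map (TopCat.ofHom g)

theorem singMap_smp (g : C(X, Y)) {n : ℕ} (σ : C(Simp n, X)) :
    (singMap g).app _ (smp σ) = smp (g.comp σ) := rfl

theorem singMap_comp (g : C(X, Y)) (h : C(Y, Z)) : singMap (h.comp g) = singMap g ≫ singMap h :=
  TopCat.toSSet.map_comp (TopCat.ofHom g) (TopCat.ofHom h)

theorem singMap_id : singMap (ContinuousMap.id X) = 𝟙 (Sing X) :=
  TopCat.toSSet.map_id (TopCat.of X)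

theorem tot_ext {k : Type*} {x y : Tot k (Sing X)}
    (h : ∀ n (σ : C(Simp n, X)), x n (smp σ) = y n (smp σ)) : x = y :=
  Tot.ext fun n σ => by
    have := h n (smp.symm σ)
    rwa [Equiv.apply_symm_apply] at this

end

section Affine
variable {E : Type*} [NormedAddCommGroup E] [NormedSpace ℝ E] {s : Set E}

/-- The affine simplex with the given vertices in a convex set. -/
def aff (hs : Convex ℝ s) {n : ℕ} (v : Fin (n + 1) → s) : C(Simp n, s) where
  toFun t := ⟨∑ i, t i • (v i : E),
    hs.sum_mem (fun i _ => stdSimplex.zero_le t i) (stdSimplex.sum_eq_one t) fun i _ => (v i).2⟩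
  continuous_toFun := by
    refine Continuous.subtype_mk (continuous_finsetSum _ fun i _ => ?_) _
    exact ((continuous_apply i).comp continuous_subtype_val).smul continuous_const

theorem aff_apply (hs : Convex ℝ s) {n : ℕ} (v : Fin (n + 1) → s) (t : Simp n) :
    (aff hs v t : E) = ∑ i, t i • (v i : E) := rfl

theorem aff_mem (hs : Convex ℝ s) {n : ℕ} (v : Fin (n + 1) → s) (t : Simp n) {C : Set E}
    (hC : Convex ℝ C) (hv : ∀ i, (v i : E) ∈ C) : (aff hs v t : E) ∈ C :=
  hC.sum_mem (fun i _ => stdSimplex.zero_le t i) (stdSimplex.sum_eq_one t) fun i _ => hv i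

theorem sum_map_smul {a b : ℕ} (f : Fin (a + 1) → Fin (b + 1)) (t : Simp a)
    (v : Fin (b + 1) → E) : ∑ j, stdSimplex.map f t j • v j = ∑ i, t i • v (f i) := by
  simp only [stdSimplex.map_coe, FunOnFinite.linearMap_apply_apply, Finset.sum_smul]
  rw [← Finset.sum_fiberwise Finset.univ f (fun i => t i • v (f i))]
  refine Finset.sum_congr rfl fun j _ => Finset.sum_congr rfl fun i hi => ?_
  rw [(Finset.mem_filter.1 hi).2]

theorem aff_comp_map (hs : Convex ℝ s) {a b : ℕ} (f : Fin (a + 1) → Fin (b + 1))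
    (v : Fin (b + 1) → s) (t : Simp a) :
    aff hs v (stdSimplex.map f t) = aff hs (fun i => v (f i)) t :=
  Subtype.ext (by rw [aff_apply, aff_apply]; exact sum_map_smul f t fun j => (v j : E))

theorem aff_face (hs : Convex ℝ s) {n : ℕ} (i : Fin (n + 2)) (v : Fin (n + 2) → s) :
    (aff hs v).comp (faceMap i) = aff hs (fun j => v (i.succAbove j)) :=
  ContinuousMap.ext fun t => aff_comp_map hs _ v t

theorem aff_const (hs : Convex ℝ s) {n : ℕ} (c : s) (t : Simp n) :
    aff hs (fun _ => c) t = c :=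
  Subtype.ext (by rw [aff_apply, ← Finset.sum_smul, stdSimplex.sum_eq_one, one_smul])

end Affine

/-- The affine simplex with the given vertices in a standard simplex. -/
abbrev affS {N n : ℕ} (v : Fin (n + 1) → Simp N) : C(Simp n, Simp N) :=
  aff (convex_stdSimplex ℝ (Fin (N + 1))) v

/-- The vertices of the standard simplex. -/
def verts (N : ℕ) : Fin (N + 1) → Simp N := fun i => stdSimplex.vertex i

theorem affS_verts (N : ℕ) : affS (verts N) = ContinuousMap.id _ := by
  ext t j
  change (aff (convex_stdSimplex ℝ (Fin (N + 1))) (verts N) t).1 j = t j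
  rw [aff_apply, Finset.sum_apply]
  simp only [Pi.smul_apply, smul_eq_mul, verts]
  rw [Finset.sum_eq_single j]
  · simp
  · intro i _ hij
    simp [Pi.single_eq_of_ne hij.symm]
  · simp

theorem faceMap_verts {n : ℕ} (i : Fin (n + 2)) :
    faceMap i ∘ verts n = fun j => verts (n + 1) (i.succAbove j) :=
  funext fun _ => stdSimplex.map_vertex _ _

theorem faceMap_affS {N n : ℕ} (i : Fin (N + 2)) (w : Fin (n + 1) → Simp N) :
    (faceMap i).comp (affS w) = affS (faceMap i ∘ w) := by
  refine ContinuousMap.ext fun t => Subtype.ext ?_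
  change FunOnFinite.linearMap ℝ ℝ i.succAbove (∑ j, t j • (w j : Fin (N + 1) → ℝ)) =
    ∑ j, t j • FunOnFinite.linearMap ℝ ℝ i.succAbove (w j : Fin (N + 1) → ℝ)
  rw [map_sum]
  simp

section Homotopy
variable {k : Type*} [CommRing k] {X Y Z : Type} [TopologicalSpace X] [TopologicalSpace Y]
  [TopologicalSpace Z]

/-- Affine simplices in the prism. -/
def affP {N n : ℕ} (w : Fin (n + 1) → Simp N × unitInterval) :
    C(Simp n, Simp N × unitInterval) :=
  (affS fun j => (w j).1).prodMk (aff (convex_Icc (0 : ℝ) 1) fun j => (w j).2)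

theorem affP_face {N n : ℕ} (i : Fin (n + 2)) (w : Fin (n + 2) → Simp N × unitInterval) :
    (affP w).comp (faceMap i) = affP fun j => w (i.succAbove j) := by
  refine ContinuousMap.ext fun t => Prod.ext ?_ ?_
  · exact DFunLike.congr_fun (aff_face _ i fun j => (w j).1) t
  · exact DFunLike.congr_fun (aff_face (convex_Icc (0 : ℝ) 1) i fun j => (w j).2) t

/-- The difference of the restrictions to the top and the bottom of the prism. -/
def prismDiff (V : Type) (n : ℕ) :
    ((Fin (n + 1) → V × unitInterval) → k) →ₗ[k] ((Fin (n + 1) → V) → k) where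
  toFun f v := f (fun j => (v j, 1)) - f (fun j => (v j, 0))
  map_add' f g := by funext v; simp; ring
  map_smul' c f := by funext v; simp; ring

theorem prismDiff_const (V : Type) (c : k) : prismDiff V 0 (fun _ => c) = 0 := by
  funext v; simp [prismDiff]

theorem prismDiff_delta (V : Type) (n : ℕ) (f : (Fin (n + 1) → V × unitInterval) → k) :
    prismDiff V (n + 1) (delta n f) = delta n (prismDiff V n f) := by
  funext v
  simp [prismDiff, delta_apply, mul_sub, Finset.sum_sub_distrib]

/-- The prism operator on functions of tuples. -/
def prism (V : Type) : ∀ n, ((Fin (n + 2) → V × unitInterval) → k) →ₗ[k]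
    ((Fin (n + 1) → V) → k) :=
  htpy (fun _ v => (v 0, 0)) (prismDiff V)

/-- The values of a cochain on the simplices `τ ∘ affP w`. -/
def prismEval {N : ℕ} (τ : C(Simp N × unitInterval, Y)) (x : Tot k (Sing Y)) (n : ℕ) :
    (Fin (n + 1) → Simp N × unitInterval) → k :=
  fun w => x n (smp (τ.comp (affP w)))

theorem delta_prismEval {N : ℕ} (τ : C(Simp N × unitInterval, Y)) (x : Tot k (Sing Y)) (n : ℕ) :
    delta n (prismEval τ x n) = prismEval τ (Tot.d x) (n + 1) := by
  funext w
  rw [delta_apply, prismEval, Tot.d_apply]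
  refine Finset.sum_congr rfl fun i _ => ?_
  rw [δ_smp, ContinuousMap.comp_assoc, affP_face]
  rfl

/-- The map of prisms induced by a homotopy and a simplex. -/
def prismMap (H : C(X × unitInterval, Y)) {n : ℕ} (σ : C(Simp n, X)) :
    C(Simp n × unitInterval, Y) :=
  H.comp (σ.prodMap (ContinuousMap.id _))

/-- The cochain homotopy induced by a homotopy of maps. -/
def prismOp (H : C(X × unitInterval, Y)) (x : Tot k (Sing Y)) : Tot k (Sing X) :=
  ⟨fun n σ => prism (Simp n) n (prismEval (prismMap H (smp.symm σ)) x (n + 1)) (verts n)⟩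

theorem prismOp_smp (H : C(X × unitInterval, Y)) (x : Tot k (Sing Y)) {n : ℕ}
    (σ : C(Simp n, X)) : prismOp H x n (smp σ) =
      prism (Simp n) n (prismEval (prismMap H σ) x (n + 1)) (verts n) := by
  simp [prismOp]

theorem prismOp_face (H : C(X × unitInterval, Y)) (x : Tot k (Sing Y)) {n : ℕ}
    (σ : C(Simp (n + 1), X)) (i : Fin (n + 2)) :
    prismOp H x n (smp (σ.comp (faceMap i))) =
      prism (Simp (n + 1)) n (prismEval (prismMap H σ) x (n + 1))
        (fun j => verts (n + 1) (i.succAbove j)) := by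
  rw [prismOp_smp, ← faceMap_verts]
  refine Eq.trans ?_ (htpy_comp (b := fun _ v => (v 0, 0)) (Q := prismDiff (Simp n))
    (b' := fun _ v => (v 0, 0)) (Q' := prismDiff (Simp (n + 1))) (faceMap i)
    (Prod.map (faceMap i) id) (fun _ _ => rfl) (fun _ _ _ => rfl) n _ (verts n))
  refine congrFun (congrArg (prism (Simp n) n) (funext fun w => ?_)) (verts n)
  simp only [prismEval]
  congr 2
  refine ContinuousMap.ext fun t => ?_
  change H (σ (faceMap i (affS (fun j => (w j).1) t)), _) = _
  have := DFunLike.congr_fun (faceMap_affS i fun j => (w j).1) t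
  simp only [ContinuousMap.comp_apply] at this
  rw [this]
  rfl

theorem prismDiff_prismEval (H : C(X × unitInterval, Y)) (x : Tot k (Sing Y)) {n : ℕ}
    (σ : C(Simp n, X)) (i0 i1 : C(X, Y)) (h0 : ∀ a, H (a, 0) = i0 a) (h1 : ∀ a, H (a, 1) = i1 a) :
    prismDiff (Simp n) n (prismEval (prismMap H σ) x n) (verts n) =
      x n (smp (i1.comp σ)) - x n (smp (i0.comp σ)) := by
  have key : ∀ (c : unitInterval) (i : C(X, Y)), (∀ a, H (a, c) = i a) →
      (prismMap H σ).comp (affP fun j => (verts n j, c)) = i.comp σ := by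
    intro c i hi
    refine ContinuousMap.ext fun t => ?_
    change H (σ (affS (verts n) t), aff (convex_Icc (0 : ℝ) 1) (fun _ => c) t) = i (σ t)
    rw [affS_verts, aff_const]
    exact hi _
  change prismEval _ x n _ - prismEval _ x n _ = _
  simp only [prismEval]
  rw [key 1 i1 h1, key 0 i0 h0]

theorem prismOp_homotopy (H : C(X × unitInterval, Y)) (i0 i1 : C(X, Y))
    (h0 : ∀ a, H (a, 0) = i0 a) (h1 : ∀ a, H (a, 1) = i1 a) (x : Tot k (Sing Y)) :
    prismOp H (Tot.d x) + Tot.d (prismOp H x) =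
      Tot.pull (singMap i1) x - Tot.pull (singMap i0) x := by
  refine tot_ext fun n σ => ?_
  rw [Tot.add_apply, Tot.sub_apply, Tot.pull_apply, Tot.pull_apply, singMap_smp, singMap_smp,
    ← prismDiff_prismEval H x σ i0 i1 h0 h1, prismOp_smp, ← delta_prismEval]
  cases n with
  | zero =>
    rw [prism, htpy_delta_zero (prismDiff_const _), Tot.d_zero_apply]
    simp
  | succ n =>
    rw [Tot.d_apply]
    simp only [δ_smp, prismOp_face]
    rw [← delta_apply, ← htpy_delta_succ (b := fun _ v => (v 0, 0)) (prismDiff_const (k := k) _)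
      (prismDiff_delta _)]
    rfl

/-- The cohomology ring of a space. -/
abbrev HTop (k : Type*) [CommRing k] (X : Type) [TopologicalSpace X] : Type _ :=
  TotCoh k (Sing X)

/-- Pullback in cohomology along a continuous map. -/
def hpull (k : Type*) [CommRing k] (g : C(X, Y)) : HTop k Y →ₐ[k] HTop k X :=
  TotCoh.pull k (singMap g)

theorem hpull_cls (g : C(X, Y)) (x : Tot k (Sing Y)) (hx : Tot.d x = 0) :
    hpull k g (TotCoh.cls x hx) =
      TotCoh.cls (Tot.pull (singMap g) x) (by rw [← Tot.pull_d, hx, map_zero]) := rfl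

theorem hpull_comp (g : C(X, Y)) (h : C(Y, Z)) (x : HTop k Z) :
    hpull k (h.comp g) x = hpull k g (hpull k h x) := by
  rw [hpull, hpull, hpull, TotCoh.pull_pull, singMap_comp]

theorem hpull_id (x : HTop k X) : hpull k (ContinuousMap.id X) x = x := by
  obtain ⟨x, hx, rfl⟩ := TotCoh.exists_rep x
  rw [hpull_cls, singMap_id]
  rfl

theorem hpull_eq_of_homotopic {f g : C(X, Y)} (h : f.Homotopic g) (x : HTop k Y) :
    hpull k f x = hpull k g x := by
  obtain ⟨F⟩ := h
  obtain ⟨x, hx, rfl⟩ := TotCoh.exists_rep x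
  rw [hpull_cls, hpull_cls, eq_comm, TotCoh.cls_eq_cls]
  let H : C(X × unitInterval, Y) := ⟨fun p => F (p.2, p.1), by fun_prop⟩
  refine ⟨prismOp H x, ?_⟩
  rw [← prismOp_homotopy H f g (fun a => F.apply_zero a) (fun a => F.apply_one a), hx]
  have : prismOp H (0 : Tot k (Sing Y)) = 0 := by
    refine tot_ext fun n σ => ?_
    rw [prismOp_smp, show prismEval (prismMap H σ) (0 : Tot k (Sing Y)) (n + 1) = 0 from rfl,
      map_zero]
    rfl
  rw [this, zero_add]

theorem hpull_injective_of_leftInverse {f : C(X, Y)} {g : C(Y, X)}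
    (h : (f.comp g).Homotopic (ContinuousMap.id Y)) : Function.Injective (hpull k f) := by
  intro x y hxy
  rw [← hpull_id x, ← hpull_id y, ← hpull_eq_of_homotopic h, ← hpull_eq_of_homotopic h,
    hpull_comp, hpull_comp, hxy]

theorem hpull_mem_homogeneous (g : C(X, Y)) {n : ℕ} {x : HTop k Y}
    (hx : x ∈ TotCoh.homogeneous k (Sing Y) n) :
    hpull k g x ∈ TotCoh.homogeneous k (Sing X) n :=
  TotCoh.pull_mem_homogeneous _ hx

end Homotopy
end SingCoh
end

noncomputable section

/-! ### Barycentric subdivision and small simplices -/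

namespace SingCoh

open CategoryTheory TupleCochain

/-- The barycentre of a tuple of points of a standard simplex. -/
def bary {N : ℕ} (n : ℕ) (v : Fin (n + 1) → Simp N) : Simp N := affS v stdSimplex.barycenter

theorem bary_mem {N n : ℕ} (v : Fin (n + 1) → Simp N) {C : Set (Fin (N + 1) → ℝ)}
    (hC : Convex ℝ C) (hv : ∀ i, (v i : Fin (N + 1) → ℝ) ∈ C) :
    (bary n v : Fin (N + 1) → ℝ) ∈ C :=
  aff_mem _ v _ hC hv

theorem bary_face {N n : ℕ} (i : Fin (N + 2)) (v : Fin (n + 1) → Simp N) :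
    bary n (faceMap i ∘ v) = faceMap i (bary n v) :=
  (DFunLike.congr_fun (faceMap_affS i v) _).symm

theorem dist_bary_le {N n : ℕ} (v : Fin (n + 1) → Simp N) {r : ℝ}
    (hr : ∀ i j, dist (v i) (v j) ≤ r) (j : Fin (n + 1)) :
    dist (v j) (bary n v) ≤ n / (n + 1) * r := by
  have hn : (0 : ℝ) < n + 1 := by positivity
  have e : (bary n v).1 - (v j).1 =
      ∑ i, (n + 1 : ℝ)⁻¹ • ((v i).1 - (v j).1) := by
    rw [← Finset.smul_sum, Finset.sum_sub_distrib, smul_sub, Finset.sum_const, Finset.card_univ,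
      Fintype.card_fin, ← Nat.cast_smul_eq_nsmul ℝ, smul_smul]
    push_cast
    rw [inv_mul_cancel₀ hn.ne', one_smul]
    congr 1
    change ∑ i, (stdSimplex.barycenter : Simp n).1 i • _ = _
    rw [Finset.smul_sum]
    refine Finset.sum_congr rfl fun i _ => ?_
    rw [stdSimplex.barycenter_apply]
    simp
  rw [dist_comm, Subtype.dist_eq, dist_eq_norm, e]
  calc ‖∑ i, (n + 1 : ℝ)⁻¹ • ((v i).1 - (v j).1)‖
      ≤ ∑ i, ‖(n + 1 : ℝ)⁻¹ • ((v i).1 - (v j).1)‖ := norm_sum_le _ _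
    _ = ∑ i ∈ Finset.univ.erase j, ‖(n + 1 : ℝ)⁻¹ • ((v i).1 - (v j).1)‖ := by
        rw [← Finset.add_sum_erase _ _ (Finset.mem_univ j)]; simp
    _ ≤ ∑ i ∈ Finset.univ.erase j, (n + 1 : ℝ)⁻¹ * r := by
        refine Finset.sum_le_sum fun i _ => ?_
        rw [norm_smul, Real.norm_of_nonneg (by positivity)]
        gcongr
        have := hr i j
        rwa [Subtype.dist_eq, dist_eq_norm] at this
    _ = n / (n + 1) * r := by
        rw [Finset.sum_const, Finset.card_erase_of_mem (Finset.mem_univ j), Finset.card_univ,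
          Fintype.card_fin, nsmul_eq_mul, Nat.add_sub_cancel]
        ring

section
variable {k : Type*} [CommRing k] {N : ℕ}

/-- Subdivision of a simplex of diameter at most `r` only involves simplices of diameter at most
`n / (n + 1) * r` in its convex hull. -/
theorem sd_bary_eq_zero_of_small {n : ℕ} {r : ℝ} (v : Fin (n + 1) → Simp N)
    (hr : ∀ i j, dist (v i) (v j) ≤ r) (f : (Fin (n + 1) → Simp N) → k)
    (hf : ∀ w : Fin (n + 1) → Simp N,
      (∀ C : Set (Fin (N + 1) → ℝ), Convex ℝ C → (∀ j, (v j).1 ∈ C) → ∀ j, (w j).1 ∈ C) →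
      (∀ i j, dist (w i) (w j) ≤ n / (n + 1) * r) → f w = 0) :
    sd bary n f v = 0 := by
  induction n with
  | zero =>
    refine hf v (fun C _ h => h) fun i j => ?_
    rw [Subsingleton.elim (α := Fin 1) i j, dist_self]
    simp
  | succ n ih =>
    have hr0 : 0 ≤ r := dist_nonneg.trans (hr 0 0)
    rw [sd_succ_apply]
    refine delta_eq_zero_of fun i => ih _ (fun a b => hr _ _) _ fun w hw1 hw2 => ?_
    rw [cone_apply]
    have hw1' : ∀ C : Set (Fin (N + 1) → ℝ), Convex ℝ C → (∀ j, (v j).1 ∈ C) →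
        ∀ j, (w j).1 ∈ C := fun C hC h => hw1 C hC fun j => h _
    have hb : ∀ j, dist (w j) (bary (n + 1) v) ≤ ((n + 1 : ℕ) : ℝ) / ((n + 1 : ℕ) + 1) * r := by
      intro j
      have := hw1' (Metric.closedBall (bary (n + 1) v).1 (((n + 1 : ℕ) : ℝ) / ((n + 1 : ℕ) + 1) * r))
        (convex_closedBall _ _) (fun j => dist_bary_le v hr j) j
      exact this
    have hq : (n : ℝ) / (n + 1) * r ≤ ((n + 1 : ℕ) : ℝ) / ((n + 1 : ℕ) + 1) * r := by
      refine mul_le_mul_of_nonneg_right ?_ hr0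
      rw [div_le_div_iff₀ (by positivity) (by positivity)]
      push_cast
      nlinarith
    have hq0 : 0 ≤ ((n + 1 : ℕ) : ℝ) / ((n + 1 : ℕ) + 1) * r := by positivity
    refine hf _ (fun C hC h j => ?_) fun a b => ?_
    · exact cons_mem (P := {y : Simp N | y.1 ∈ C}) (bary_mem v hC h) (hw1' C hC h) j
    · refine Fin.cases ?_ (fun a => ?_) a <;> refine Fin.cases ?_ (fun b => ?_) b
      · rw [dist_self]; exact hq0
      · rw [Fin.cons_zero, Fin.cons_succ, dist_comm]; exact hb b
      · rw [Fin.cons_zero, Fin.cons_succ]; exact hb a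
      · rw [Fin.cons_succ, Fin.cons_succ]; exact (hw2 a b).trans hq

theorem iterate_sd_eq_zero_of_small {n : ℕ} (m : ℕ) {r : ℝ} (v : Fin (n + 1) → Simp N)
    (hr : ∀ i j, dist (v i) (v j) ≤ r) (f : (Fin (n + 1) → Simp N) → k)
    (hf : ∀ w : Fin (n + 1) → Simp N,
      (∀ i j, dist (w i) (w j) ≤ ((n : ℝ) / (n + 1)) ^ m * r) → f w = 0) :
    (sd bary n)^[m] f v = 0 := by
  induction m generalizing v r with
  | zero => exact hf v fun i j => by simpa using hr i j
  | succ m ih =>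
    rw [Function.iterate_succ_apply']
    refine sd_bary_eq_zero_of_small v hr _ fun w _ hw => ih w hw fun w' hw' => hf w' ?_
    intro i j
    rw [pow_succ, mul_assoc]
    exact hw' i j

theorem iterate_sd_delta (m n : ℕ) (f : (Fin (n + 1) → Simp N) → k) :
    (sd bary (n + 1))^[m] (delta n f) = delta n ((sd bary n)^[m] f) := by
  induction m with
  | zero => rfl
  | succ m ih => rw [Function.iterate_succ_apply', ih, sd_delta, Function.iterate_succ_apply']

theorem iterate_sd_face (m n : ℕ) (i : Fin (N + 2)) (f : (Fin (n + 1) → Simp (N + 1)) → k)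
    (v : Fin (n + 1) → Simp N) :
    (sd bary n)^[m] (fun w => f (faceMap i ∘ w)) v = (sd bary n)^[m] f (faceMap i ∘ v) := by
  induction m generalizing v with
  | zero => rfl
  | succ m ih =>
    rw [Function.iterate_succ_apply', Function.iterate_succ_apply',
      ← sd_comp (faceMap i) (fun n v => bary_face i v)]
    exact congrFun (congrArg (sd bary n) (funext ih)) v

theorem iterate_sd_zero (m n : ℕ) :
    (sd bary n)^[m] (0 : (Fin (n + 1) → Simp N) → k) = 0 := by
  induction m with
  | zero => rfl
  | succ m ih => rw [Function.iterate_succ_apply', ih, map_zero]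

/-- The homotopy between the identity and subdivision. -/
def sdHtpy (N : ℕ) : ∀ n, ((Fin (n + 2) → Simp N) → k) →ₗ[k] ((Fin (n + 1) → Simp N) → k) :=
  htpy bary fun n => LinearMap.id - sd bary n

theorem sdHtpy_delta (n : ℕ) (f : (Fin (n + 2) → Simp N) → k) :
    sdHtpy N (n + 1) (delta (n + 1) f) + delta n (sdHtpy N n f) = f - sd bary (n + 1) f :=
  htpy_delta_succ (fun c => by simp [sd]) (fun n f => by simp [sd_delta]) n f

theorem sdHtpy_face (n : ℕ) (i : Fin (N + 2)) (f : (Fin (n + 2) → Simp (N + 1)) → k)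
    (v : Fin (n + 1) → Simp N) :
    sdHtpy N n (fun w => f (faceMap i ∘ w)) v = sdHtpy (N + 1) n f (faceMap i ∘ v) := by
  refine htpy_comp (faceMap i) (faceMap i) (fun n v => bary_face i v) (fun n f v => ?_) n f v
  simp only [LinearMap.sub_apply, LinearMap.id_coe, id_eq, Pi.sub_apply]
  rw [sd_comp (faceMap i) (fun n v => bary_face i v)]

theorem sdHtpy_eq_zero_of {C : Set (Fin (N + 1) → ℝ)} (hC : Convex ℝ C) {n : ℕ}
    (f : (Fin (n + 2) → Simp N) → k) (hf : ∀ w, (∀ j, (w j).1 ∈ C) → f w = 0)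
    (v : Fin (n + 1) → Simp N) (hv : ∀ j, (v j).1 ∈ C) : sdHtpy N n f v = 0 := by
  refine htpy_eq_zero_of {y : Simp N | y.1 ∈ C} {y : Simp N | y.1 ∈ C}
    (fun n v hv => bary_mem v hC hv) (fun n f v hv hf => ?_) n f hf v hv
  rw [LinearMap.sub_apply, Pi.sub_apply, LinearMap.id_apply, hf v hv,
    sd_eq_zero_of {y : Simp N | y.1 ∈ C} (fun n v hv => bary_mem v hC hv) n f hf v hv, sub_zero]

end

section Small
variable {k : Type*} [CommRing k] {X : Type} [TopologicalSpace X]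

/-- The cochains vanishing on all simplices contained in `A`. -/
def van (k : Type*) [CommRing k] (A : Set X) : Submodule k (Tot k (Sing X)) where
  carrier := {x | ∀ n (σ : C(Simp n, X)), (∀ t, σ t ∈ A) → x n (smp σ) = 0}
  add_mem' hx hy n σ h := by rw [Tot.add_apply, hx n σ h, hy n σ h, add_zero]
  zero_mem' n σ h := rfl
  smul_mem' c x hx n σ h := by rw [Tot.smul_apply, hx n σ h, mul_zero]

theorem van_anti {A B : Set X} (h : A ⊆ B) : van k B ≤ van k A :=
  fun _ hx n σ hσ => hx n σ fun t => h (hσ t)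

theorem van_d {A : Set X} {x : Tot k (Sing X)} (hx : x ∈ van k A) : Tot.d x ∈ van k A := by
  intro n σ hσ
  cases n with
  | zero => rfl
  | succ n =>
    rw [Tot.d_apply]
    refine Finset.sum_eq_zero fun i _ => ?_
    rw [δ_smp, hx n _ fun t => hσ _, mul_zero]

theorem van_eps {A : Set X} {x : Tot k (Sing X)} (hx : x ∈ van k A) : Tot.eps x ∈ van k A := by
  intro n σ hσ
  rw [Tot.eps_apply, hx n σ hσ, mul_zero]

theorem van_mul {A : Set X} {x : Tot k (Sing X)} (hx : x ∈ van k A) (y : Tot k (Sing X)) :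
    x * y ∈ van k A := by
  intro n σ hσ
  rw [Tot.mul_apply]
  refine Finset.sum_eq_zero fun p _ => ?_
  rw [map_smp, hx p.1 (σ.comp (vertexMap (frontFace p.1 n))) fun t => hσ _, zero_mul]

theorem van_univ {x : Tot k (Sing X)} (hx : x ∈ van k (Set.univ : Set X)) : x = 0 :=
  tot_ext fun n σ => hx n σ fun _ => trivial

/-- A simplex of both `U` and `V` is one of `U ∩ V`, so no subdivision is needed here. -/
theorem van_inter (U V : Set X) : van k (U ∩ V) ≤ van k U ⊔ van k V := by
  classical
  intro x hx
  rw [Submodule.mem_sup]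
  refine ⟨⟨fun n σ => if ∀ t, smp.symm σ t ∈ U then 0 else x n σ⟩, fun n σ h => ?_,
    ⟨fun n σ => if ∀ t, smp.symm σ t ∈ U then x n σ else 0⟩, fun n σ h => ?_, ?_⟩
  · simp only [Equiv.symm_apply_apply]
    rw [if_pos h]
  · simp only [Equiv.symm_apply_apply]
    split_ifs with h'
    · exact hx n σ fun t => ⟨h' t, h t⟩
    · rfl
  · ext n σ
    rw [Tot.add_apply]
    simp only
    split_ifs <;> simp

/-- The values of a cochain on the simplices `σ ∘ affS w`. -/
def simpEval {N : ℕ} (σ : C(Simp N, X)) (x : Tot k (Sing X)) (n : ℕ) :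
    (Fin (n + 1) → Simp N) → k :=
  fun w => x n (smp (σ.comp (affS w)))

theorem delta_simpEval {N : ℕ} (σ : C(Simp N, X)) (x : Tot k (Sing X)) (n : ℕ) :
    delta n (simpEval σ x n) = simpEval σ (Tot.d x) (n + 1) := by
  funext w
  rw [delta_apply, simpEval, Tot.d_apply]
  refine Finset.sum_congr rfl fun i _ => ?_
  rw [δ_smp, ContinuousMap.comp_assoc, aff_face]
  rfl

theorem simpEval_face {N : ℕ} (σ : C(Simp (N + 1), X)) (x : Tot k (Sing X)) (n : ℕ)
    (i : Fin (N + 2)) :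
    simpEval (σ.comp (faceMap i)) x n = fun w => simpEval σ x n (faceMap i ∘ w) := by
  funext w
  rw [simpEval, simpEval, ContinuousMap.comp_assoc, faceMap_affS]

theorem simpEval_verts {n : ℕ} (σ : C(Simp n, X)) (x : Tot k (Sing X)) :
    simpEval σ x n (verts n) = x n (smp σ) := by
  rw [simpEval, affS_verts, ContinuousMap.comp_id]

theorem simpEval_eq_zero {N : ℕ} {A : Set X} {σ : C(Simp N, X)} (hσ : ∀ t, σ t ∈ A)
    {x : Tot k (Sing X)} (hx : x ∈ van k A) (n : ℕ) : simpEval σ x n = 0 :=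
  funext fun _ => hx n _ fun _ => hσ _

/-- For a simplex in `U ∪ V`, sufficiently fine affine simplices are contained in a convex set that
is mapped into `U` or into `V`. -/
theorem exists_small {N : ℕ} {U V : Set X} (hU : IsOpen U) (hV : IsOpen V) (σ : C(Simp N, X))
    (hσ : ∀ t, σ t ∈ U ∪ V) :
    ∃ ε > 0, ∀ {n : ℕ} (w : Fin (n + 1) → Simp N), (∀ i j, dist (w i) (w j) ≤ ε) →
      ∃ C : Set (Fin (N + 1) → ℝ), Convex ℝ C ∧ (∀ j, (w j).1 ∈ C) ∧
        ((∀ t : Simp N, t.1 ∈ C → σ t ∈ U) ∨ (∀ t : Simp N, t.1 ∈ C → σ t ∈ V)) := by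
  obtain ⟨δ, hδ, h⟩ := lebesgue_number_lemma_of_metric (s := (Set.univ : Set (Simp N)))
    (c := fun b : Bool => σ ⁻¹' (cond b U V)) isCompact_univ
    (fun b => by cases b; exacts [hV.preimage σ.continuous, hU.preimage σ.continuous])
    (fun t _ => by
      rw [Set.mem_iUnion]
      rcases hσ t with h | h
      exacts [⟨true, h⟩, ⟨false, h⟩])
  refine ⟨δ / 2, half_pos hδ, fun w hw => ?_⟩
  obtain ⟨b, hb⟩ := h (w 0) trivial
  refine ⟨Metric.ball (w 0).1 δ, convex_ball _ _, fun j => ?_, ?_⟩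
  · exact lt_of_le_of_lt (hw j 0) (by linarith)
  · cases b
    · exact .inr fun t ht => hb (show t ∈ Metric.ball (w 0) δ from ht)
    · exact .inl fun t ht => hb (show t ∈ Metric.ball (w 0) δ from ht)

/-- **Small simplices.** A cochain that vanishes on the simplices of `U` and of `V`, and whose
coboundary vanishes on those of `U ∪ V`, is on `U ∪ V` the coboundary of a cochain that vanishes on
the simplices of `U` and of `V`. The primitive is the sum over `j` of `T (Sd^j x)`, where `T` is the
homotopy between the identity and subdivision; on each simplex of `U ∪ V` only finitely many
summands are nonzero, as the simplices of a fine subdivision lie in `U` or in `V`. -/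
theorem exists_primitive_of_van {U V : Set X} (hU : IsOpen U) (hV : IsOpen V)
    (x : Tot k (Sing X)) (hxU : x ∈ van k U) (hxV : x ∈ van k V)
    (hx : Tot.d x ∈ van k (U ∪ V)) :
    ∃ y ∈ van k U ⊓ van k V, x - Tot.d y ∈ van k (U ∪ V) := by
  classical
  -- the summands of the primitive
  let g : ℕ → ∀ n, C(Simp n, X) → k := fun j n σ =>
    (sd bary n)^[j] (sdHtpy n n (simpEval σ x (n + 1))) (verts n)
  have small : ∀ {N : ℕ} (σ : C(Simp N, X)), (∀ t, σ t ∈ U ∪ V) → ∀ n, ∃ M : ℕ, ∀ j ≥ M,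
      ∀ w : Fin (n + 1) → Simp N,
        (∀ a b, dist (w a) (w b) ≤ ((n : ℝ) / (n + 1)) ^ j * Metric.diam (Set.univ : Set (Simp N))) →
        ∃ C : Set (Fin (N + 1) → ℝ), Convex ℝ C ∧ (∀ j, (w j).1 ∈ C) ∧
        ((∀ t : Simp N, t.1 ∈ C → σ t ∈ U) ∨ (∀ t : Simp N, t.1 ∈ C → σ t ∈ V)) := by
    intro N σ hσ n
    obtain ⟨ε, hε, h⟩ := exists_small hU hV σ hσ
    have hlim : Filter.Tendsto
        (fun j : ℕ => ((n : ℝ) / (n + 1)) ^ j * Metric.diam (Set.univ : Set (Simp N)))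
        Filter.atTop (nhds 0) := by
      have := (tendsto_pow_atTop_nhds_zero_of_lt_one (r := (n : ℝ) / (n + 1)) (by positivity)
        ((div_lt_one (by positivity)).2 (by linarith))).mul_const
          (Metric.diam (Set.univ : Set (Simp N)))
      simpa using this
    obtain ⟨M, hM⟩ := Filter.eventually_atTop.1 (hlim.eventually_le_const hε)
    exact ⟨M, fun j hj w hw => h w fun a b => (hw a b).trans (hM j hj)⟩
  have diam : ∀ {N n : ℕ} (v : Fin (n + 1) → Simp N) (a b : Fin (n + 1)),
      dist (v a) (v b) ≤ Metric.diam (Set.univ : Set (Simp N)) := fun v a b =>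
    Metric.dist_le_diam_of_mem isCompact_univ.isBounded trivial trivial
  have hC0 : ∀ {N : ℕ} (σ : C(Simp N, X)) {C : Set (Fin (N + 1) → ℝ)} (_ : Convex ℝ C)
      (_ : (∀ t : Simp N, t.1 ∈ C → σ t ∈ U) ∨ (∀ t : Simp N, t.1 ∈ C → σ t ∈ V)) {n : ℕ}
      (w : Fin (n + 1) → Simp N), (∀ j, (w j).1 ∈ C) → simpEval σ x n w = 0 := by
    intro N σ C hC h n w hw
    rcases h with h | h
    · exact hxU n _ fun t => h _ (aff_mem _ w t hC hw)
    · exact hxV n _ fun t => h _ (aff_mem _ w t hC hw)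
  have hg : ∀ n (σ : C(Simp n, X)), (∀ t, σ t ∈ U ∪ V) → ∃ M, ∀ j ≥ M, g j n σ = 0 := by
    intro n σ hσ
    obtain ⟨M, hM⟩ := small σ hσ n
    refine ⟨M, fun j hj => iterate_sd_eq_zero_of_small j _ (diam _) _ fun w hw => ?_⟩
    obtain ⟨C, hC, hwC, h⟩ := hM j hj w hw
    exact sdHtpy_eq_zero_of hC _ (fun w' hw' => hC0 σ hC h w' hw') w hwC
  have hgA : ∀ A : Set X, x ∈ van k A → ∀ j n (σ : C(Simp n, X)), (∀ t, σ t ∈ A) →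
      g j n σ = 0 := by
    intro A hA j n σ hσ
    simp only [g]
    rw [simpEval_eq_zero hσ hA, map_zero, iterate_sd_zero]
    rfl
  -- the primitive
  let y : Tot k (Sing X) := ⟨fun n σ => if ∀ t, smp.symm σ t ∈ U ∪ V then
    ∑ᶠ j, g j n (smp.symm σ) else 0⟩
  have hy : ∀ n (σ : C(Simp n, X)), (∀ t, σ t ∈ U ∪ V) → ∀ M, (∀ j ≥ M, g j n σ = 0) →
      y n (smp σ) = ∑ j ∈ Finset.range M, g j n σ := by
    intro n σ hσ M hM
    simp only [y, Equiv.symm_apply_apply]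
    rw [if_pos hσ]
    refine finsum_eq_sum_of_support_subset _ fun j hj => ?_
    by_contra hj'
    simp only [Finset.coe_range, Set.mem_Iio, not_lt] at hj'
    exact hj (hM j hj')
  have hyA : ∀ A : Set X, A ⊆ U ∪ V → x ∈ van k A → y ∈ van k A := by
    intro A hAUV hA n σ hσ
    rw [hy n σ (fun t => hAUV (hσ t)) 0 fun j _ => hgA A hA j n σ hσ, Finset.sum_range_zero]
  refine ⟨y, ⟨hyA U Set.subset_union_left hxU, hyA V Set.subset_union_right hxV⟩, ?_⟩
  intro n σ hσ
  rw [Tot.sub_apply]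
  cases n with
  | zero =>
    rw [Tot.d_zero_apply, Pi.zero_apply, sub_zero]
    rcases hσ default with h | h
    · exact hxU 0 σ fun t => by rwa [Subsingleton.elim t default]
    · exact hxV 0 σ fun t => by rwa [Subsingleton.elim t default]
  | succ n =>
    -- a common bound for the number of subdivisions
    have hface : ∀ i : Fin (n + 2), ∃ M, ∀ j ≥ M, g j n (σ.comp (faceMap i)) = 0 :=
      fun i => hg n _ fun t => hσ _
    choose M₁ hM₁ using hface
    obtain ⟨M₂, hM₂⟩ := small σ hσ (n + 1)
    let M := (∑ i, M₁ i) + M₂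
    have hM₁' : ∀ i, M₁ i ≤ M := fun i =>
      (Finset.single_le_sum (f := M₁) (fun _ _ => Nat.zero_le _) (Finset.mem_univ i)).trans
        (Nat.le_add_right _ _)
    have hcl : delta (n + 1) (simpEval σ x (n + 1)) = 0 := by
      rw [delta_simpEval]
      exact simpEval_eq_zero hσ hx _
    have htop : (sd bary (n + 1))^[M] (simpEval σ x (n + 1)) (verts (n + 1)) = 0 := by
      refine iterate_sd_eq_zero_of_small M _ (diam _) _ fun w hw => ?_
      obtain ⟨C, hC, hwC, h⟩ := hM₂ M (Nat.le_add_left _ _) w hw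
      exact hC0 σ hC h w hwC
    -- the coboundaries of the summands telescope
    have hterm : ∀ j, ∑ i : Fin (n + 2), (-1 : k) ^ (i : ℕ) * g j n (σ.comp (faceMap i)) =
        (sd bary (n + 1))^[j] (simpEval σ x (n + 1)) (verts (n + 1)) -
        (sd bary (n + 1))^[j + 1] (simpEval σ x (n + 1)) (verts (n + 1)) := by
      intro j
      have h1 : ∀ i : Fin (n + 2), g j n (σ.comp (faceMap i)) =
          (sd bary n)^[j] (sdHtpy (n + 1) n (simpEval σ x (n + 1)))
            (fun l => verts (n + 1) (i.succAbove l)) := by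
        intro i
        simp only [g]
        rw [simpEval_face, ← faceMap_verts, ← iterate_sd_face]
        refine congrFun (congrArg _ (funext fun w => ?_)) _
        exact sdHtpy_face n i _ w
      simp only [h1]
      rw [← delta_apply, ← iterate_sd_delta]
      have h2 := sdHtpy_delta n (simpEval σ x (n + 1))
      rw [hcl, map_zero, zero_add] at h2
      rw [h2, Function.iterate_succ_apply]
      have hsub : ∀ (j : ℕ) (f f' : (Fin (n + 2) → Simp (n + 1)) → k),
          (sd bary (n + 1))^[j] (f - f') = (sd bary (n + 1))^[j] f - (sd bary (n + 1))^[j] f' := by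
        intro j
        induction j with
        | zero => exact fun _ _ => rfl
        | succ j ih => intro f f'; simp only [Function.iterate_succ_apply, map_sub, ih]
      rw [hsub]
      rfl
    rw [Tot.d_apply]
    simp only [δ_smp]
    rw [Finset.sum_congr rfl fun i _ => by
      rw [hy n (σ.comp (faceMap i)) (fun t => hσ _) M fun j hj => hM₁ i j ((hM₁' i).trans hj)]]
    simp only [Finset.mul_sum]
    rw [Finset.sum_comm, Finset.sum_congr rfl fun j _ => hterm j, Finset.sum_range_sub', htop,
      sub_zero, Function.iterate_zero_apply, simpEval_verts, sub_self]

end Small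
end SingCoh
end

noncomputable section

/-! ### Restriction to subspaces, Mayer–Vietoris, and commutativity in degree two -/

namespace SingCoh

open CategoryTheory TupleCochain

section Embedding
variable {k : Type*} [CommRing k] {X A B W : Type} [TopologicalSpace X] [TopologicalSpace A]
  [TopologicalSpace B] [TopologicalSpace W]

theorem exists_lift_simplex {j : C(A, X)} (hj : Topology.IsEmbedding j) {n : ℕ} (σ : C(Simp n, X))
    (hσ : ∀ t, σ t ∈ Set.range j) : ∃ τ : C(Simp n, A), j.comp τ = σ := by
  choose τ hτ using hσ
  refine ⟨⟨τ, hj.continuous_iff.2 ?_⟩, ContinuousMap.ext hτ⟩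
  rw [show j ∘ τ = σ from funext hτ]
  exact σ.continuous

theorem mem_van_range_iff {j : C(A, X)} (hj : Topology.IsEmbedding j) {x : Tot k (Sing X)} :
    x ∈ van k (Set.range j) ↔ Tot.pull (singMap j) x = 0 := by
  constructor
  · intro hx
    refine tot_ext fun n σ => ?_
    rw [Tot.pull_apply, singMap_smp]
    exact hx n _ fun t => ⟨_, rfl⟩
  · intro hx n σ hσ
    obtain ⟨τ, rfl⟩ := exists_lift_simplex hj σ hσ
    have := congrArg (fun y : Tot k (Sing A) => y n (smp τ)) hx
    simpa [Tot.pull_apply, singMap_smp] using this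

theorem pull_surjective_of_isEmbedding {j : C(A, X)} (hj : Topology.IsEmbedding j)
    (z : Tot k (Sing A)) : ∃ x : Tot k (Sing X), Tot.pull (singMap j) x = z := by
  classical
  refine ⟨⟨fun n σ => if h : ∃ τ : C(Simp n, A), smp (j.comp τ) = σ then z n (smp h.choose)
    else 0⟩, tot_ext fun n σ => ?_⟩
  rw [Tot.pull_apply, singMap_smp]
  have h : ∃ τ : C(Simp n, A), smp (j.comp τ) = smp (j.comp σ) := ⟨σ, rfl⟩
  simp only
  rw [dif_pos h]
  congr 2
  have := smp.injective h.choose_spec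
  ext t
  exact hj.injective (DFunLike.congr_fun this t)

/-- **Mayer–Vietoris.** If `X` is covered by two open subspaces `A` and `B` and the restriction from
`B` to the intersection is surjective in cohomology, then the cohomology of `X` embeds in that of
`A` times that of `B`. -/
theorem mayerVietoris_injective (jA : C(A, X)) (jB : C(B, X)) (i : C(W, B))
    (hA : Topology.IsOpenEmbedding jA) (hB : Topology.IsOpenEmbedding jB)
    (hW : Topology.IsEmbedding (jB.comp i))
    (hcov : Set.range jA ∪ Set.range jB = Set.univ)
    (hint : Set.range (jB.comp i) = Set.range jA ∩ Set.range jB)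
    (hsurj : Function.Surjective (hpull k i)) (x : HTop k X)
    (hxA : hpull k jA x = 0) (hxB : hpull k jB x = 0) : x = 0 := by
  obtain ⟨x, hx, rfl⟩ := TotCoh.exists_rep x
  rw [hpull_cls, TotCoh.cls_eq_zero] at hxA hxB
  obtain ⟨yA, hyA⟩ := hxA
  obtain ⟨yB, hyB⟩ := hxB
  obtain ⟨y₁, rfl⟩ := pull_surjective_of_isEmbedding hA.isEmbedding yA
  obtain ⟨y₂, rfl⟩ := pull_surjective_of_isEmbedding hB.isEmbedding yB
  have h₁ : x - Tot.d y₁ ∈ van k (Set.range jA) := by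
    rw [mem_van_range_iff hA.isEmbedding, map_sub, Tot.pull_d, hyA, sub_self]
  have h₂ : x - Tot.d y₂ ∈ van k (Set.range jB) := by
    rw [mem_van_range_iff hB.isEmbedding, map_sub, Tot.pull_d, hyB, sub_self]
  -- the difference of the primitives is closed on the intersection
  have hcl : Tot.d (Tot.pull (singMap (jB.comp i)) (y₁ - y₂)) = 0 := by
    rw [← Tot.pull_d, ← mem_van_range_iff hW, hint]
    have e : Tot.d (y₁ - y₂) = (x - Tot.d y₂) - (x - Tot.d y₁) := by rw [map_sub]; abel
    rw [e]
    exact sub_mem (van_anti Set.inter_subset_right h₂) (van_anti Set.inter_subset_left h₁)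
  obtain ⟨u, hu⟩ := hsurj (TotCoh.cls _ hcl)
  obtain ⟨u, hdu, rfl⟩ := TotCoh.exists_rep u
  obtain ⟨u, rfl⟩ := pull_surjective_of_isEmbedding hB.isEmbedding u
  rw [hpull_cls, TotCoh.cls_eq_cls] at hu
  obtain ⟨z, hz⟩ := hu
  obtain ⟨z, rfl⟩ := pull_surjective_of_isEmbedding hW z
  have hpi : Tot.pull (singMap i) (Tot.pull (singMap jB) u) =
      Tot.pull (singMap (jB.comp i)) u := by rw [Tot.pull_pull, singMap_comp]
  have hv : u - (y₁ - y₂) - Tot.d z ∈ van k (Set.range jA ∩ Set.range jB) := by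
    rw [← hint, mem_van_range_iff hW, map_sub, map_sub, ← hpi, Tot.pull_d, hz, sub_self]
  have hdu' : Tot.d u ∈ van k (Set.range jB) := by
    rw [mem_van_range_iff hB.isEmbedding, Tot.pull_d, hdu]
  obtain ⟨n₁, hn₁, n₂, hn₂, hn⟩ := Submodule.mem_sup.1 (van_inter _ _ hv)
  -- a common primitive on the small simplices
  have e : y₁ + n₁ = y₂ + u - Tot.d z - n₂ := by
    have : n₁ = (u - (y₁ - y₂) - Tot.d z) - n₂ := by rw [← hn]; abel
    rw [this]; abel
  have hxy₁ : x - Tot.d (y₁ + n₁) ∈ van k (Set.range jA) := by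
    rw [map_add, ← sub_sub]; exact sub_mem h₁ (van_d hn₁)
  have hxy₂ : x - Tot.d (y₁ + n₁) ∈ van k (Set.range jB) := by
    rw [e, map_sub, map_sub, map_add, Tot.d_d, sub_zero]
    have e' : x - (Tot.d y₂ + Tot.d u - Tot.d n₂) = x - Tot.d y₂ - Tot.d u + Tot.d n₂ := by abel
    rw [e']
    exact add_mem (sub_mem h₂ hdu') (van_d hn₂)
  have hd : Tot.d (x - Tot.d (y₁ + n₁)) = 0 := by rw [map_sub, hx, Tot.d_d, sub_zero]
  obtain ⟨y, _, hy⟩ := exists_primitive_of_van hA.isOpen_range hB.isOpen_range _ hxy₁ hxy₂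
    (by rw [hd]; exact zero_mem _)
  rw [hcov] at hy
  have := van_univ hy
  refine TotCoh.cls_eq_zero.2 ⟨(y₁ + n₁) + y, ?_⟩
  rw [map_add]
  rw [sub_eq_zero] at this
  rw [← this]; abel

end Embedding

section Acyclic
variable {k : Type*} [CommRing k] {M : Type*} [AddCommGroup M] [Module k M]

/-- The quotient of the differential module `(M, D)` by the submodule `N` is acyclic. -/
def AcyclicMod (D : M →ₗ[k] M) (N : Submodule k M) : Prop :=
  ∀ x, D x ∈ N → ∃ y, x - D y ∈ N

/-- The Mayer–Vietoris argument: acyclicity for two sets and their intersection gives acyclicity for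
the union, if the quotient by the cochains on small simplices is acyclic. -/
theorem AcyclicMod.inf {D : M →ₗ[k] M} (hDD : ∀ x, D (D x) = 0) {N₁ N₂ N₁₂ N : Submodule k M}
    (h₁ : AcyclicMod D N₁) (h₂ : AcyclicMod D N₂) (h₁₂ : AcyclicMod D N₁₂)
    (hD₁ : ∀ x ∈ N₁, D x ∈ N₁) (hD₂ : ∀ x ∈ N₂, D x ∈ N₂)
    (hle₁ : N₁ ≤ N₁₂) (hle₂ : N₂ ≤ N₁₂) (hsup : N₁₂ ≤ N₁ ⊔ N₂) (hN₁ : N ≤ N₁) (hN₂ : N ≤ N₂)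
    (hsmall : ∀ x ∈ N₁ ⊓ N₂, D x ∈ N → ∃ y, x - D y ∈ N) : AcyclicMod D N := by
  intro x hx
  obtain ⟨y₁, hy₁⟩ := h₁ x (hN₁ hx)
  obtain ⟨y₂, hy₂⟩ := h₂ x (hN₂ hx)
  obtain ⟨u, hu⟩ := h₁₂ (y₁ - y₂) (by
    have e : D (y₁ - y₂) = (x - D y₂) - (x - D y₁) := by rw [map_sub]; abel
    rw [e]
    exact sub_mem (hle₂ hy₂) (hle₁ hy₁))
  obtain ⟨n₁, hn₁, n₂, hn₂, hn⟩ := Submodule.mem_sup.1 (hsup hu)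
  have e : y₁ - n₁ = y₂ + D u + n₂ := by
    have : n₁ = (y₁ - y₂ - D u) - n₂ := by rw [← hn]; abel
    rw [this]; abel
  have hxy₁ : x - D (y₁ - n₁) ∈ N₁ := by
    have : x - D (y₁ - n₁) = (x - D y₁) + D n₁ := by rw [map_sub]; abel
    rw [this]; exact add_mem hy₁ (hD₁ _ hn₁)
  have hxy₂ : x - D (y₁ - n₁) ∈ N₂ := by
    have : x - D (y₁ - n₁) = (x - D y₂) - D n₂ := by
      rw [e, map_add, map_add, hDD]; abel
    rw [this]; exact sub_mem hy₂ (hD₂ _ hn₂)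
  obtain ⟨y, hy⟩ := hsmall _ ⟨hxy₁, hxy₂⟩ (by rw [map_sub, hDD, sub_zero]; exact hx)
  refine ⟨y₁ - n₁ + y, ?_⟩
  rwa [map_add, ← sub_sub]

/-- Acyclicity passes to the limit of a tower of quotients. -/
theorem AcyclicMod.iInf {D : M →ₗ[k] M} (hDD : ∀ x, D (D x) = 0) {N : ℕ → Submodule k M}
    (hanti : ∀ n, N (n + 1) ≤ N n) (h : ∀ n, AcyclicMod D (N n)) (hD : ∀ n, ∀ x ∈ N n, D x ∈ N n)
    (hcomplete : ∀ y : ℕ → M, (∀ n, y (n + 1) - y n ∈ N n) → ∃ z, ∀ n, z - y n ∈ N n) :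
    AcyclicMod D (⨅ n, N n) := by
  intro x hx
  rw [Submodule.mem_iInf] at hx
  have step : ∀ (n : ℕ) (y : {y // x - D y ∈ N n}), ∃ y' : {y // x - D y ∈ N (n + 1)},
      y'.1 - y.1 ∈ N n := by
    rintro n ⟨y, hy⟩
    obtain ⟨y', hy'⟩ := h (n + 1) x (hx _)
    obtain ⟨u, hu⟩ := h n (y' - y) (by
      have e : D (y' - y) = (x - D y) - (x - D y') := by rw [map_sub]; abel
      rw [e]
      exact sub_mem hy (hanti n hy'))
    refine ⟨⟨y' - D u, ?_⟩, ?_⟩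
    · rwa [map_sub, hDD, sub_zero]
    · have e : y' - D u - y = y' - y - D u := by abel
      simpa only [e] using hu
  choose f hf using step
  let y : ∀ n, {y // x - D y ∈ N n} := fun n =>
    Nat.rec (motive := fun n => {y // x - D y ∈ N n}) ⟨_, (h 0 x (hx 0)).choose_spec⟩ f n
  obtain ⟨z, hz⟩ := hcomplete (fun n => (y n).1) fun n => hf n (y n)
  refine ⟨z, Submodule.mem_iInf _ |>.2 fun n => ?_⟩
  have e : x - D z = (x - D (y n).1) - D (z - (y n).1) := by rw [map_sub]; abel
  rw [e]
  exact sub_mem (y n).2 (hD n _ (hz n))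

end Acyclic

section CupOne
variable {k : Type*} [CommRing k] {S : SSet.{0}}

theorem Tot.apply_eq_zero_of_ne {q n : ℕ} {x : Tot k S} (hx : Tot.comp q x = x) (h : n ≠ q) :
    x n = 0 := by
  rw [← hx, Tot.comp_apply, if_neg h]

theorem Tot.mul_apply_of_homogeneous {p q n : ℕ} (h : p + q = n) {x y : Tot k S}
    (hx : Tot.comp p x = x) (σ : S.obj (.op (.mk n))) :
    (x * y) n σ = cup h (x p) (y q) σ := by
  rw [Tot.mul_apply, Finset.sum_eq_single (p, q)]
  · rw [frontFace_eq_front h, backFace_eq_back h]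
    rfl
  · rintro ⟨a, b⟩ hab hne
    rw [Finset.HasAntidiagonal.mem_antidiagonal] at hab
    have : a ≠ p := by
      rintro rfl
      exact hne (by simp only at hab; rw [show b = q by omega])
    rw [Tot.apply_eq_zero_of_ne hx this]
    simp
  · intro h'
    exact absurd (Finset.HasAntidiagonal.mem_antidiagonal.2 h) h'

/-- Cocycles of degree two commute up to the coboundary of their cup-one product. -/
theorem exists_d_eq_commutator (x y : Tot k S) (hx2 : Tot.comp 2 x = x) (hy2 : Tot.comp 2 y = y)
    (hx : Tot.d x = 0) (hy : Tot.d y = 0) : ∃ w, Tot.d w = x * y - y * x := by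
  -- Steenrod's cup-one product of cochains of degree two
  let w : Tot k S := ⟨fun n => match n with
    | 3 => fun σ => x 2 (S.δ 2 σ) * y 2 (S.δ 0 σ) - x 2 (S.δ 1 σ) * y 2 (S.δ 3 σ)
    | _ => 0⟩
  refine ⟨w, Tot.ext fun n σ => ?_⟩
  by_cases hn : n = 4
  · subst hn
    -- the simplicial identities leave ten faces, on which the cocycle conditions for `x` at the
    -- faces 1, 2, 3 and for `y` at the faces 0, 4 combine to the claim
    have hface : ∀ {i j : Fin 4} (_ : i ≤ j), S.δ i (S.δ j.succ σ) = S.δ j (S.δ i.castSucc σ) :=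
      fun h => congrArg (fun f => f σ) (S.δ_comp_δ h)
    have e01 := hface (i := 0) (j := 0) (by decide)
    have e02 := hface (i := 0) (j := 1) (by decide)
    have e03 := hface (i := 0) (j := 2) (by decide)
    have e04 := hface (i := 0) (j := 3) (by decide)
    have e12 := hface (i := 1) (j := 1) (by decide)
    have e13 := hface (i := 1) (j := 2) (by decide)
    have e14 := hface (i := 1) (j := 3) (by decide)
    have e23 := hface (i := 2) (j := 2) (by decide)
    have e24 := hface (i := 2) (j := 3) (by decide)
    have e34 := hface (i := 3) (j := 3) (by decide)
    have closed : ∀ (z : Tot k S) (_ : Tot.d z = 0) (j : Fin 5), z 2 (S.δ 0 (S.δ j σ)) -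
        z 2 (S.δ 1 (S.δ j σ)) + z 2 (S.δ 2 (S.δ j σ)) - z 2 (S.δ 3 (S.δ j σ)) = 0 := by
      intro z hz j
      have h : Tot.d z 3 (S.δ j σ) = 0 := by rw [hz]; rfl
      have h2 := (Fin.sum_univ_four
        (fun i : Fin 4 => (-1 : k) ^ (i : ℕ) * z 2 (S.δ i (S.δ j σ)))).symm.trans h
      rw [← h2]
      norm_num
      ring
    have ef : frontFace 2 4 = SimplexCategory.δ (3 : Fin 4) ≫ SimplexCategory.δ (3 : Fin 5) := by
      ext a; fin_cases a <;> rfl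
    have eb : backFace 2 4 = SimplexCategory.δ (0 : Fin 4) ≫ SimplexCategory.δ (0 : Fin 5) := by
      ext a; fin_cases a <;> rfl
    have emul : ∀ z z' : Tot k S, Tot.comp 2 z = z →
        (z * z') 4 σ = z 2 (S.δ 3 (S.δ 3 σ)) * z' 2 (S.δ 0 (S.δ 0 σ)) := by
      intro z z' hz
      rw [Tot.mul_apply_of_homogeneous (show 2 + 2 = 4 from rfl) hz, cup, ← frontFace_eq_front,
        ← backFace_eq_back, ef, eb, ← Tot.map_map, ← Tot.map_map]
      rfl
    have cx1 := closed x hx 1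
    have cx2 := closed x hx 2
    have cx3 := closed x hx 3
    have cy0 := closed y hy 0
    have cy4 := closed y hy 4
    change S.δ 0 (S.δ 1 σ) = S.δ 0 (S.δ 0 σ) at e01
    change S.δ 0 (S.δ 2 σ) = S.δ 1 (S.δ 0 σ) at e02
    change S.δ 0 (S.δ 3 σ) = S.δ 2 (S.δ 0 σ) at e03
    change S.δ 0 (S.δ 4 σ) = S.δ 3 (S.δ 0 σ) at e04
    change S.δ 1 (S.δ 2 σ) = S.δ 1 (S.δ 1 σ) at e12
    change S.δ 1 (S.δ 3 σ) = S.δ 2 (S.δ 1 σ) at e13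
    change S.δ 1 (S.δ 4 σ) = S.δ 3 (S.δ 1 σ) at e14
    change S.δ 2 (S.δ 3 σ) = S.δ 2 (S.δ 2 σ) at e23
    change S.δ 2 (S.δ 4 σ) = S.δ 3 (S.δ 2 σ) at e24
    change S.δ 3 (S.δ 4 σ) = S.δ 3 (S.δ 3 σ) at e34
    have hdw : Tot.d w 4 σ = w 3 (S.δ 0 σ) - w 3 (S.δ 1 σ) + w 3 (S.δ 2 σ) - w 3 (S.δ 3 σ) +
        w 3 (S.δ 4 σ) := by
      refine (Fin.sum_univ_five (fun i : Fin 5 => (-1 : k) ^ (i : ℕ) * w 3 (S.δ i σ))).trans ?_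
      norm_num
      ring
    rw [Tot.sub_apply, emul x y hx2, emul y x hy2, hdw]
    simp only [w]
    rw [e01] at cx1
    rw [e02, e12] at cx2
    rw [e03, e13, e23] at cx3
    rw [e04, e14, e24, e34] at cy4
    rw [e01, e02, e03, e04, e12, e13, e14, e23, e24, e34]
    linear_combination y 2 (S.δ 0 (S.δ 0 σ)) * cx3 - x 2 (S.δ 2 (S.δ 2 σ)) * cy0 -
      x 2 (S.δ 1 (S.δ 1 σ)) * cy4 - y 2 (S.δ 3 (S.δ 0 σ)) * cx2 + y 2 (S.δ 3 (S.δ 3 σ)) * cx1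
  · have hw : ∀ n, n ≠ 3 → w n = 0 := by
      intro n hn
      simp only [w]
    have h22 : ∀ z z' : Tot k S, Tot.comp 2 z = z → Tot.comp 2 z' = z' → (z * z') n = 0 := by
      intro z z' hz hz'
      refine Tot.apply_eq_zero_of_ne (q := 4) ?_ hn
      have := Tot.comp_mul_of_homogeneous hz' 2 z
      rwa [hz] at this
    rw [Tot.sub_apply, h22 x y hx2 hy2, h22 y x hy2 hx2]
    cases n with
    | zero => rw [Tot.d_zero_apply]; simp
    | succ n =>
      rw [Tot.d_apply, hw n (by omega)]
      simp

end CupOne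
end SingCoh
end

noncomputable section

/-! ### Continuity on the infinite-dimensional sphere -/

namespace MomentAngle

open Topology

section FinCont
variable {Y Z : Type*} [TopologicalSpace Y] [TopologicalSpace Z]

/-- The square of the Euclidean norm of a finitely supported sequence. -/
def nsq (v : ℕ →₀ ℂ) : ℝ := v.sum fun _ w => ‖w‖ ^ 2

theorem nsq_eq_sum {v : ℕ →₀ ℂ} {N : ℕ} (h : ∀ j, N ≤ j → v j = 0) :
    nsq v = ∑ j ∈ Finset.range N, ‖v j‖ ^ 2 :=
  Finsupp.sum_of_support_subset _ (fun j hj => by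
    rw [Finset.mem_range]
    by_contra hN
    exact (Finsupp.mem_support_iff.1 hj) (h j (not_lt.1 hN))) _ (by simp)

theorem exists_bound (v : ℕ →₀ ℂ) : ∃ N, ∀ j, N ≤ j → v j = 0 := by
  refine ⟨v.support.sup id + 1, fun j hj => ?_⟩
  by_contra h
  have := Finset.le_sup (f := id) (Finsupp.mem_support_iff.2 h)
  simp only [id] at this
  omega

theorem nsq_nonneg (v : ℕ →₀ ℂ) : 0 ≤ nsq v := Finset.sum_nonneg fun _ _ => by positivity

theorem nsq_smul (c : ℂ) (v : ℕ →₀ ℂ) : nsq (c • v) = ‖c‖ ^ 2 * nsq v := by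
  obtain ⟨N, hN⟩ := exists_bound v
  rw [nsq_eq_sum hN, nsq_eq_sum (N := N) (fun j hj => by simp [hN j hj]), Finset.mul_sum]
  exact Finset.sum_congr rfl fun j _ => by simp [mul_pow]

theorem norm_sq_le_nsq (v : ℕ →₀ ℂ) (j : ℕ) : ‖v j‖ ^ 2 ≤ nsq v := by
  by_cases h : v j = 0
  · rw [h]; simpa using nsq_nonneg v
  · exact Finset.single_le_sum (f := fun j => ‖v j‖ ^ 2) (fun _ _ => by positivity)
      (Finsupp.mem_support_iff.2 h)

theorem nsq_pos {v : ℕ →₀ ℂ} (h : v ≠ 0) : 0 < nsq v := by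
  obtain ⟨j, hj⟩ := Finsupp.ne_iff.1 h
  exact lt_of_lt_of_le (by simp only [Finsupp.coe_zero, Pi.zero_apply] at hj; positivity)
    (norm_sq_le_nsq v j)

theorem nsq_zero : nsq 0 = 0 := by simp [nsq]

theorem nsq_single_add (w : ℂ) {v : ℕ →₀ ℂ} (h : v 0 = 0) :
    nsq (Finsupp.single 0 w + v) = ‖w‖ ^ 2 + nsq v := by
  obtain ⟨N, hN⟩ := exists_bound v
  rw [nsq_eq_sum (N := N + 1) (v := v) (fun j hj => hN j (by omega)),
    nsq_eq_sum (N := N + 1) (fun j hj => by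
      rw [Finsupp.add_apply, hN j (by omega), Finsupp.single_apply, if_neg (by omega), add_zero]),
    Finset.sum_range_succ', Finset.sum_range_succ']
  simp [h, add_comm]

/-- The right shift of sequences. -/
def shift : (ℕ →₀ ℂ) →ₗ[ℂ] (ℕ →₀ ℂ) := Finsupp.lmapDomain ℂ ℂ Nat.succ

@[simp] theorem shift_apply_zero (v : ℕ →₀ ℂ) : shift v 0 = 0 :=
  Finsupp.mapDomain_of_notMem_range _ _ (by simp)

@[simp] theorem shift_apply_succ (v : ℕ →₀ ℂ) (j : ℕ) : shift v (j + 1) = v j :=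
  Finsupp.mapDomain_apply Nat.succ_injective _ _

/-- A family of finitely supported sequences whose supports are uniformly bounded and whose
coordinates are continuous. -/
def FinCont (v : Y → ℕ →₀ ℂ) : Prop :=
  (∃ N, ∀ y j, N ≤ j → v y j = 0) ∧ ∀ j, Continuous fun y => v y j

theorem FinCont.add {v w : Y → ℕ →₀ ℂ} (hv : FinCont v) (hw : FinCont w) :
    FinCont fun y => v y + w y := by
  obtain ⟨⟨N, hN⟩, hc⟩ := hv
  obtain ⟨⟨M, hM⟩, hd⟩ := hw
  refine ⟨⟨max N M, fun y j hj => ?_⟩, fun j => (hc j).add (hd j)⟩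
  rw [Finsupp.add_apply, hN y j (le_trans (le_max_left _ _) hj),
    hM y j (le_trans (le_max_right _ _) hj), add_zero]

theorem FinCont.smul {v : Y → ℕ →₀ ℂ} {c : Y → ℂ} (hc : Continuous c) (hv : FinCont v) :
    FinCont fun y => c y • v y :=
  ⟨hv.1.imp fun N hN y j hj => by simp [hN y j hj], fun j => hc.mul (hv.2 j)⟩

theorem FinCont.shift {v : Y → ℕ →₀ ℂ} (hv : FinCont v) : FinCont fun y => shift (v y) := by
  obtain ⟨⟨N, hN⟩, hc⟩ := hv
  refine ⟨⟨N + 1, fun y j hj => ?_⟩, fun j => ?_⟩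
  · obtain ⟨j, rfl⟩ : ∃ i, j = i + 1 := ⟨j - 1, by omega⟩
    rw [shift_apply_succ, hN y j (by omega)]
  · cases j with
    | zero => simpa using continuous_const
    | succ j => simpa using hc j

theorem FinCont.single {c : Y → ℂ} (hc : Continuous c) (i : ℕ) :
    FinCont fun y => Finsupp.single i (c y) := by
  refine ⟨⟨i + 1, fun y j hj => ?_⟩, fun j => ?_⟩
  · rw [Finsupp.single_apply, if_neg (by omega)]
  · simp only [Finsupp.single_apply]
    split_ifs
    · exact hc
    · exact continuous_const

theorem FinCont.sub {v w : Y → ℕ →₀ ℂ} (hv : FinCont v) (hw : FinCont w) :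
    FinCont fun y => v y - w y := by
  simpa [sub_eq_add_neg] using hv.add (hw.smul (c := fun _ => -1) continuous_const)

theorem FinCont.comp {v : Y → ℕ →₀ ℂ} (hv : FinCont v) {f : Z → Y} (hf : Continuous f) :
    FinCont fun z => v (f z) :=
  ⟨hv.1.imp fun _ hN _ => hN _, fun j => (hv.2 j).comp hf⟩

theorem FinCont.nsq {v : Y → ℕ →₀ ℂ} (hv : FinCont v) : Continuous fun y => nsq (v y) := by
  obtain ⟨⟨N, hN⟩, hc⟩ := hv
  simp only [nsq_eq_sum (hN _)]
  exact continuous_finsetSum _ fun j _ => (hc j).norm.pow 2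

end FinCont

namespace SInf

instance : CoeFun SInf fun _ => ℕ → ℂ := ⟨fun e => e.1⟩

@[ext] theorem ext {e e' : SInf} (h : ∀ j, e j = e' j) : e = e' := Subtype.ext (Finsupp.ext h)

theorem nsq_val (e : SInf) : nsq e.1 = 1 := e.2

theorem ne_zero (e : SInf) : e.1 ≠ 0 := fun h => by
  have := e.nsq_val
  rw [h, nsq_zero] at this
  exact zero_ne_one this

theorem norm_apply_le (e : SInf) (j : ℕ) : ‖e j‖ ≤ 1 := by
  have := (norm_sq_le_nsq e.1 j).trans_eq e.nsq_val
  nlinarith [norm_nonneg (e j)]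

@[simp] theorem smul_apply (g : Circle) (e : SInf) (j : ℕ) : (g • e) j = g * e j := rfl

theorem smul_val (g : Circle) (e : SInf) : (g • e).1 = (g : ℂ) • e.1 := rfl

theorem incl_apply (n : ℕ) (v : FinSphere n) (j : ℕ) :
    (FinSphere.incl n v) j = if h : j < n then v.1 ⟨j, h⟩ else 0 := by
  change ((Finsupp.equivFunOnFinite.symm v.1).embDomain Fin.valEmbedding) j = _
  split_ifs with h
  · exact Finsupp.embDomain_apply_self Fin.valEmbedding _ (⟨j, h⟩ : Fin n)
  · refine Finsupp.embDomain_of_notMem_range _ _ _ ?_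
    rintro ⟨i, rfl⟩
    exact h i.2

theorem finCont_incl (n : ℕ) : FinCont fun v : FinSphere n => (FinSphere.incl n v).1 := by
  refine ⟨⟨n, fun v j hj => ?_⟩, fun j => ?_⟩
  · exact (incl_apply n v j).trans (dif_neg (not_lt.2 hj))
  · have : (fun v : FinSphere n => (FinSphere.incl n v).1 j) =
        fun v => if h : j < n then v.1 ⟨j, h⟩ else 0 := funext fun v => incl_apply n v j
    rw [this]
    split_ifs
    · exact (continuous_apply _).comp continuous_subtype_val
    · exact continuous_const

theorem continuous_incl (n : ℕ) : Continuous (FinSphere.incl n) :=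
  continuous_iff_coinduced_le.2 (le_iSup (fun n => TopologicalSpace.coinduced (FinSphere.incl n)
    inferInstance) n)

theorem exists_incl {e : SInf} {n : ℕ} (h : ∀ j, n ≤ j → e j = 0) :
    ∃ v : FinSphere n, FinSphere.incl n v = e := by
  refine ⟨⟨fun j => e j, ?_⟩, ?_⟩
  · rw [Fin.sum_univ_eq_sum_range (fun j => ‖e j‖ ^ 2) n, ← nsq_eq_sum h]
    exact e.2
  · ext j
    rw [incl_apply]
    split_ifs with hj
    · rfl
    · exact (h j (not_lt.1 hj)).symm

theorem continuous_of_finCont {Y : Type*} [TopologicalSpace Y] {f : Y → SInf}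
    (hf : FinCont fun y => (f y).1) : Continuous f := by
  obtain ⟨⟨N, hN⟩, hc⟩ := hf
  choose g hg using fun y => exists_incl (hN y)
  have : f = FinSphere.incl N ∘ g := funext fun y => (hg y).symm
  rw [this]
  refine (continuous_incl N).comp (continuous_induced_rng.2 (continuous_pi fun j => ?_))
  convert hc j using 2 with y
  have h := incl_apply N (g y) j
  rw [dif_pos j.2, hg] at h
  exact h.symm

theorem isQuotientMap_incl :
    IsQuotientMap fun p : Σ n, FinSphere n => FinSphere.incl p.1 p.2 := by
  refine ⟨⟨?_⟩, fun e => ?_⟩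
  · change (⨆ n : ℕ, TopologicalSpace.coinduced (FinSphere.incl n) inferInstance) =
      TopologicalSpace.coinduced _ (⨆ n, TopologicalSpace.coinduced (Sigma.mk n) inferInstance)
    simp only [coinduced_iSup, coinduced_compose]
    rfl
  · obtain ⟨N, hN⟩ := exists_bound e.1
    obtain ⟨v, hv⟩ := exists_incl hN
    exact ⟨⟨N, v⟩, hv⟩

/-- Continuity out of `S^∞ × Y` may be tested on the finite-dimensional spheres if `Y` is locally
compact. -/
theorem continuous_prod {Y Z : Type*} [TopologicalSpace Y] [LocallyCompactSpace Y]
    [TopologicalSpace Z] {f : SInf × Y → Z}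
    (h : ∀ n, Continuous fun p : FinSphere n × Y => f (FinSphere.incl n p.1, p.2)) :
    Continuous f := by
  refine isQuotientMap_incl.continuous_lift_prod_left ?_
  have : (fun p : (Σ n, FinSphere n) × Y => f (FinSphere.incl p.1.1 p.1.2, p.2)) =
      (fun q : Σ n, FinSphere n × Y => f (FinSphere.incl q.1 q.2.1, q.2.2)) ∘
        Homeomorph.sigmaProdDistrib := rfl
  change Continuous (fun p : (Σ n, FinSphere n) × Y => f (FinSphere.incl p.1.1 p.1.2, p.2))
  rw [this]
  exact (continuous_sigma h).comp (Homeomorph.continuous _)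

theorem continuous_dom {Z : Type*} [TopologicalSpace Z] {f : SInf → Z}
    (h : ∀ n, Continuous fun v : FinSphere n => f (FinSphere.incl n v)) : Continuous f :=
  isQuotientMap_incl.continuous_iff.2 (continuous_sigma h)

theorem continuous_apply (j : ℕ) : Continuous fun e : SInf => e j :=
  continuous_dom fun n => (finCont_incl n).2 j

/-- The continuous self-maps of `S^∞`, with parameters in a locally compact space, given by
families of finitely supported sequences. -/
theorem continuous_prod_of_finCont {Y : Type*} [TopologicalSpace Y] [LocallyCompactSpace Y]
    {f : SInf × Y → SInf}
    (h : ∀ n, FinCont fun p : FinSphere n × Y => (f (FinSphere.incl n p.1, p.2)).1) :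
    Continuous f :=
  continuous_prod fun n => continuous_of_finCont (h n)

instance : ContinuousSMul Circle SInf where
  continuous_smul := by
    have : Continuous fun p : SInf × Circle => p.2 • p.1 :=
      continuous_prod_of_finCont fun n =>
        ((finCont_incl n).comp continuous_fst).smul
          (show Continuous fun p : FinSphere n × Circle => (p.2 : ℂ) by fun_prop)
    exact this.comp continuous_swap

/-- The first basis vector. -/
def e0 : SInf := FinSphere.incl 1 ⟨fun _ => 1, by simp⟩

theorem e0_val : e0.1 = Finsupp.single 0 1 := by
  ext j
  refine (incl_apply 1 _ j).trans ?_
  rw [Finsupp.single_apply]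
  by_cases h : j = 0
  · simp [h]
  · rw [dif_neg (by omega), if_neg (Ne.symm h)]

/-- A unit vector as a point of `S^∞`. -/
def mk (v : ℕ →₀ ℂ) (h : nsq v = 1) : SInf := ⟨v, h⟩

@[simp] theorem mk_val (v : ℕ →₀ ℂ) (h : nsq v = 1) : (mk v h).1 = v := rfl

/-- The normalization `v / ‖v‖` of a sequence (the first basis vector for `v = 0`). -/
def nrm (v : ℕ →₀ ℂ) : SInf :=
  if h : v = 0 then e0 else mk (((√(nsq v))⁻¹ : ℂ) • v) <| by
    have h0 := nsq_pos h
    rw [nsq_smul, norm_inv, Complex.norm_real, Real.norm_eq_abs, abs_of_nonneg (Real.sqrt_nonneg _),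
      inv_pow, Real.sq_sqrt h0.le, inv_mul_cancel₀ h0.ne']

theorem nrm_val {v : ℕ →₀ ℂ} (h : v ≠ 0) : (nrm v).1 = ((√(nsq v))⁻¹ : ℂ) • v := by
  rw [nrm, dif_neg h, mk_val]

theorem nrm_of_mem (e : SInf) : nrm e.1 = e := by
  refine Subtype.ext ?_
  rw [nrm_val e.ne_zero, nsq_val]
  simp

theorem nrm_smul (g : Circle) {v : ℕ →₀ ℂ} (h : v ≠ 0) : nrm ((g : ℂ) • v) = g • nrm v := by
  refine Subtype.ext ?_
  rw [smul_val, nrm_val h, nrm_val (smul_ne_zero g.coe_ne_zero h), nsq_smul, Circle.norm_coe,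
    one_pow, one_mul, smul_comm]

theorem finCont_nrm {Y : Type*} [TopologicalSpace Y] {v : Y → ℕ →₀ ℂ} (hv : FinCont v)
    (h : ∀ y, v y ≠ 0) : FinCont fun y => (nrm (v y)).1 := by
  simp only [nrm_val (h _)]
  refine FinCont.smul ?_ hv
  refine Continuous.inv₀ (by have := hv.nsq; fun_prop) fun y => ?_
  exact_mod_cast (Real.sqrt_pos.2 (nsq_pos (h y))).ne'

end SInf
end MomentAngle
end

noncomputable section

/-! ### Moving the first coordinate of a point of the sphere -/

namespace MomentAngle

open Topology unitInterval

/-- The closed unit disc of the complex plane. -/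
abbrev Disc : Type := Metric.closedBall (0 : ℂ) 1

theorem Disc.norm_le (w : Disc) : ‖(w : ℂ)‖ ≤ 1 := mem_closedBall_zero_iff.1 w.2

/-- Normalizing a sequence and rescaling it to a norm that vanishes where the sequence does. -/
theorem FinCont.rescale {Y : Type*} [TopologicalSpace Y] {v : Y → ℕ →₀ ℂ} (hv : FinCont v)
    {c : Y → ℝ} (hc : Continuous c) (h : ∀ y, v y = 0 → c y = 0) :
    FinCont fun y => ((c y / √(MomentAngle.nsq (v y)) : ℝ) : ℂ) • v y := by
  refine ⟨hv.1.imp fun N hN y j hj => by simp [hN y j hj], fun j => ?_⟩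
  refine continuous_iff_continuousAt.2 fun y => ?_
  by_cases hy : v y = 0
  · have hb : ∀ y, ‖(((c y / √(MomentAngle.nsq (v y)) : ℝ) : ℂ) • v y) j‖ ≤ |c y| := by
      intro y
      rw [Finsupp.smul_apply, norm_smul, Complex.norm_real, Real.norm_eq_abs, abs_div,
        abs_of_nonneg (Real.sqrt_nonneg _), div_mul_eq_mul_div]
      refine div_le_of_le_mul₀ (Real.sqrt_nonneg _) (abs_nonneg _)
        (mul_le_mul_of_nonneg_left ?_ (abs_nonneg _))
      exact Real.le_sqrt_of_sq_le (norm_sq_le_nsq _ _)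
    have h0 : (((c y / √(MomentAngle.nsq (v y)) : ℝ) : ℂ) • v y) j = 0 := by simp [hy]
    rw [ContinuousAt, h0]
    refine squeeze_zero_norm hb ?_
    have := (hc.abs).tendsto y
    rwa [h y hy, abs_zero] at this
  · have h1 := hv.nsq
    have h2 := hv.2 j
    have h3 : √(MomentAngle.nsq (v y)) ≠ 0 := (Real.sqrt_pos.2 (nsq_pos hy)).ne'
    change ContinuousAt (fun y => ((c y / √(MomentAngle.nsq (v y)) : ℝ) : ℂ) * v y j) y
    refine ContinuousAt.mul (Complex.continuous_ofReal.continuousAt.comp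
      (ContinuousAt.div hc.continuousAt ?_ h3)) h2.continuousAt
    exact (Real.continuous_sqrt.comp h1).continuousAt

namespace SInf

/-- The direction of the remaining coordinates when the first coordinate of `e` is moved to `w`: the
tail of `e`, mixed with the shift of `e - w` so as not to vanish. -/
def tailDir (e : SInf) (w : ℂ) : ℕ →₀ ℂ :=
  ((1 - ‖e 0 - w‖ / 2 : ℝ) : ℂ) • (e.1 - Finsupp.single 0 (e 0)) +
    ((‖e 0 - w‖ / 2 : ℝ) : ℂ) • shift (e.1 - Finsupp.single 0 w)

theorem tailDir_zero (e : SInf) (w : ℂ) : tailDir e w 0 = 0 := by simp [tailDir]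

theorem tailDir_one (e : SInf) (w : ℂ) : tailDir e w 1 =
    ((1 - ‖e 0 - w‖ / 2 : ℝ) : ℂ) * e 1 + ((‖e 0 - w‖ / 2 : ℝ) : ℂ) * (e 0 - w) := by
  have h : shift (e.1 - Finsupp.single 0 w) 1 = e 0 - w := by
    rw [shift_apply_succ _ 0]; simp
  rw [tailDir, Finsupp.add_apply, Finsupp.smul_apply, Finsupp.smul_apply, h]
  simp

theorem tailDir_add_two (e : SInf) (w : ℂ) (j : ℕ) : tailDir e w (j + 2) =
    ((1 - ‖e 0 - w‖ / 2 : ℝ) : ℂ) * e (j + 2) + ((‖e 0 - w‖ / 2 : ℝ) : ℂ) * e (j + 1) := by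
  rw [tailDir, Finsupp.add_apply, Finsupp.smul_apply, Finsupp.smul_apply, shift_apply_succ]
  simp

theorem tailDir_smul (g : Circle) (e : SInf) (w : ℂ) :
    tailDir (g • e) (g * w) = (g : ℂ) • tailDir e w := by
  have h : ‖(g • e) 0 - g * w‖ = ‖e 0 - w‖ := by
    rw [smul_apply, ← mul_sub, norm_mul, Circle.norm_coe, one_mul]
  have h1 : (g • e).1 - Finsupp.single 0 ((g • e) 0) = (g : ℂ) • (e.1 - Finsupp.single 0 (e 0)) := by
    rw [smul_sub, Finsupp.smul_single]; rfl
  have h2 : (g • e).1 - Finsupp.single 0 (g * w) = (g : ℂ) • (e.1 - Finsupp.single 0 w) := by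
    rw [smul_sub, Finsupp.smul_single]; rfl
  rw [tailDir, h, h1, h2, map_smul, tailDir, smul_add, smul_comm, smul_comm _ (g : ℂ)]

theorem tailDir_self (e : SInf) : tailDir e (e 0) = e.1 - Finsupp.single 0 (e 0) := by
  simp [tailDir]

theorem tailDir_ne_zero {e : SInf} {w : ℂ} (hw : ‖w‖ < 1) : tailDir e w ≠ 0 := by
  intro h
  by_cases ht : e 0 = w
  · rw [← ht, tailDir_self, sub_eq_zero] at h
    have h1 := e.nsq_val
    have h2 := nsq_single_add (e 0) (v := 0) rfl
    rw [add_zero, ← h, h1, nsq_zero, add_zero, ht] at h2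
    nlinarith [norm_nonneg w]
  · have hpos : 0 < ‖e 0 - w‖ := norm_pos_iff.2 (sub_ne_zero.2 ht)
    have hlt : ‖e 0 - w‖ < 2 := by
      have := norm_sub_le (e 0) w
      have := e.norm_apply_le 0
      linarith
    have ht0 : ((‖e 0 - w‖ / 2 : ℝ) : ℂ) ≠ 0 := by
      exact_mod_cast (by positivity : ‖e 0 - w‖ / 2 ≠ 0)
    -- every coordinate of `e` would be nonzero
    have key : ∀ j, e (j + 1) ≠ 0 := by
      intro j
      induction j with
      | zero =>
        intro h1
        have := tailDir_one e w
        rw [h, Finsupp.zero_apply, show e 1 = 0 from h1, mul_zero, zero_add] at this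
        exact mul_ne_zero ht0 (sub_ne_zero.2 ht) this.symm
      | succ j ih =>
        intro h1
        have := tailDir_add_two e w j
        rw [h, Finsupp.zero_apply, show e (j + 2) = 0 from h1, mul_zero, zero_add] at this
        exact mul_ne_zero ht0 ih this.symm
    obtain ⟨N, hN⟩ := exists_bound e.1
    exact key N (hN _ (by omega))

theorem tailDir_eq_zero {e : SInf} {w : ℂ} (hw : ‖w‖ ≤ 1) (h : tailDir e w = 0) : ‖w‖ = 1 :=
  le_antisymm hw (not_lt.1 fun h' => tailDir_ne_zero h' h)

/-- The point of `S^∞` with first coordinate `w` obtained from `e` by moving its first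
coordinate to `w`. -/
def move (e : SInf) (w : Disc) : SInf :=
  mk (Finsupp.single 0 (w : ℂ) +
    ((√(1 - ‖(w : ℂ)‖ ^ 2) / √(nsq (tailDir e w)) : ℝ) : ℂ) • tailDir e w) <| by
    rw [nsq_single_add _ (by simp [tailDir_zero]), nsq_smul, Complex.norm_real, Real.norm_eq_abs,
      sq_abs, div_pow, Real.sq_sqrt (nsq_nonneg _), Real.sq_sqrt (by
        have := w.norm_le; nlinarith [norm_nonneg (w : ℂ)])]
    by_cases h : tailDir e w = 0
    · simp [tailDir_eq_zero w.norm_le h]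
    · rw [div_mul_cancel₀ _ (nsq_pos h).ne']; ring

theorem move_val (e : SInf) (w : Disc) : (move e w).1 = Finsupp.single 0 (w : ℂ) +
    ((√(1 - ‖(w : ℂ)‖ ^ 2) / √(nsq (tailDir e w)) : ℝ) : ℂ) • tailDir e w := rfl

@[simp] theorem move_zero (e : SInf) (w : Disc) : move e w 0 = w := by
  rw [move_val]; simp [tailDir_zero]

theorem move_self (e : SInf) (w : Disc) (h : (w : ℂ) = e 0) : move e w = e := by
  refine Subtype.ext ?_
  have h1 : e.1 = Finsupp.single 0 (e 0) + (e.1 - Finsupp.single 0 (e 0)) := by abel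
  have h2 := e.nsq_val
  rw [h1, nsq_single_add _ (by simp)] at h2
  rw [move_val, h, tailDir_self]
  by_cases h0 : e.1 - Finsupp.single 0 (e 0) = 0
  · rw [h0, smul_zero, add_zero]; exact (sub_eq_zero.1 h0).symm
  · have h3 : 1 - ‖e 0‖ ^ 2 = nsq (e.1 - Finsupp.single 0 (e 0)) := by linarith
    rw [h3, div_self (Real.sqrt_pos.2 (nsq_pos h0)).ne']
    simp

/-- Rotation of the disc. -/
instance : SMul Circle Disc := ⟨fun g w => ⟨g * w, by simpa [Circle.norm_coe] using w.norm_le⟩⟩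

@[simp] theorem disc_smul_coe (g : Circle) (w : Disc) : ((g • w : Disc) : ℂ) = g * w := rfl

theorem move_smul (g : Circle) (e : SInf) (w : Disc) : move (g • e) (g • w) = g • move e w := by
  refine Subtype.ext ?_
  rw [smul_val, move_val, move_val, disc_smul_coe, tailDir_smul, nsq_smul, norm_mul,
    Circle.norm_coe, one_mul, one_pow, one_mul, smul_add, Finsupp.smul_single, smul_eq_mul,
    smul_comm]

theorem exists_move_eq_smul (e : SInf) (w : Disc) (h : ‖(w : ℂ)‖ = 1) :
    ∃ g : Circle, move e w = g • e0 := by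
  obtain ⟨g, hg⟩ : ∃ g : Circle, (g : ℂ) = w := ⟨⟨w, mem_sphere_zero_iff_norm.2 h⟩, rfl⟩
  refine ⟨g, Subtype.ext ?_⟩
  rw [move_val, smul_val, e0_val, h, hg]
  simp

section
variable {Y : Type*} [TopologicalSpace Y]

theorem finCont_tailDir {u : Y → SInf} (hu : FinCont fun y => (u y).1) {w : Y → ℂ}
    (hw : Continuous w) : FinCont fun y => tailDir (u y) (w y) := by
  have h0 := hu.2 0
  exact ((hu.sub (FinCont.single h0 0)).smul (by fun_prop)).add
    ((hu.sub (FinCont.single hw 0)).shift.smul (by fun_prop))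

theorem finCont_move {u : Y → SInf} (hu : FinCont fun y => (u y).1) {w : Y → Disc}
    (hw : Continuous w) : FinCont fun y => (move (u y) (w y)).1 := by
  refine (FinCont.single (by fun_prop : Continuous fun y => (w y : ℂ)) 0).add
    ((finCont_tailDir hu (by fun_prop)).rescale (by fun_prop) fun y hy => ?_)
  simp [tailDir_eq_zero (w y).norm_le hy]

end

/-- The straight path from `e` to `move e w`, pushed off the origin by a double shift. -/
def pathVec (e : SInf) (w : Disc) (s : I) : ℕ →₀ ℂ :=
  ((1 - s : ℝ) : ℂ) • e.1 + ((s : ℝ) : ℂ) • (move e w).1 +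
    ((s * (1 - s) * ‖e 0 - w‖ : ℝ) : ℂ) • shift (shift e.1)

theorem pathVec_self (e : SInf) (w : Disc) (s : I) (h : (w : ℂ) = e 0) : pathVec e w s = e.1 := by
  rw [pathVec, move_self e w h, h, ← add_smul]
  simp

theorem pathVec_ne_zero (e : SInf) (w : Disc) (s : I) : pathVec e w s ≠ 0 := by
  by_cases h : (w : ℂ) = e 0
  · rw [pathVec_self e w s h]; exact e.ne_zero
  by_cases hs0 : (s : ℝ) = 0
  · rw [pathVec, hs0]; simpa using e.ne_zero
  by_cases hs1 : (s : ℝ) = 1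
  · rw [pathVec, hs1]; simpa using (move e w).ne_zero
  -- the last nonzero coordinate of `e` is only seen by the double shift
  intro h0
  obtain ⟨N, hN, hmax⟩ : ∃ N, e N ≠ 0 ∧ ∀ j, N < j → e j = 0 := by
    have hne : e.1.support.Nonempty := Finsupp.support_nonempty_iff.2 e.ne_zero
    refine ⟨e.1.support.max' hne, Finsupp.mem_support_iff.1 (e.1.support.max'_mem hne),
      fun j hj => ?_⟩
    by_contra hj0
    exact absurd (e.1.support.le_max' j (Finsupp.mem_support_iff.2 hj0)) (not_le.2 hj)
  have h1 := DFunLike.congr_fun h0 (N + 2)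
  rw [pathVec, move_val] at h1
  simp only [Finsupp.add_apply, Finsupp.smul_apply, smul_eq_mul, Finsupp.zero_apply,
    shift_apply_succ, tailDir_add_two] at h1
  rw [hmax (N + 2) (by omega), hmax (N + 1) (by omega), Finsupp.single_apply,
    if_neg (by omega)] at h1
  simp only [mul_zero, zero_add, add_zero, mul_eq_zero, hN, or_false] at h1
  have h2 : (s : ℝ) * (1 - s) * ‖e 0 - w‖ = 0 := by exact_mod_cast h1
  have h3 : 0 < ‖e 0 - w‖ := norm_pos_iff.2 (sub_ne_zero.2 (Ne.symm h))
  have h4 : (s : ℝ) * (1 - s) = 0 := (mul_eq_zero.1 h2).resolve_right h3.ne'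
  rcases mul_eq_zero.1 h4 with h5 | h5
  · exact hs0 h5
  · exact hs1 (by linarith)

/-- An equivariant path in `S^∞` from `e` to `move e w`, constant if `w` is the first coordinate
of `e`. -/
def movePath (e : SInf) (w : Disc) (s : I) : SInf := nrm (pathVec e w s)

@[simp] theorem movePath_zero (e : SInf) (w : Disc) : movePath e w 0 = e := by
  rw [movePath, pathVec]; simp [nrm_of_mem]

@[simp] theorem movePath_one (e : SInf) (w : Disc) : movePath e w 1 = move e w := by
  rw [movePath, pathVec]; simp [nrm_of_mem]

theorem movePath_self (e : SInf) (w : Disc) (s : I) (h : (w : ℂ) = e 0) : movePath e w s = e := by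
  rw [movePath, pathVec_self e w s h, nrm_of_mem]

theorem movePath_smul (g : Circle) (e : SInf) (w : Disc) (s : I) :
    movePath (g • e) (g • w) s = g • movePath e w s := by
  have h : ‖(g • e) 0 - (g • w : Disc)‖ = ‖e 0 - w‖ := by
    rw [smul_apply, disc_smul_coe, ← mul_sub, norm_mul, Circle.norm_coe, one_mul]
  have : pathVec (g • e) (g • w) s = (g : ℂ) • pathVec e w s := by
    rw [pathVec, pathVec, h, move_smul, smul_val, smul_val, map_smul, map_smul, smul_add, smul_add]
    simp only [smul_comm (g : ℂ)]
  rw [movePath, this, nrm_smul _ (pathVec_ne_zero e w s), movePath]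

theorem continuous_movePath : Continuous fun p : SInf × Disc × I => movePath p.1 p.2.1 p.2.2 := by
  refine continuous_prod_of_finCont fun n => finCont_nrm ?_ fun p => pathVec_ne_zero _ _ _
  have hu : FinCont fun p : FinSphere n × Disc × I => (FinSphere.incl n p.1).1 :=
    (finCont_incl n).comp continuous_fst
  have h0 := hu.2 0
  refine ((hu.smul ?_).add ((finCont_move hu (by fun_prop)).smul ?_)).add
    ((hu.shift.shift).smul ?_)
  · fun_prop
  · fun_prop
  · fun_prop

end SInf

/-! ### The Borel construction retracts onto the Stanley–Reisner space -/

section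
variable {m : ℕ} (K : PreAbstractSimplicialComplex (Fin m))

variable {K} in
/-- The complex conjugate of a coordinate of a point of the moment-angle complex. -/
def conjCoord (z : momentAngle K) (i : Fin m) : Disc :=
  ⟨(starRingEnd ℂ) (z.1 i), by simpa using z.2.1 i⟩

theorem continuous_conjCoord (i : Fin m) : Continuous fun z : momentAngle K => conjCoord z i :=
  Continuous.subtype_mk (Complex.continuous_conj.comp
    ((continuous_apply i).comp continuous_subtype_val)) _

variable {K} in
theorem conjCoord_inv_smul (g : Torus m) (z : momentAngle K) (i : Fin m) :
    conjCoord (g⁻¹ • z) i = g i • conjCoord z i := by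
  refine Subtype.ext ?_
  change (starRingEnd ℂ) (((g i)⁻¹ : Circle) * z.1 i) = g i * (starRingEnd ℂ) (z.1 i)
  rw [map_mul, ← Circle.coe_inv_eq_conj, inv_inv]

variable {K} in
/-- The equivariant homotopy of `ET^m × Z_K` over `Z_K`. -/
def torusPath (e : ET m) (z : momentAngle K) (s : I) : ET m :=
  fun i => SInf.movePath (e i) (conjCoord z i) s

variable {K} in
theorem torusPath_smul (g : Torus m) (e : ET m) (z : momentAngle K) (s : I) :
    torusPath (g • e) (g⁻¹ • z) s = g • torusPath e z s := by
  funext i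
  change SInf.movePath (g i • e i) (conjCoord (g⁻¹ • z) i) s = g i • _
  rw [conjCoord_inv_smul, SInf.movePath_smul]
  rfl

theorem continuous_torusPath :
    Continuous fun p : (ET m × momentAngle K) × I => torusPath p.1.1 p.1.2 p.2 := by
  refine continuous_pi fun i => ?_
  change Continuous fun p : (ET m × momentAngle K) × I =>
    SInf.movePath (p.1.1 i) (conjCoord p.1.2 i) p.2
  have h := continuous_conjCoord K i
  have h1 : Continuous fun p : (ET m × momentAngle K) × I =>
      (p.1.1 i, conjCoord p.1.2 i, p.2) :=
    ((continuous_apply i).comp (continuous_fst.comp continuous_fst)).prodMk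
      ((h.comp (continuous_snd.comp continuous_fst)).prodMk continuous_snd)
  have h2 := SInf.continuous_movePath.comp h1
  exact h2

variable {K} in
theorem _root_.Continuous.torusPath {Y : Type*} [TopologicalSpace Y] {e : Y → ET m}
    {z : Y → momentAngle K} {s : Y → I} (he : Continuous e) (hz : Continuous z)
    (hs : Continuous s) : Continuous fun y => torusPath (e y) (z y) (s y) := by
  have h := Continuous.comp (continuous_torusPath K) ((he.prodMk hz).prodMk hs)
  exact h

variable {K} in
theorem torusPath_one_mem (e : ET m) (z : momentAngle K) :
    universalProj m (torusPath e z 1) ∈ stanleyReisnerSpace K := by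
  obtain ⟨J, hJ, h⟩ := z.2.2
  refine ⟨J, hJ, fun i hi => ?_⟩
  change Quotient.mk _ (SInf.movePath (e i) (conjCoord z i) 1) = Quotient.mk _ SInf.e0
  obtain ⟨g, hg⟩ := SInf.exists_move_eq_smul (e i) (conjCoord z i)
    (by simpa [conjCoord] using h i hi)
  rw [SInf.movePath_one, hg]
  exact Quotient.sound ⟨g, rfl⟩

theorem universalProj_smul (g : Torus m) (e : ET m) :
    universalProj m (g • e) = universalProj m e :=
  funext fun i => Quotient.sound ⟨g i, rfl⟩

theorem borel_sound {X : Type} [TopologicalSpace X] [MulAction (Torus m) X] (g : Torus m)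
    (e : ET m) (x : X) :
    (Quotient.mk (borelSetoid m X) (g • e, g⁻¹ • x)) = Quotient.mk _ (e, x) :=
  ((borelSetoid m X).symm ⟨g, rfl⟩ : _) |> Quotient.sound

/-- The retraction `r`, `[e, z] ↦ [move e \bar z]`. -/
def retr : C(Borel m (momentAngle K), stanleyReisnerSpace K) where
  toFun := Quotient.lift (fun a => ⟨_, torusPath_one_mem a.1 a.2⟩) (by
    rintro a b ⟨g, rfl⟩
    refine Subtype.ext ?_
    change universalProj m (torusPath a.1 a.2 1) = universalProj m (torusPath (g • a.1) (g⁻¹ • a.2) 1)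
    rw [torusPath_smul, universalProj_smul])
  continuous_toFun := Continuous.quotient_lift (Continuous.subtype_mk
    ((universalProj m).continuous.comp ((continuous_torusPath K).comp (by fun_prop : Continuous
      fun a : ET m × momentAngle K => (a, (1 : I))))) _) _

theorem isOpenQuotientMap_universalProj : IsOpenQuotientMap (universalProj m) :=
  IsOpenQuotientMap.piMap fun _ => MulAction.isOpenQuotientMap_quotientMk

theorem exists_smul_of_universalProj_eq {e e' : ET m} (h : universalProj m e = universalProj m e') :
    ∃ g : Torus m, g • e' = e := by
  choose g hg using fun i => Quotient.exact (congrFun h i)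
  exact ⟨g, funext hg⟩

variable {K} in
/-- The conjugates of the first coordinates, as a point of the moment-angle complex. -/
def firstCoords (e : ET m) (he : universalProj m e ∈ stanleyReisnerSpace K) : momentAngle K :=
  ⟨fun i => (starRingEnd ℂ) (e i 0), fun i => by simpa using (e i).norm_apply_le 0, by
    obtain ⟨J, hJ, h⟩ := he
    refine ⟨J, hJ, fun i hi => ?_⟩
    obtain ⟨g, hg⟩ := Quotient.exact (h i hi)
    replace hg : g • SInf.e0 = e i := hg
    change ‖(starRingEnd ℂ) (e i 0)‖ = 1
    rw [← hg, RCLike.norm_conj, SInf.smul_apply, SInf.e0_val]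
    simp [Circle.norm_coe]⟩

variable {K} in
theorem firstCoords_smul (g : Torus m) (e : ET m) (he he') :
    firstCoords (K := K) (g • e) he = g⁻¹ • firstCoords e he' := by
  refine Subtype.ext (funext fun i => ?_)
  change (starRingEnd ℂ) (g i * e i 0) = ((g i)⁻¹ : Circle) * (starRingEnd ℂ) (e i 0)
  rw [map_mul, Circle.coe_inv_eq_conj]

variable {K} in
theorem torusPath_firstCoords (e : ET m) (he) (s : I) :
    torusPath e (firstCoords (K := K) e he) s = e :=
  funext fun i => SInf.movePath_self _ _ _ (by simp [conjCoord, firstCoords])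

theorem continuous_firstCoords : Continuous fun e : universalProj m ⁻¹' stanleyReisnerSpace K =>
    firstCoords e.1 e.2 :=
  Continuous.subtype_mk (continuous_pi fun i => Complex.continuous_conj.comp
    ((SInf.continuous_apply 0).comp ((continuous_apply i).comp continuous_subtype_val))) _

/-- The restriction of the universal bundle to the Stanley–Reisner space. -/
def restrProj : C(universalProj m ⁻¹' stanleyReisnerSpace K, stanleyReisnerSpace K) :=
  ⟨(stanleyReisnerSpace K).restrictPreimage (universalProj m),
    (universalProj m).continuous.restrictPreimage⟩

theorem isQuotientMap_restrProj : IsQuotientMap (restrProj K) :=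
  (isOpenQuotientMap_universalProj.restrictPreimage (stanleyReisnerSpace K)).isQuotientMap

/-- The lift of the embedding `h` to the restriction of the universal bundle. -/
def embLift : C(universalProj m ⁻¹' stanleyReisnerSpace K, Borel m (momentAngle K)) :=
  ⟨fun e => Quotient.mk _ (e.1, firstCoords e.1 e.2), continuous_quotient_mk'.comp
    (continuous_subtype_val.prodMk (continuous_firstCoords K))⟩

theorem embLift_factorsThrough : Function.FactorsThrough (embLift K) (restrProj K) := by
  rintro ⟨e, he⟩ ⟨e', he'⟩ h
  obtain ⟨g, rfl⟩ := exists_smul_of_universalProj_eq (congrArg Subtype.val h)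
  change Quotient.mk _ (g • e', firstCoords (g • e') he) = Quotient.mk _ (e', firstCoords e' he')
  rw [firstCoords_smul g e' he he', borel_sound]

/-- The embedding `h`, `[e] ↦ [e, \bar e_0]`. -/
def emb : C(stanleyReisnerSpace K, Borel m (momentAngle K)) :=
  (isQuotientMap_restrProj K).lift (embLift K) (embLift_factorsThrough K)

theorem emb_mk (e : ET m) (he : universalProj m e ∈ stanleyReisnerSpace K) :
    emb K ⟨universalProj m e, he⟩ = Quotient.mk _ (e, firstCoords e he) :=
  ContinuousMap.congr_fun ((isQuotientMap_restrProj K).lift_comp (embLift K)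
    (embLift_factorsThrough K)) ⟨e, he⟩

theorem exists_rep_SR (b : stanleyReisnerSpace K) :
    ∃ (e : ET m) (he : universalProj m e ∈ stanleyReisnerSpace K), b = ⟨universalProj m e, he⟩ := by
  obtain ⟨e, he⟩ := isOpenQuotientMap_universalProj.surjective b.1
  exact ⟨e, he ▸ b.2, Subtype.ext he.symm⟩

theorem borelProj_comp_emb : (borelProj m (momentAngle K)).comp (emb K) = stanleyReisnerIncl K := by
  ext1 b
  obtain ⟨e, he, rfl⟩ := exists_rep_SR K b
  rw [ContinuousMap.comp_apply, emb_mk]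
  rfl

theorem retr_comp_emb : (retr K).comp (emb K) = ContinuousMap.id _ := by
  ext1 b
  obtain ⟨e, he, rfl⟩ := exists_rep_SR K b
  rw [ContinuousMap.comp_apply, emb_mk]
  refine Subtype.ext ?_
  change universalProj m (torusPath e (firstCoords e he) 1) = universalProj m e
  rw [torusPath_firstCoords]

/-- The homotopy of the Borel construction from the identity to `h ∘ r`. -/
def borelHomotopy : C(Borel m (momentAngle K) × I, Borel m (momentAngle K)) where
  toFun p := Quotient.lift (fun a => Quotient.mk _ (torusPath a.1 a.2 p.2, a.2)) (by
    rintro a b ⟨g, rfl⟩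
    simp only
    rw [torusPath_smul, borel_sound]) p.1
  continuous_toFun := by
    refine (isQuotientMap_quotient_mk' (s := borelSetoid m (momentAngle K))).continuous_lift_prod_left ?_
    exact continuous_quotient_mk'.comp ((continuous_torusPath K).prodMk (by fun_prop))

theorem borelHomotopy_mk (e : ET m) (z : momentAngle K) (s : I) :
    borelHomotopy K (Quotient.mk _ (e, z), s) = Quotient.mk _ (torusPath e z s, z) := rfl

theorem borelHomotopy_zero (x : Borel m (momentAngle K)) : borelHomotopy K (x, 0) = x := by
  obtain ⟨⟨e, z⟩, rfl⟩ := Quotient.exists_rep x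
  rw [borelHomotopy_mk]
  congr 2
  exact funext fun i => SInf.movePath_zero _ _

theorem borelHomotopy_one (x : Borel m (momentAngle K)) :
    borelHomotopy K (x, 1) = emb K (retr K x) := by
  obtain ⟨⟨e, z⟩, rfl⟩ := Quotient.exists_rep x
  rw [borelHomotopy_mk]
  refine Eq.trans ?_ (emb_mk K (torusPath e z 1) (torusPath_one_mem e z)).symm
  congr 2
  refine Subtype.ext (funext fun i => ?_)
  change z.1 i = (starRingEnd ℂ) (SInf.movePath (e i) (conjCoord z i) 1 0)
  rw [SInf.movePath_one, SInf.move_zero]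
  simp [conjCoord]

theorem borelHomotopy_emb (b : stanleyReisnerSpace K) (s : I) :
    borelHomotopy K (emb K b, s) = emb K b := by
  obtain ⟨e, he, rfl⟩ := exists_rep_SR K b
  rw [emb_mk, borelHomotopy_mk, torusPath_firstCoords]

theorem homotopicRel_emb_comp_retr :
    (ContinuousMap.id _).HomotopicRel ((emb K).comp (retr K)) (Set.range (emb K)) := by
  refine ⟨⟨⟨⟨fun p => borelHomotopy K (p.2, p.1), by fun_prop⟩, ?_, ?_⟩, ?_⟩⟩
  · exact borelHomotopy_zero K
  · exact borelHomotopy_one K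
  · rintro s _ ⟨b, rfl⟩
    exact borelHomotopy_emb K b s

theorem incl_comp_retr_homotopic :
    ((stanleyReisnerIncl K).comp (retr K)).Homotopic (borelProj m (momentAngle K)) := by
  refine ContinuousMap.Homotopic.symm ⟨⟨⟨fun p => borelProj m (momentAngle K)
    (borelHomotopy K (p.2, p.1)), by fun_prop⟩, ?_, ?_⟩⟩
  · intro x
    exact congrArg _ (borelHomotopy_zero K x)
  · intro x
    change borelProj m (momentAngle K) (borelHomotopy K (x, 1)) = _
    rw [borelHomotopy_one, ← ContinuousMap.comp_apply, borelProj_comp_emb]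
    rfl

end

end MomentAngle
end

noncomputable section

/-! ### Lifting paths from projective space to the sphere -/

namespace MomentAngle

open Topology unitInterval

namespace SInf

/-- The Hilbert space of square-summable sequences. -/
abbrev Hilb : Type := lp (fun _ : ℕ => ℂ) 2

/-- The standard Hilbert basis. -/
def hilbBasis : HilbertBasis ℕ ℂ Hilb := HilbertBasis.ofRepr (LinearIsometryEquiv.refl ℂ Hilb)

/-- The continuous inclusion of `S^∞` in the unit sphere of the Hilbert space. -/
def toHilb (e : SInf) : Hilb := Finsupp.linearCombination ℂ hilbBasis e.1

theorem toHilb_smul (g : Circle) (e : SInf) : toHilb (g • e) = (g : ℂ) • toHilb e := by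
  rw [toHilb, smul_val, map_smul]; rfl

theorem inner_toHilb_self (e : SInf) : inner ℂ (toHilb e) (toHilb e) = 1 := by
  have h := e.nsq_val
  rw [toHilb, hilbBasis.orthonormal.inner_finsupp_eq_sum_left, Finsupp.sum]
  have h' : ((∑ j ∈ e.1.support, ‖e.1 j‖ ^ 2 : ℝ) : ℂ) = 1 := by
    rw [show ∑ j ∈ e.1.support, ‖e.1 j‖ ^ 2 = 1 from h, Complex.ofReal_one]
  rw [← h', Complex.ofReal_sum]
  refine Finset.sum_congr rfl fun j _ => ?_
  rw [← Complex.normSq_eq_norm_sq, ← Complex.mul_conj, mul_comm]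

theorem continuous_toHilb : Continuous toHilb := by
  refine continuous_dom fun n => ?_
  have : ∀ v : FinSphere n, toHilb (FinSphere.incl n v) =
      ∑ j ∈ Finset.range n, (FinSphere.incl n v) j • hilbBasis j := by
    intro v
    refine Finsupp.sum_of_support_subset _ (fun j hj => ?_) _ (by simp)
    rw [Finset.mem_range]
    by_contra h
    refine (Finsupp.mem_support_iff.1 hj) ?_
    exact (incl_apply n v j).trans (dif_neg h)
  simp only [this]
  exact continuous_finsetSum _ fun j _ => ((finCont_incl n).2 j).smul continuous_const

/-- The Hermitian product of two points of `S^∞`. -/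
def ip (a b : SInf) : ℂ := inner ℂ (toHilb a) (toHilb b)

theorem ip_self (a : SInf) : ip a a = 1 := inner_toHilb_self a

theorem ip_smul_left (g : Circle) (a b : SInf) : ip (g • a) b = (g⁻¹ : Circle) * ip a b := by
  rw [ip, toHilb_smul, inner_smul_left, Circle.coe_inv_eq_conj]; rfl

theorem ip_smul_right (g : Circle) (a b : SInf) : ip a (g • b) = g * ip a b := by
  rw [ip, toHilb_smul, inner_smul_right]; rfl

theorem conj_ip (a b : SInf) : (starRingEnd ℂ) (ip b a) = ip a b := inner_conj_symm _ _

theorem continuous_ip : Continuous fun p : SInf × SInf => ip p.1 p.2 :=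
  (continuous_toHilb.comp continuous_fst).inner (continuous_toHilb.comp continuous_snd)

theorem _root_.Continuous.ip {Y : Type*} [TopologicalSpace Y] {a b : Y → SInf}
    (ha : Continuous a) (hb : Continuous b) : Continuous fun y => ip (a y) (b y) := by
  have h := continuous_ip.comp (ha.prodMk hb)
  exact h

attribute [irreducible] ip

end SInf

/-- A complex number of modulus one as a point of the circle. -/
def circleMk (z : ℂ) (h : ‖z‖ = 1) : Circle := ⟨z, mem_sphere_zero_iff_norm.2 h⟩

@[simp] theorem coe_circleMk (z : ℂ) (h : ‖z‖ = 1) : (circleMk z h : ℂ) = z := rfl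

/-- The phase `z / |z|` of a complex number (with the value `1` at `0`). -/
def phase (z : ℂ) : Circle :=
  if h : z = 0 then 1 else circleMk (z / ‖z‖) (by simp [h])

theorem coe_phase {z : ℂ} (h : z ≠ 0) : (phase z : ℂ) = z / ‖z‖ := by
  rw [phase, dif_neg h, coe_circleMk]

theorem phase_one : phase 1 = 1 := Circle.ext (by rw [coe_phase one_ne_zero]; simp)

theorem phase_smul (g : Circle) {z : ℂ} (h : z ≠ 0) : phase (g * z) = g * phase z := by
  refine Circle.ext ?_
  rw [coe_phase (mul_ne_zero g.coe_ne_zero h), Circle.coe_mul, coe_phase h, norm_mul,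
    Circle.norm_coe, one_mul, mul_div_assoc]

theorem continuousAt_phase {z : ℂ} (h : z ≠ 0) : ContinuousAt phase z := by
  refine (IsInducing.subtypeVal (t := Metric.sphere (0 : ℂ) 1)).continuousAt_iff.2 ?_
  have : (fun z : ℂ => z / (‖z‖ : ℂ)) =ᶠ[𝓝 z] Subtype.val ∘ phase := by
    filter_upwards [isOpen_ne.mem_nhds h] with y hy using (coe_phase hy).symm
  refine ContinuousAt.congr ?_ this
  exact continuousAt_id.div (Complex.continuous_ofReal.comp continuous_norm).continuousAt
    (by simpa using h)

namespace CPInf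

/-- The class of a point of the sphere in projective space. -/
def mk (e : SInf) : CPInf := Quotient.mk _ e

theorem isOpenQuotientMap_mk : IsOpenQuotientMap mk := MulAction.isOpenQuotientMap_quotientMk

theorem mk_smul (g : Circle) (e : SInf) : mk (g • e) = mk e := Quotient.sound ⟨g, rfl⟩

theorem exists_smul_of_mk_eq {a b : SInf} (h : mk a = mk b) : ∃ g : Circle, g • b = a :=
  Quotient.exact h

theorem mk_surjective : Function.Surjective mk := Quotient.mk_surjective

/-- The modulus of the Hermitian product of a point of the sphere and a point of projective
space. -/
def closeness (a : CPInf) (b : CPInf) : ℝ :=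
  Quotient.liftOn₂ a b (fun a b => ‖SInf.ip a b‖) (by
    rintro _ _ a b ⟨g, rfl⟩ ⟨h, rfl⟩
    simp only [SInf.ip_smul_left, SInf.ip_smul_right, norm_mul, Circle.norm_coe, one_mul])

theorem closeness_mk (a b : SInf) : closeness (mk a) (mk b) = ‖SInf.ip a b‖ := rfl

theorem closeness_nonneg (a b : CPInf) : 0 ≤ closeness a b := by
  obtain ⟨a, rfl⟩ := mk_surjective a
  obtain ⟨b, rfl⟩ := mk_surjective b
  exact norm_nonneg _

theorem closeness_self (a : CPInf) : closeness a a = 1 := by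
  obtain ⟨a, rfl⟩ := mk_surjective a
  rw [closeness_mk, SInf.ip_self, norm_one]

theorem continuous_closeness : Continuous fun p : CPInf × CPInf => closeness p.1 p.2 :=
  (isOpenQuotientMap_mk.prodMap isOpenQuotientMap_mk).isQuotientMap.continuous_iff.2
    SInf.continuous_ip.norm

open Classical in
/-- Parallel transport: the representative of `b` closest to `a`. -/
def transport (a : SInf) (b : CPInf) : SInf :=
  if h : ∃ b', b = mk b' ∧ SInf.ip a b' ≠ 0 then phase (SInf.ip h.choose a) • h.choose
    else Quotient.out b

theorem transport_mk (a b : SInf) (h : SInf.ip a b ≠ 0) :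
    transport a (mk b) = phase (SInf.ip b a) • b := by
  have h' : ∃ b', mk b = mk b' ∧ SInf.ip a b' ≠ 0 := ⟨b, rfl, h⟩
  have hc := h'.choose_spec
  rw [transport, dif_pos h']
  obtain ⟨g, hg⟩ := exists_smul_of_mk_eq hc.1
  have h0 : SInf.ip h'.choose a ≠ 0 := by
    intro h0
    refine hc.2 ?_
    rw [← SInf.conj_ip, h0, map_zero]
  generalize h'.choose = c at hc hg h0 ⊢
  subst hg
  rw [SInf.ip_smul_left, phase_smul _ h0, smul_smul, mul_right_comm, inv_mul_cancel, one_mul]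

theorem mk_transport (a : SInf) (b : CPInf) : mk (transport a b) = b := by
  rw [transport]
  split_ifs with h
  · rw [mk_smul]; exact h.choose_spec.1.symm
  · exact Quotient.out_eq b

theorem transport_self (a : SInf) : transport a (mk a) = a := by
  have h := SInf.ip_self a
  rw [transport_mk a a (by rw [h]; exact one_ne_zero), h, phase_one, one_smul]

theorem continuousAt_phase_ip (a b : SInf) (h : SInf.ip a b ≠ 0) :
    ContinuousAt (fun p : SInf × SInf => phase (SInf.ip p.2 p.1)) (a, b) := by
  have h0 : SInf.ip b a ≠ 0 := by
    intro h0
    refine h ?_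
    rw [← SInf.conj_ip, h0, map_zero]
  have h1 : Filter.Tendsto (fun p : SInf × SInf => SInf.ip p.2 p.1) (𝓝 (a, b))
      (𝓝 (SInf.ip b a)) :=
    (SInf.continuous_ip.comp (continuous_snd.prodMk continuous_fst)).tendsto (a, b)
  have h2 : Filter.Tendsto phase (𝓝 (SInf.ip b a)) (𝓝 (phase (SInf.ip b a))) :=
    continuousAt_phase h0
  exact h2.comp h1

theorem continuousAt_transport_mk (a b : SInf) (h : SInf.ip a b ≠ 0) :
    ContinuousAt (fun p : SInf × SInf => transport p.1 (mk p.2)) (a, b) := by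
  have hopen : IsOpen {p : SInf × SInf | SInf.ip p.1 p.2 ≠ 0} :=
    isOpen_ne.preimage SInf.continuous_ip
  have hcongr : (fun p : SInf × SInf => phase (SInf.ip p.2 p.1) • p.2) =ᶠ[𝓝 (a, b)]
      fun p : SInf × SInf => transport p.1 (mk p.2) := by
    filter_upwards [hopen.mem_nhds h] with p hp
    exact (transport_mk p.1 p.2 hp).symm
  have h2 : ContinuousAt (fun p : SInf × SInf => p.2) (a, b) := continuousAt_snd
  exact ContinuousAt.congr ((continuousAt_phase_ip a b h).smul h2) hcongr

theorem continuousAt_transport (a : SInf) (b : CPInf) (h : closeness (mk a) b ≠ 0) :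
    ContinuousAt (fun p : SInf × CPInf => transport p.1 p.2) (a, b) := by
  obtain ⟨b, rfl⟩ := mk_surjective b
  rw [closeness_mk, norm_ne_zero_iff] at h
  have hq : IsOpenQuotientMap (Prod.map (id : SInf → SInf) mk) :=
    IsOpenQuotientMap.id.prodMap isOpenQuotientMap_mk
  exact (hq.continuousAt_comp_iff (g := fun p : SInf × CPInf => transport p.1 p.2)
    (x := (a, b))).1 (continuousAt_transport_mk a b h)

/-! #### The step size -/

/-- A step size for which the points of a path are close to each other, varying continuously with
the path. -/
def step (γ : C(I, CPInf)) : ℝ :=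
  sInf ((fun p : I × I => |(p.1 : ℝ) - p.2| + closeness (γ p.1) (γ p.2)) '' Set.univ) / 2

theorem continuous_step : Continuous step := by
  refine Continuous.div_const (IsCompact.continuous_sInf isCompact_univ ?_) 2
  have h1 : Continuous fun p : C(I, CPInf) × I × I => (p.1 p.2.1, p.1 p.2.2) := by fun_prop
  have h2 := continuous_closeness.comp h1
  exact Continuous.add (by fun_prop) h2

theorem two_mul_step_le (γ : C(I, CPInf)) (s t : I) :
    2 * step γ ≤ |(s : ℝ) - t| + closeness (γ s) (γ t) := by
  rw [step, mul_div_cancel₀ _ two_ne_zero]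
  refine csInf_le ⟨0, ?_⟩ ⟨(s, t), trivial, rfl⟩
  rintro _ ⟨p, -, rfl⟩
  exact add_nonneg (abs_nonneg _) (closeness_nonneg _ _)

theorem step_pos (γ : C(I, CPInf)) : 0 < step γ := by
  have hc : Continuous fun p : I × I => |(p.1 : ℝ) - p.2| + closeness (γ p.1) (γ p.2) := by
    have h2 := continuous_closeness.comp (by fun_prop : Continuous fun p : I × I => (γ p.1, γ p.2))
    exact Continuous.add (by fun_prop) h2
  obtain ⟨p, -, hp⟩ := (isCompact_univ.image hc).sInf_mem (Set.univ_nonempty.image _)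
  rw [step, ← hp]
  refine half_pos ?_
  by_cases h : p.1 = p.2
  · simp [h, closeness_self]
  · have : 0 < |(p.1 : ℝ) - p.2| := abs_pos.2 (sub_ne_zero.2 fun h' => h (Subtype.ext h'))
    have := closeness_nonneg (γ p.1) (γ p.2)
    simp only
    linarith

theorem closeness_ne_zero {γ : C(I, CPInf)} {s t : I} (h : |(s : ℝ) - t| ≤ step γ) :
    closeness (γ s) (γ t) ≠ 0 := by
  have := two_mul_step_le γ s t
  have := step_pos γ
  linarith

/-- One step backwards in time. -/
def back (γ : C(I, CPInf)) (t : I) : I :=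
  ⟨max (t - step γ) 0, le_max_right _ _, max_le (by
    have := t.2.2; have := step_pos γ; linarith) zero_le_one⟩

theorem back_zero (γ : C(I, CPInf)) : back γ 0 = 0 := by
  refine Subtype.ext (max_eq_right ?_)
  have := step_pos γ
  simpa using this.le

theorem back_le {γ : C(I, CPInf)} {t : I} {k : ℕ} (h : (t : ℝ) ≤ (k + 1 : ℕ) * step γ) :
    (back γ t : ℝ) ≤ k * step γ := by
  refine max_le ?_ (mul_nonneg (Nat.cast_nonneg k) (step_pos γ).le)
  push_cast at h
  linarith

theorem abs_back_sub_le (γ : C(I, CPInf)) (t : I) : |(back γ t : ℝ) - t| ≤ step γ := by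
  have h1 := step_pos γ
  have h2 := t.2.1
  change |max ((t : ℝ) - step γ) 0 - t| ≤ step γ
  rcases le_total ((t : ℝ) - step γ) 0 with h | h
  · rw [max_eq_right h, zero_sub, abs_neg, abs_of_nonneg h2]; linarith
  · rw [max_eq_left h, abs_of_nonpos (by linarith)]; linarith

/-- The lift of a path by `k` steps of parallel transport, correct up to the time `k * step γ`. -/
def liftSteps (e : SInf) (γ : C(I, CPInf)) : ℕ → I → SInf
  | 0, _ => e
  | k + 1, t => transport (liftSteps e γ k (back γ t)) (γ t)

theorem mk_liftSteps {e : SInf} {γ : C(I, CPInf)} (h : mk e = γ 0) (k : ℕ) (t : I)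
    (ht : (t : ℝ) ≤ k * step γ) : mk (liftSteps e γ k t) = γ t := by
  cases k with
  | zero =>
    rw [Nat.cast_zero, zero_mul] at ht
    rw [show t = 0 from Subtype.ext (le_antisymm ht t.2.1)]
    exact h
  | succ k => exact mk_transport _ _

theorem liftSteps_zero {e : SInf} {γ : C(I, CPInf)} (h : mk e = γ 0) (k : ℕ) :
    liftSteps e γ k 0 = e := by
  induction k with
  | zero => rfl
  | succ k ih => rw [liftSteps, back_zero, ih, ← h, transport_self]

theorem liftSteps_succ {e : SInf} {γ : C(I, CPInf)} (h : mk e = γ 0) (k : ℕ) (t : I)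
    (ht : (t : ℝ) ≤ k * step γ) : liftSteps e γ (k + 1) t = liftSteps e γ k t := by
  induction k generalizing t with
  | zero =>
    rw [Nat.cast_zero, zero_mul] at ht
    rw [show t = 0 from Subtype.ext (le_antisymm ht t.2.1), liftSteps_zero h, liftSteps_zero h]
  | succ k ih => rw [liftSteps, ih _ (back_le ht), ← liftSteps]

theorem liftSteps_eq {e : SInf} {γ : C(I, CPInf)} (h : mk e = γ 0) {k l : ℕ} (hkl : k ≤ l) (t : I)
    (hk : 1 ≤ k * step γ) : liftSteps e γ l t = liftSteps e γ k t := by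
  induction l, hkl using Nat.le_induction with
  | base => rfl
  | succ l hl ih =>
    rw [liftSteps_succ h _ _ (t.2.2.trans (hk.trans ?_)), ih]
    exact mul_le_mul_of_nonneg_right (by exact_mod_cast hl) (step_pos γ).le

section
variable {Y : Type*} [TopologicalSpace Y] {e : Y → SInf} {γ : Y → C(I, CPInf)}

theorem continuous_liftSteps (he : Continuous e) (hγ : Continuous γ) (h : ∀ y, mk (e y) = γ y 0)
    (k : ℕ) (t : Y → I) (ht : Continuous t) (hk : ∀ y, (t y : ℝ) ≤ k * step (γ y)) :
    Continuous fun y => liftSteps (e y) (γ y) k (t y) := by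
  induction k generalizing t with
  | zero => exact he
  | succ k ih =>
    have hs := continuous_step.comp hγ
    have hb : Continuous fun y => back (γ y) (t y) :=
      Continuous.subtype_mk ((Continuous.sub (by fun_prop) hs).max continuous_const) _
    have h1 := ih _ hb fun y => back_le (hk y)
    have h2 : Continuous fun y => γ y (t y) := by fun_prop
    refine continuous_iff_continuousAt.2 fun y => ?_
    refine ContinuousAt.comp (g := fun p : SInf × CPInf => transport p.1 p.2)
      (f := fun y => (liftSteps (e y) (γ y) k (back (γ y) (t y)), γ y (t y)))
      (continuousAt_transport _ _ ?_) (h1.prodMk h2).continuousAt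
    rw [mk_liftSteps (h y) k _ (back_le (hk y))]
    exact closeness_ne_zero (abs_back_sub_le _ _)

/-- The horizontal lift of a path of projective space starting at a given point of the sphere. -/
def lift (e : SInf) (γ : C(I, CPInf)) (t : I) : SInf := liftSteps e γ ⌈(step γ)⁻¹⌉₊ t

theorem one_le_ceil_mul_step (γ : C(I, CPInf)) : 1 ≤ (⌈(step γ)⁻¹⌉₊ : ℝ) * step γ := by
  have h := step_pos γ
  calc (1 : ℝ) = (step γ)⁻¹ * step γ := (inv_mul_cancel₀ h.ne').symm
    _ ≤ _ := mul_le_mul_of_nonneg_right (Nat.le_ceil _) h.le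

theorem lift_zero {e : SInf} {γ : C(I, CPInf)} (h : mk e = γ 0) : lift e γ 0 = e :=
  liftSteps_zero h _

theorem mk_lift {e : SInf} {γ : C(I, CPInf)} (h : mk e = γ 0) (t : I) : mk (lift e γ t) = γ t :=
  mk_liftSteps h _ _ (t.2.2.trans (one_le_ceil_mul_step γ))

theorem lift_eq {e : SInf} {γ : C(I, CPInf)} (h : mk e = γ 0) {k : ℕ} (hk : 1 ≤ k * step γ)
    (t : I) : lift e γ t = liftSteps e γ k t := by
  rcases le_total k ⌈(step γ)⁻¹⌉₊ with hl | hl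
  · exact liftSteps_eq h hl t hk
  · exact (liftSteps_eq h hl t (one_le_ceil_mul_step γ)).symm

theorem continuous_lift (he : Continuous e) (hγ : Continuous γ) (h : ∀ y, mk (e y) = γ y 0)
    {t : Y → I} (ht : Continuous t) : Continuous fun y => lift (e y) (γ y) (t y) := by
  refine continuous_iff_continuousAt.2 fun y₀ => ?_
  obtain ⟨k, hk⟩ := exists_nat_gt (step (γ y₀))⁻¹
  have hk' : 1 < k * step (γ y₀) := (inv_lt_iff_one_lt_mul₀ (step_pos _)).1 hk
  have hopen : IsOpen {y | 1 < k * step (γ y)} :=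
    isOpen_lt continuous_const (continuous_const.mul (continuous_step.comp hγ))
  refine ContinuousOn.continuousAt ?_ (hopen.mem_nhds hk')
  rw [continuousOn_iff_continuous_domRestrict]
  have h1 := continuous_liftSteps (Y := {y | 1 < k * step (γ y)}) (e := fun y => e y)
    (γ := fun y => γ y) (by fun_prop) (by fun_prop) (fun y => h y) k (fun y => t y) (by fun_prop)
    (fun y => (t y).2.2.trans y.2.le)
  convert h1 using 1
  funext y
  exact lift_eq (h y) y.2.le _

end

end CPInf

end MomentAngle
end

noncomputable section

/-! ### The moment-angle complex as a homotopy fibre -/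

namespace MomentAngle

open Topology unitInterval

/-- The element of the circle which carries `b` to `a`, for points of the same circle orbit. -/
def ratio (a b : SInf) : Circle := phase (SInf.ip b a)

theorem ratio_smul {a b : SInf} (h : CPInf.mk a = CPInf.mk b) : ratio a b • b = a := by
  obtain ⟨g, rfl⟩ := CPInf.exists_smul_of_mk_eq h
  rw [ratio, SInf.ip_smul_right, SInf.ip_self, phase_smul g one_ne_zero, phase_one, mul_one]

theorem ratio_self (a : SInf) : ratio a a = 1 := by rw [ratio, SInf.ip_self, phase_one]

theorem continuous_ratio {Y : Type*} [TopologicalSpace Y] {a b : Y → SInf} (ha : Continuous a)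
    (hb : Continuous b) (h : ∀ y, CPInf.mk (a y) = CPInf.mk (b y)) :
    Continuous fun y => ratio (a y) (b y) := by
  have h1 : Continuous fun y => SInf.ip (b y) (a y) := hb.ip ha
  refine continuous_iff_continuousAt.2 fun y => ?_
  have h0 : SInf.ip (b y) (a y) ≠ 0 := by
    obtain ⟨g, hg⟩ := CPInf.exists_smul_of_mk_eq (h y)
    rw [← hg, SInf.ip_smul_right, SInf.ip_self, mul_one]
    exact g.coe_ne_zero
  have h2 : Filter.Tendsto phase (𝓝 (SInf.ip (b y) (a y))) (𝓝 (phase (SInf.ip (b y) (a y)))) :=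
    continuousAt_phase h0
  exact h2.comp (h1.tendsto y)

section
variable {m : ℕ}

/-- The coordinates of a path in `BT^m`. -/
def coordPath (γ : C(I, BT m)) (i : Fin m) : C(I, CPInf) :=
  (⟨fun b => b i, continuous_apply i⟩ : C(BT m, CPInf)).comp γ

/-- The horizontal lift of a path of `BT^m` to `ET^m`. -/
def torusLift (e : ET m) (γ : C(I, BT m)) (t : I) : ET m :=
  fun i => CPInf.lift (e i) (coordPath γ i) t

theorem torusLift_zero {e : ET m} {γ : C(I, BT m)} (h : γ 0 = universalProj m e) :
    torusLift e γ 0 = e :=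
  funext fun i => CPInf.lift_zero (congrFun h.symm i)

theorem universalProj_torusLift {e : ET m} {γ : C(I, BT m)} (h : γ 0 = universalProj m e) (t : I) :
    universalProj m (torusLift e γ t) = γ t :=
  funext fun i => CPInf.mk_lift (γ := coordPath γ i) (congrFun h.symm i) t

theorem continuous_torusLift {Y : Type*} [TopologicalSpace Y] {e : ET m} {γ : Y → C(I, BT m)}
    (hγ : Continuous γ) (h : ∀ y, γ y 0 = universalProj m e) {t : Y → I} (ht : Continuous t) :
    Continuous fun y => torusLift e (γ y) (t y) := by
  refine continuous_pi fun i => ?_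
  have h1 : Continuous fun y => coordPath (γ y) i :=
    (ContinuousMap.continuous_postcomp _).comp hγ
  exact CPInf.continuous_lift (e := fun _ => e i) continuous_const h1
    (fun y => congrFun (h y).symm i) ht

variable (K : PreAbstractSimplicialComplex (Fin m)) (e : ET m)

/-- The homotopy fibre of the inclusion of the Stanley–Reisner space over the class of `e`. -/
abbrev Fib : Type := HomotopyFibre (stanleyReisnerIncl K) (universalProj m e)

/-- The map of `Z_K` to the homotopy fibre which records the retraction `r` and the path to it in
`BT^m`. -/
def toFib : C(momentAngle K, Fib K e) where
  toFun z := ⟨(retr K (fibreIncl e z), ContinuousMap.mk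
      (fun s : I => universalProj m (torusPath e z (σ s)))
      ((universalProj m).continuous.comp (continuous_const.torusPath continuous_const
        continuous_symm))), by
    constructor
    · change universalProj m (torusPath e z (σ 0)) = universalProj m (torusPath e z 1)
      rw [symm_zero]
    · change universalProj m (torusPath e z (σ 1)) = universalProj m e
      rw [symm_one]
      congr 1
      exact funext fun i => SInf.movePath_zero _ _⟩
  continuous_toFun := by
    refine Continuous.subtype_mk (Continuous.prodMk (by fun_prop) ?_) _
    refine ContinuousMap.continuous_of_continuous_uncurry _ ?_
    exact (universalProj m).continuous.comp
      (continuous_const.torusPath continuous_fst (continuous_symm.comp continuous_snd))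

variable {K e}

/-- The reverse of the path of a point of the homotopy fibre. -/
def Fib.rev (c : Fib K e) : C(I, BT m) := c.1.2.comp ⟨σ, continuous_symm⟩

theorem Fib.rev_zero (c : Fib K e) : c.rev 0 = universalProj m e := by
  change c.1.2 (σ 0) = _
  rw [symm_zero]
  exact c.2.2

theorem Fib.rev_one (c : Fib K e) : c.rev 1 = c.1.1.1 := by
  change c.1.2 (σ 1) = _
  rw [symm_one]
  exact c.2.1

theorem Fib.continuous_rev : Continuous (Fib.rev (K := K) (e := e)) :=
  (ContinuousMap.continuous_precomp _).comp (continuous_snd.comp continuous_subtype_val)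

theorem Fib.lift_one_mem (c : Fib K e) :
    universalProj m (torusLift e c.rev 1) ∈ stanleyReisnerSpace K := by
  rw [universalProj_torusLift c.rev_zero, c.rev_one]
  exact c.1.1.2

variable (K e)

/-- The map from the homotopy fibre to `Z_K` given by lifting paths. -/
def ofFib : C(Fib K e, momentAngle K) where
  toFun c := firstCoords (torusLift e c.rev 1) c.lift_one_mem
  continuous_toFun := by
    have h : Continuous fun c : Fib K e => torusLift e c.rev 1 :=
      continuous_torusLift Fib.continuous_rev Fib.rev_zero continuous_const
    exact (continuous_firstCoords K).comp (h.subtype_mk Fib.lift_one_mem)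

theorem ofFib_apply (c : Fib K e) :
    ofFib K e c = firstCoords (torusLift e c.rev 1) c.lift_one_mem := rfl

theorem rev_toFib (z : momentAngle K) (t : I) :
    (toFib K e z).rev t = universalProj m (torusPath e z t) := by
  change universalProj m (torusPath e z (σ (σ t))) = _
  rw [symm_symm]

/-- The rotation relating the horizontal lift to the path of `toFib`. -/
def holonomy (z : momentAngle K) (t : I) : Torus m :=
  fun i => ratio (torusLift e (toFib K e z).rev t i) (torusPath e z t i)

theorem holonomy_aux (z : momentAngle K) (t : I) (i : Fin m) :
    CPInf.mk (torusLift e (toFib K e z).rev t i) = CPInf.mk (torusPath e z t i) :=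
  congrFun ((universalProj_torusLift (toFib K e z).rev_zero t).trans (rev_toFib K e z t)) i

theorem holonomy_smul (z : momentAngle K) (t : I) :
    holonomy K e z t • torusPath e z t = torusLift e (toFib K e z).rev t :=
  funext fun i => ratio_smul (holonomy_aux K e z t i)

theorem continuous_holonomy :
    Continuous fun p : momentAngle K × I => holonomy K e p.1 p.2 := by
  refine continuous_pi fun i => continuous_ratio ?_ ?_ fun p => holonomy_aux K e p.1 p.2 i
  · have h1 : Continuous fun p : momentAngle K × I => (toFib K e p.1).rev :=
      Fib.continuous_rev.comp ((toFib K e).continuous.comp continuous_fst)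
    exact (continuous_apply i).comp
      (continuous_torusLift h1 (fun p => (toFib K e p.1).rev_zero) continuous_snd)
  · exact (continuous_apply i).comp
      (continuous_const.torusPath continuous_fst continuous_snd)

theorem torusPath_zero (z : momentAngle K) : torusPath e z 0 = e :=
  funext fun _ => SInf.movePath_zero _ _

theorem holonomy_zero (z : momentAngle K) : holonomy K e z 0 = 1 := by
  funext i
  rw [holonomy, torusPath_zero, torusLift_zero (toFib K e z).rev_zero]
  exact ratio_self _

theorem firstCoords_torusPath_one (z : momentAngle K) :
    firstCoords (torusPath e z 1) (torusPath_one_mem e z) = z := by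
  refine Subtype.ext (funext fun i => ?_)
  change (starRingEnd ℂ) (SInf.movePath (e i) (conjCoord z i) 1 0) = z.1 i
  rw [SInf.movePath_one, SInf.move_zero]
  simp [conjCoord]

theorem ofFib_toFib (z : momentAngle K) :
    ofFib K e (toFib K e z) = (holonomy K e z 1)⁻¹ • z := by
  have h := firstCoords_smul (K := K) (holonomy K e z 1) (torusPath e z 1)
    (by rw [universalProj_smul]; exact torusPath_one_mem e z) (torusPath_one_mem e z)
  rw [firstCoords_torusPath_one] at h
  rw [← h]
  rw [ofFib_apply]
  simp only [holonomy_smul]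

instance : ContinuousSMul (Torus m) (momentAngle K) where
  continuous_smul := by
    refine Continuous.subtype_mk (continuous_pi fun i => ?_) _
    have h1 : Continuous fun p : Torus m × momentAngle K => ((p.1 i : Circle) : ℂ) :=
      continuous_subtype_val.comp ((continuous_apply i).comp continuous_fst)
    have h2 : Continuous fun p : Torus m × momentAngle K => p.2.1 i :=
      (continuous_apply i).comp (continuous_subtype_val.comp continuous_snd)
    exact h1.mul h2

theorem ofFib_comp_toFib : ((ofFib K e).comp (toFib K e)).Homotopic (ContinuousMap.id _) := by
  have h := continuous_holonomy K e
  refine ContinuousMap.Homotopic.symm ⟨⟨⟨fun p => (holonomy K e p.2 p.1)⁻¹ • p.2, ?_⟩, ?_, ?_⟩⟩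
  · exact ((h.comp continuous_swap).inv).smul continuous_snd
  · intro z
    change (holonomy K e z 0)⁻¹ • z = z
    rw [holonomy_zero, inv_one, one_smul]
  · intro z
    exact (ofFib_toFib K e z).symm

variable {K e}

/-- The surface in `BT^m` spanned by the lift of a path and the homotopy to its retraction. -/
def Fib.surface (c : Fib K e) (s u : I) : BT m :=
  universalProj m (torusPath (torusLift e c.rev s) (ofFib K e c) u)

theorem Fib.continuous_surface :
    Continuous fun p : Fib K e × I × I => p.1.surface p.2.1 p.2.2 := by
  have h1 : Continuous fun p : Fib K e × I × I => torusLift e p.1.rev p.2.1 :=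
    continuous_torusLift (Fib.continuous_rev.comp continuous_fst) (fun p => p.1.rev_zero)
      (by fun_prop)
  have h2 : Continuous fun p : Fib K e × I × I => ofFib K e p.1 :=
    (ofFib K e).continuous.comp continuous_fst
  exact (universalProj m).continuous.comp (h1.torusPath h2 (continuous_snd.comp continuous_snd))

theorem _root_.Continuous.fibSurface {Y : Type*} [TopologicalSpace Y] {c : Y → Fib K e} {s u : Y → I}
    (hc : Continuous c) (hs : Continuous s) (hu : Continuous u) :
    Continuous fun y => (c y).surface (s y) (u y) := by
  have h := Fib.continuous_surface.comp (hc.prodMk (hs.prodMk hu))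
  exact h

theorem Fib.surface_right_zero (c : Fib K e) (s : I) : c.surface s 0 = c.rev s := by
  rw [Fib.surface, torusPath_zero, universalProj_torusLift c.rev_zero]

theorem Fib.surface_one_left (c : Fib K e) (u : I) : c.surface 1 u = c.1.1.1 := by
  rw [Fib.surface, ofFib_apply, torusPath_firstCoords, universalProj_torusLift c.rev_zero, c.rev_one]

theorem Fib.surface_mem (c : Fib K e) {s u : I} (h : s = 1 ∨ u = 1) :
    c.surface s u ∈ stanleyReisnerSpace K := by
  rcases h with rfl | rfl
  · rw [c.surface_one_left]; exact c.1.1.2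
  · exact torusPath_one_mem _ _

/-- The point of the homotopy fibre given by the segment of the surface from `(s, u)` to the
origin. -/
def Fib.ray (c : Fib K e) (s u : I) (h : s = 1 ∨ u = 1) : Fib K e :=
  ⟨(⟨c.surface s u, c.surface_mem h⟩, ContinuousMap.mk
      (fun t : I => c.surface (s * σ t) (u * σ t)) (continuous_const.fibSurface
        (by fun_prop) (by fun_prop))), by
    constructor
    · change c.surface (s * σ 0) (u * σ 0) = c.surface s u
      rw [symm_zero, mul_one, mul_one]
    · change c.surface (s * σ 1) (u * σ 1) = _
      rw [symm_one, mul_zero, mul_zero, c.surface_right_zero, c.rev_zero]⟩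

theorem Fib.continuous_ray {Y : Type*} [TopologicalSpace Y] {c : Y → Fib K e} {s u : Y → I}
    (hc : Continuous c) (hs : Continuous s) (hu : Continuous u) (h : ∀ y, s y = 1 ∨ u y = 1) :
    Continuous fun y => (c y).ray (s y) (u y) (h y) := by
  refine Continuous.subtype_mk (Continuous.prodMk (Continuous.subtype_mk ?_ _) ?_) _
  · exact hc.fibSurface hs hu
  · refine ContinuousMap.continuous_of_continuous_uncurry _ ?_
    exact (hc.comp continuous_fst).fibSurface (by fun_prop) (by fun_prop)

theorem Fib.ray_one_zero (c : Fib K e) (h) : c.ray 1 0 h = c := by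
  refine Subtype.ext (Prod.ext (Subtype.ext (c.surface_one_left 0)) (ContinuousMap.ext fun t => ?_))
  change c.surface (1 * σ t) (0 * σ t) = c.1.2 t
  rw [one_mul, zero_mul, c.surface_right_zero]
  change c.1.2 (σ (σ t)) = _
  rw [symm_symm]

theorem Fib.ray_zero_one (c : Fib K e) (h) : c.ray 0 1 h = toFib K e (ofFib K e c) := by
  have h0 := torusLift_zero c.rev_zero
  refine Subtype.ext (Prod.ext (Subtype.ext ?_) (ContinuousMap.ext fun t => ?_))
  · change universalProj m (torusPath (torusLift e c.rev 0) (ofFib K e c) 1) = _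
    rw [h0]; rfl
  · change universalProj m (torusPath (torusLift e c.rev (0 * σ t)) (ofFib K e c) (1 * σ t)) = _
    rw [zero_mul, one_mul, h0]; rfl

variable (K e)

theorem toFib_comp_ofFib : ((toFib K e).comp (ofFib K e)).Homotopic (ContinuousMap.id _) := by
  -- the corner path `(0,1) → (1,1) → (1,0)` of parameters
  let a : I → I := fun t => ⟨min (2 * t) 1, le_min (by have := t.2.1; positivity) zero_le_one,
    min_le_right _ _⟩
  have ha : Continuous a := Continuous.subtype_mk (by fun_prop) _
  have hor : ∀ t, a t = 1 ∨ a (σ t) = 1 := by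
    intro t
    rcases le_total (1 / 2 : ℝ) t with h | h
    · exact Or.inl (Subtype.ext (min_eq_right (by linarith)))
    · refine Or.inr (Subtype.ext (min_eq_right ?_))
      rw [coe_symm_eq]
      linarith
  have a0 : a 0 = 0 := Subtype.ext (by simp [a])
  have a1 : a 1 = 1 := Subtype.ext (by simp [a])
  refine ⟨⟨⟨fun p => p.2.ray (a p.1) (a (σ p.1)) (hor p.1), ?_⟩, ?_, ?_⟩⟩
  · exact Fib.continuous_ray continuous_snd (by fun_prop) (by fun_prop) _
  · intro c
    simp only [symm_zero, a0, a1]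
    exact c.ray_zero_one _
  · intro c
    simp only [symm_one, a0, a1]
    exact c.ray_one_zero _

/-- The moment-angle complex is the homotopy fibre of the inclusion of the Stanley–Reisner
space. -/
def fibEquiv : ContinuousMap.HomotopyEquiv (momentAngle K) (Fib K e) where
  toFun := toFib K e
  invFun := ofFib K e
  left_inv := ofFib_comp_toFib K e
  right_inv := toFib_comp_ofFib K e

end

end MomentAngle
end

noncomputable section

/-! ### The Euler cochain of the circle bundle `S^∞ → ℂP^∞` -/

namespace MomentAngle

open Topology SingCoh

/-! #### Lifting singular simplices -/

instance (n : ℕ) : PreconnectedSpace (Simp n) :=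
  isPreconnected_iff_preconnectedSpace.1 (convex_stdSimplex ℝ (Fin (n + 1))).isPreconnected

/-- The contraction of the standard simplex to its first vertex. -/
def simpContr (n : ℕ) : C(unitInterval × Simp n, Simp n) where
  toFun p := ⟨(1 - p.1 : ℝ) • (verts n 0).1 + (p.1 : ℝ) • p.2.1,
    convex_stdSimplex ℝ _ (verts n 0).2 p.2.2 (by linarith [p.1.2.2]) p.1.2.1 (by ring)⟩
  continuous_toFun := Continuous.subtype_mk (by fun_prop) _

theorem simpContr_zero (n : ℕ) (x : Simp n) : simpContr n (0, x) = verts n 0 :=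
  Subtype.ext (by simp [simpContr])

theorem simpContr_one (n : ℕ) (x : Simp n) : simpContr n (1, x) = x :=
  Subtype.ext (by simp [simpContr])

/-- The universal covering of the circle, with period one. -/
def expt : C(ℝ, Circle) := Circle.exp.comp ⟨fun t => 2 * Real.pi * t, by fun_prop⟩

theorem expt_apply (t : ℝ) : expt t = Circle.exp (2 * Real.pi * t) := rfl

theorem expt_add (s t : ℝ) : expt (s + t) = expt s * expt t := by
  rw [expt_apply, mul_add, Circle.exp_add]; rfl

theorem expt_eq_expt_iff {s t : ℝ} : expt s = expt t ↔ ∃ n : ℤ, s = t + n := by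
  rw [expt_apply, expt_apply, Circle.exp_eq_exp]
  refine exists_congr fun n => ⟨fun h => ?_, fun h => by rw [h]; ring⟩
  have : (2 * Real.pi) * s = (2 * Real.pi) * (t + n) := by rw [h]; ring
  exact mul_left_cancel₀ Real.two_pi_pos.ne' this

theorem expt_surjective : Function.Surjective expt := fun g =>
  ⟨Complex.arg g / (2 * Real.pi), by
    rw [expt_apply, mul_div_cancel₀ _ Real.two_pi_pos.ne', Circle.exp_arg]⟩

/-- A map from a simplex to the circle lifts to the line. -/
theorem exists_expt_lift {n : ℕ} (g : C(Simp n, Circle)) :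
    ∃ t : C(Simp n, ℝ), ∀ x, expt (t x) = g x := by
  have H0 : ∀ x : Simp n, (g.comp (simpContr n)) (0, x) =
      Circle.exp (ContinuousMap.const (Simp n) (Complex.arg (g (verts n 0))) x) := by
    intro x
    rw [ContinuousMap.comp_apply, simpContr_zero, ContinuousMap.const_apply, Circle.exp_arg]
  let L := Circle.isCoveringMap_exp.liftHomotopy (g.comp (simpContr n)) (ContinuousMap.const _ _) H0
  refine ⟨⟨fun x => L (1, x) / (2 * Real.pi), by fun_prop⟩, fun x => ?_⟩
  have h := congrFun (Circle.isCoveringMap_exp.liftHomotopy_lifts (g.comp (simpContr n))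
    (ContinuousMap.const _ _) H0) (1, x)
  change Circle.exp (L (1, x)) = g (simpContr n (1, x)) at h
  rw [simpContr_one] at h
  rw [← h]
  change expt (L (1, x) / (2 * Real.pi)) = _
  rw [expt_apply, mul_div_cancel₀ _ Real.two_pi_pos.ne']

theorem exists_int_of_expt_eq {n : ℕ} (s t : C(Simp n, ℝ)) (h : ∀ x, expt (s x) = expt (t x)) :
    ∃ m : ℤ, ∀ x, s x = t x + m := by
  obtain ⟨m, hm⟩ := expt_eq_expt_iff.1 (h (verts n 0))
  refine ⟨m, fun x => ?_⟩
  have key := Circle.isCoveringMap_exp.eq_of_comp_eq (g₁ := fun x => 2 * Real.pi * s x)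
    (g₂ := fun x => 2 * Real.pi * (t x + m)) (by fun_prop) (by fun_prop) (funext fun x => by
      change expt (s x) = expt (t x + m)
      rw [h, expt_eq_expt_iff.2 ⟨m, rfl⟩]) (verts n 0) (by rw [hm])
  exact mul_left_cancel₀ Real.two_pi_pos.ne' (congrFun key x)

/-- Every singular simplex of projective space lifts to the sphere. -/
theorem exists_sphere_lift {n : ℕ} (σ : C(Simp n, CPInf)) :
    ∃ τ : C(Simp n, SInf), ∀ x, CPInf.mk (τ x) = σ x := by
  obtain ⟨e, he⟩ := CPInf.mk_surjective (σ (verts n 0))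
  let γ : C(Simp n, C(unitInterval, CPInf)) :=
    ContinuousMap.curry ((σ.comp (simpContr n)).comp ⟨Prod.swap, continuous_swap⟩)
  have h0 : ∀ x, CPInf.mk e = γ x 0 := by
    intro x
    change _ = σ (simpContr n (0, x))
    rw [simpContr_zero, he]
  refine ⟨⟨fun x => CPInf.lift e (γ x) 1, CPInf.continuous_lift (e := fun _ => e) continuous_const
    γ.continuous h0 continuous_const⟩, fun x => ?_⟩
  refine (CPInf.mk_lift (h0 x) 1).trans ?_
  change σ (simpContr n (1, x)) = _
  rw [simpContr_one]

/-- Two singular simplices of the sphere with the same image in projective space differ by a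
rotation with a continuous angle. -/
theorem exists_angle {n : ℕ} (τ τ' : C(Simp n, SInf))
    (h : ∀ x, CPInf.mk (τ x) = CPInf.mk (τ' x)) :
    ∃ t : C(Simp n, ℝ), ∀ x, τ x = expt (t x) • τ' x := by
  obtain ⟨t, ht⟩ := exists_expt_lift
    ⟨fun x => ratio (τ x) (τ' x), continuous_ratio τ.continuous τ'.continuous h⟩
  exact ⟨t, fun x => by rw [ht]; exact (ratio_smul (h x)).symm⟩

theorem smul_right_inj_circle {g h : Circle} {e : SInf} (H : g • e = h • e) : g = h := by
  have h1 : SInf.ip e (g • e) = SInf.ip e (h • e) := by rw [H]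
  rw [SInf.ip_smul_right, SInf.ip_smul_right, SInf.ip_self, mul_one, mul_one] at h1
  exact Circle.ext h1

/-! #### Counting turns -/

theorem exists_angle_point (e : SInf) :
    ∃ r : ℝ, expt r • (Quotient.out (CPInf.mk e) : SInf) = e := by
  obtain ⟨g, hg⟩ := CPInf.exists_smul_of_mk_eq (a := e) (b := Quotient.out (CPInf.mk e))
    (Quotient.out_eq (CPInf.mk e)).symm
  obtain ⟨r, rfl⟩ := expt_surjective g
  exact ⟨r, hg⟩

/-- A discontinuous choice of angles of the points of the sphere with respect to representatives of
the circle orbits. -/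
def pointAngle (e : SInf) : ℝ := (exists_angle_point e).choose

theorem pointAngle_spec (e : SInf) : expt (pointAngle e) • Quotient.out (CPInf.mk e) = e :=
  (exists_angle_point e).choose_spec

theorem exists_turn (t : ℝ) (e : SInf) :
    ∃ n : ℤ, t + pointAngle e = pointAngle (expt t • e) + n := by
  refine expt_eq_expt_iff.1 (smul_right_inj_circle (e := Quotient.out (CPInf.mk e)) ?_)
  rw [expt_add, mul_smul, pointAngle_spec, ← CPInf.mk_smul (expt t) e, pointAngle_spec]

/-- The number of turns of the arc of angle `t` starting at `e`, an integer which is additive along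
arcs. -/
def turn (t : ℝ) (e : SInf) : ℤ := (exists_turn t e).choose

theorem turn_spec (t : ℝ) (e : SInf) :
    (turn t e : ℝ) = t + pointAngle e - pointAngle (expt t • e) := by
  have := (exists_turn t e).choose_spec
  rw [turn]; linarith

theorem turn_add (s t : ℝ) (e : SInf) : turn (s + t) e = turn t e + turn s (expt t • e) := by
  have : (turn (s + t) e : ℝ) = turn t e + turn s (expt t • e) := by
    rw [turn_spec, turn_spec, turn_spec, expt_add, mul_smul]; ring
  exact_mod_cast this

theorem turn_add_int (t : ℝ) (n : ℤ) (e : SInf) : turn (t + n) e = turn t e + n := by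
  have h : expt (t + n) = expt t := expt_eq_expt_iff.2 ⟨n, rfl⟩
  have : (turn (t + n) e : ℝ) = turn t e + n := by
    rw [turn_spec, turn_spec, h]; ring
  exact_mod_cast this

/-! #### The connection cochain -/

/-- A lift of a singular simplex of projective space. -/
def sphereLift {n : ℕ} (σ : C(Simp n, CPInf)) : C(Simp n, SInf) := (exists_sphere_lift σ).choose

theorem mk_sphereLift {n : ℕ} (σ : C(Simp n, CPInf)) (x : Simp n) :
    CPInf.mk (sphereLift σ x) = σ x := (exists_sphere_lift σ).choose_spec x

/-- The projection of the circle bundle. -/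
def cpProj : C(SInf, CPInf) := ⟨CPInf.mk, CPInf.isOpenQuotientMap_mk.continuous⟩

/-- The angle of a singular simplex of the sphere with respect to the chosen lift of its image. -/
def simpAngle {n : ℕ} (τ : C(Simp n, SInf)) : C(Simp n, ℝ) :=
  (exists_angle τ (sphereLift (cpProj.comp τ)) fun x => (mk_sphereLift (cpProj.comp τ) x).symm).choose

theorem simpAngle_spec {n : ℕ} (τ : C(Simp n, SInf)) (x : Simp n) :
    τ x = expt (simpAngle τ x) • sphereLift (cpProj.comp τ) x :=
  (exists_angle τ (sphereLift (cpProj.comp τ))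
    fun x => (mk_sphereLift (cpProj.comp τ) x).symm).choose_spec x

/-- The number of turns at a point of a singular simplex of the sphere. -/
def simpTurn {n : ℕ} (τ : C(Simp n, SInf)) (x : Simp n) : ℤ :=
  turn (simpAngle τ x) (sphereLift (cpProj.comp τ) x)

/-- Rotating a singular simplex changes its turns, up to a constant, by those of the rotation. -/
theorem simpTurn_rotate {n : ℕ} (τ τ' : C(Simp n, SInf)) (h : C(Simp n, ℝ))
    (hτ : ∀ x, τ' x = expt (h x) • τ x) :
    ∃ m : ℤ, ∀ x, simpTurn τ' x = simpTurn τ x + turn (h x) (τ x) + m := by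
  have hproj : cpProj.comp τ' = cpProj.comp τ :=
    ContinuousMap.ext fun x => by
      change CPInf.mk (τ' x) = CPInf.mk (τ x)
      rw [hτ, CPInf.mk_smul]
  obtain ⟨m, hm⟩ := exists_int_of_expt_eq (simpAngle τ') (h + simpAngle τ) fun x => by
    refine smul_right_inj_circle (e := sphereLift (cpProj.comp τ) x) ?_
    have h1 := simpAngle_spec τ' x
    rw [hproj] at h1
    rw [← h1, hτ, ContinuousMap.add_apply, expt_add, mul_smul, ← simpAngle_spec]
  refine ⟨m, fun x => ?_⟩
  rw [simpTurn, hproj, hm, turn_add_int, ContinuousMap.add_apply, turn_add, ← simpAngle_spec]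
  rfl

section
variable (k : Type*) [CommRing k]

/-- The cochain of degree zero given by a function on points. -/
def pointCochain {X : Type} [TopologicalSpace X] (f : X → k) : Tot k (Sing X) :=
  ⟨fun n => match n with
    | 0 => fun σ => f (smp.symm σ (verts 0 0))
    | _ => 0⟩

theorem pointCochain_zero {X : Type} [TopologicalSpace X] (f : X → k) (σ : C(Simp 0, X)) :
    pointCochain k f 0 (smp σ) = f (σ (verts 0 0)) := by
  change f (smp.symm (smp σ) _) = _
  rw [Equiv.symm_apply_apply]

theorem pointCochain_succ {X : Type} [TopologicalSpace X] (f : X → k) (n : ℕ) :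
    pointCochain k f (n + 1) = 0 := rfl

theorem d_pointCochain_one {X : Type} [TopologicalSpace X] (f : X → k) (σ : C(Simp 1, X)) :
    Tot.d (pointCochain k f) 1 (smp σ) = f (σ (verts 1 1)) - f (σ (verts 1 0)) := by
  have h : ∀ i : Fin 2, faceMap i (verts 0 0) = verts 1 (i.succAbove 0) := fun i =>
    congrFun (faceMap_verts i) 0
  rw [Tot.d_apply, Fin.sum_univ_two, δ_smp, δ_smp, pointCochain_zero, pointCochain_zero,
    ContinuousMap.comp_apply, ContinuousMap.comp_apply, h, h]
  simp [sub_eq_add_neg]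

theorem d_pointCochain_of_ne {X : Type} [TopologicalSpace X] (f : X → k) {n : ℕ} (hn : n ≠ 1) :
    Tot.d (pointCochain k f) n = 0 := by
  cases n with
  | zero => rfl
  | succ n =>
    cases n with
    | zero => exact absurd rfl hn
    | succ n => rw [Tot.d_succ_apply, pointCochain_succ, map_zero]

theorem pull_pointCochain {X Y : Type} [TopologicalSpace X] [TopologicalSpace Y] (g : C(X, Y))
    (f : Y → k) : Tot.pull (singMap g) (pointCochain k f) = pointCochain k (f ∘ g) := by
  refine tot_ext fun n σ => ?_
  rw [Tot.pull_apply, singMap_smp]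
  cases n with
  | zero => rw [pointCochain_zero, pointCochain_zero]; rfl
  | succ n => rfl

theorem pointCochain_add_one {X : Type} [TopologicalSpace X] (f : X → k) :
    pointCochain k (fun x => f x + 1) = pointCochain k f + 1 := by
  refine tot_ext fun n σ => ?_
  rw [Tot.add_apply, Tot.one_apply]
  cases n with
  | zero => rw [pointCochain_zero, pointCochain_zero, if_pos rfl]
  | succ n => rw [pointCochain_succ, pointCochain_succ, if_neg (by omega)]; simp

/-- The connection cochain of the circle bundle: the number of turns of a path, relative to the
chosen lift of its image. -/
def connCochain : Tot k (Sing SInf) :=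
  ⟨fun n => match n with
    | 1 => fun σ => (simpTurn (smp.symm σ) (verts 1 1) - simpTurn (smp.symm σ) (verts 1 0) : ℤ)
    | _ => 0⟩

theorem connCochain_one (σ : C(Simp 1, SInf)) : connCochain k 1 (smp σ) =
    (simpTurn σ (verts 1 1) - simpTurn σ (verts 1 0) : ℤ) := by
  change ((simpTurn (smp.symm (smp σ)) _ - simpTurn (smp.symm (smp σ)) _ : ℤ) : k) = _
  rw [Equiv.symm_apply_apply]

theorem connCochain_of_ne {n : ℕ} (hn : n ≠ 1) : connCochain k n = 0 := by
  rcases n with _ | _ | n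
  · rfl
  · exact absurd rfl hn
  · rfl

theorem comp_connCochain : Tot.comp 1 (connCochain k) = connCochain k := by
  refine Tot.ext fun n σ => ?_
  rw [Tot.comp_apply]
  split_ifs with h
  · rfl
  · rw [connCochain_of_ne k h]

/-- A rotation of a map to the sphere changes the pullback of the connection cochain by the
coboundary of the number of turns. -/
theorem pull_connCochain_rotate {Y : Type} [TopologicalSpace Y] (f f' : C(Y, SInf)) (t : C(Y, ℝ))
    (h : ∀ y, f' y = expt (t y) • f y) :
    Tot.pull (singMap f') (connCochain k) = Tot.pull (singMap f) (connCochain k) +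
      Tot.d (pointCochain k fun y => (turn (t y) (f y) : k)) := by
  refine tot_ext fun n σ => ?_
  rw [Tot.add_apply, Tot.pull_apply, Tot.pull_apply, singMap_smp, singMap_smp]
  by_cases hn : n = 1
  · subst hn
    obtain ⟨m, hm⟩ := simpTurn_rotate (f.comp σ) (f'.comp σ) (t.comp σ) fun x => h _
    rw [connCochain_one, connCochain_one, d_pointCochain_one, hm, hm]
    simp only [ContinuousMap.comp_apply]
    push_cast
    ring
  · rw [connCochain_of_ne k hn, d_pointCochain_of_ne k _ hn]
    simp

/-- The coboundary of the connection cochain depends only on the image of a simplex in `ℂP^∞`. -/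
theorem d_connCochain_eq {n : ℕ} (τ τ' : C(Simp n, SInf))
    (h : ∀ x, CPInf.mk (τ x) = CPInf.mk (τ' x)) :
    Tot.d (connCochain k) n (smp τ) = Tot.d (connCochain k) n (smp τ') := by
  obtain ⟨t, ht⟩ := exists_angle τ τ' h
  have h1 := congrArg Tot.d (pull_connCochain_rotate k τ' τ t ht)
  rw [map_add, Tot.d_d, add_zero, ← Tot.pull_d, ← Tot.pull_d] at h1
  have h2 := congrArg (fun z : Tot k (Sing (Simp n)) => z n (smp (ContinuousMap.id _))) h1
  simpa only [Tot.pull_apply, singMap_smp, ContinuousMap.comp_id] using h2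

/-- The Euler cochain of the circle bundle over projective space. -/
def eulerCochain : Tot k (Sing CPInf) :=
  ⟨fun n σ => Tot.d (connCochain k) n (smp (sphereLift (smp.symm σ)))⟩

theorem pull_eulerCochain : Tot.pull (singMap cpProj) (eulerCochain k) = Tot.d (connCochain k) := by
  refine tot_ext fun n σ => ?_
  rw [Tot.pull_apply, singMap_smp]
  change Tot.d (connCochain k) n (smp (sphereLift (smp.symm (smp _)))) = _
  rw [Equiv.symm_apply_apply]
  exact d_connCochain_eq k _ _ fun x => mk_sphereLift _ x

theorem pull_cpProj_injective :
    Function.Injective (Tot.pull (singMap cpProj) : Tot k (Sing CPInf) → Tot k (Sing SInf)) := by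
  intro x y h
  refine tot_ext fun n σ => ?_
  have h1 := congrArg (fun z : Tot k (Sing SInf) => z n (smp (sphereLift σ))) h
  simp only [Tot.pull_apply, singMap_smp] at h1
  rwa [show cpProj.comp (sphereLift σ) = σ from ContinuousMap.ext fun x => mk_sphereLift σ x] at h1

theorem d_eulerCochain : Tot.d (eulerCochain k) = 0 :=
  pull_cpProj_injective k (by rw [Tot.pull_d, pull_eulerCochain, Tot.d_d, map_zero])

theorem comp_eulerCochain : Tot.comp 2 (eulerCochain k) = eulerCochain k :=
  pull_cpProj_injective k (by
    rw [Tot.pull_comp, pull_eulerCochain, Tot.comp_d, comp_connCochain])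

end

end MomentAngle
end

noncomputable section

/-! ### The cone of a circle bundle -/

namespace SingCoh

open Topology

section Cone
variable {k : Type*} [CommRing k] {B P : Type} [TopologicalSpace B] [TopologicalSpace P]

/-- The cone complex of a circle bundle `π : P → B` with connection cochain `a` and Euler cochain
`c`: its differential vanishes if `d a = π^* c`, and its acyclicity says that the cohomology of `P`
is computed by the Gysin sequence. -/
def coneD (π : C(P, B)) (a : Tot k (Sing P)) (c : Tot k (Sing B)) :
    (Tot k (Sing B) × Tot k (Sing B) × Tot k (Sing P)) →ₗ[k]
      (Tot k (Sing B) × Tot k (Sing B) × Tot k (Sing P)) where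
  toFun x := (Tot.d x.1 + Tot.eps x.2.1 * c, Tot.d x.2.1,
    Tot.pull (singMap π) x.1 + Tot.pull (singMap π) x.2.1 * a - Tot.d x.2.2)
  map_add' x y := by
    simp only [Prod.fst_add, Prod.snd_add, map_add, add_mul, Prod.mk_add_mk]
    refine Prod.ext ?_ (Prod.ext rfl ?_)
    · simp only; abel
    · simp only; abel
  map_smul' r x := by
    simp only [Prod.smul_fst, Prod.smul_snd, map_smul, smul_mul_assoc, RingHom.id_apply,
      Prod.smul_mk, smul_add, smul_sub]

theorem coneD_apply (π : C(P, B)) (a : Tot k (Sing P)) (c x y : Tot k (Sing B))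
    (z : Tot k (Sing P)) : coneD π a c (x, y, z) = (Tot.d x + Tot.eps y * c, Tot.d y,
      Tot.pull (singMap π) x + Tot.pull (singMap π) y * a - Tot.d z) := rfl

theorem d_eps_of_closed {S : SSet.{0}} {y : Tot k S} (h : Tot.d y = 0) : Tot.d (Tot.eps y) = 0 := by
  have := Tot.eps_d y
  rw [h, map_zero] at this
  exact neg_eq_zero.1 this.symm

theorem coneD_coneD {π : C(P, B)} {a : Tot k (Sing P)} {c : Tot k (Sing B)} (hc : Tot.d c = 0)
    (ha : Tot.d a = Tot.pull (singMap π) c) (x) : coneD π a c (coneD π a c x) = 0 := by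
  obtain ⟨x, y, z⟩ := x
  rw [coneD_apply, coneD_apply]
  refine Prod.ext ?_ (Prod.ext (Tot.d_d y) ?_)
  · change Tot.d (Tot.d x + Tot.eps y * c) + Tot.eps (Tot.d y) * c = 0
    rw [map_add, Tot.d_d, Tot.d_mul, hc, Tot.eps_d]
    simp
  · change Tot.pull (singMap π) (Tot.d x + Tot.eps y * c) + Tot.pull (singMap π) (Tot.d y) * a -
      Tot.d (Tot.pull (singMap π) x + Tot.pull (singMap π) y * a - Tot.d z) = 0
    rw [map_sub, map_add, map_add, map_mul, Tot.d_d, Tot.d_mul, ha, Tot.pull_d, Tot.pull_d,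
      Tot.pull_eps]
    abel

/-! #### The trivial bundle -/

/-- The translation of the second factor. -/
def transl (B : Type) [TopologicalSpace B] (m : ℝ) : C(B × ℝ, B × ℝ) :=
  ⟨fun p => (p.1, p.2 + m), by fun_prop⟩

theorem exists_int_primitive {A : Type*} [AddCommGroup A] (F : ℤ → A) :
    ∃ H : ℤ → A, ∀ j, H (j + 1) - H j = F j := by
  refine ⟨fun j => Int.rec (fun n => ∑ i ∈ Finset.range n, F i)
    (fun n => -∑ i ∈ Finset.range (n + 1), F (Int.negSucc i)) j, fun j => ?_⟩
  cases j with
  | ofNat n =>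
    change ∑ i ∈ Finset.range (n + 1), F i - ∑ i ∈ Finset.range n, F i = F n
    rw [Finset.sum_range_succ]; abel
  | negSucc n =>
    cases n with
    | zero =>
      change ∑ i ∈ Finset.range 0, F i - -∑ i ∈ Finset.range (0 + 1), F (Int.negSucc i) = _
      simp
    | succ n =>
      change -∑ i ∈ Finset.range (n + 1), F (Int.negSucc i) -
        -∑ i ∈ Finset.range (n + 1 + 1), F (Int.negSucc i) = _
      rw [Finset.sum_range_succ _ (n + 1)]; abel

/-- The difference operator of the translation is surjective on cochains, because the infinite
cyclic group acts freely on the simplices of `B × ℝ`. -/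
theorem exists_transl_sub (f : Tot k (Sing (B × ℝ))) :
    ∃ h, Tot.pull (singMap (transl B 1)) h - h = f := by
  -- the orbit of a simplex is indexed by the floor of the second coordinate of its first vertex
  let fl : ∀ {n : ℕ}, C(Simp n, B × ℝ) → ℤ := fun τ => ⌊(τ (verts _ 0)).2⌋
  let base : ∀ {n : ℕ}, C(Simp n, B × ℝ) → C(Simp n, B × ℝ) := fun τ =>
    (transl B (-(fl τ : ℝ))).comp τ
  have H : ∀ (n : ℕ) (τ : C(Simp n, B × ℝ)), ∃ H : ℤ → k,
      ∀ j : ℤ, H (j + 1) - H j = f n (smp ((transl B j).comp τ)) := fun n τ =>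
    exists_int_primitive _
  choose H hH using H
  refine ⟨⟨fun n σ => H n (base (smp.symm σ)) (fl (smp.symm σ))⟩, tot_ext fun n σ => ?_⟩
  rw [Tot.sub_apply, Tot.pull_apply, singMap_smp]
  change H n (base (smp.symm (smp _))) (fl (smp.symm (smp _))) -
    H n (base (smp.symm (smp _))) (fl (smp.symm (smp _))) = _
  rw [Equiv.symm_apply_apply, Equiv.symm_apply_apply]
  have h1 : fl ((transl B 1).comp σ) = fl σ + 1 := Int.floor_add_one _
  have h2 : base ((transl B 1).comp σ) = base σ := by
    refine ContinuousMap.ext fun x => Prod.ext rfl ?_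
    change (σ x).2 + 1 + -(fl ((transl B 1).comp σ) : ℝ) = (σ x).2 + -(fl σ : ℝ)
    rw [h1]; push_cast; ring
  rw [h1, h2, hH]
  congr 2
  refine ContinuousMap.ext fun x => Prod.ext rfl ?_
  change (σ x).2 + -(fl σ : ℝ) + fl σ = (σ x).2
  ring

theorem apply_transl_of_invariant {f : Tot k (Sing (B × ℝ))}
    (hf : Tot.pull (singMap (transl B 1)) f = f) {n : ℕ} (τ : C(Simp n, B × ℝ)) (m : ℤ) :
    f n (smp ((transl B m).comp τ)) = f n (smp τ) := by
  have step : ∀ τ : C(Simp n, B × ℝ), f n (smp ((transl B 1).comp τ)) = f n (smp τ) := by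
    intro τ
    have := congrArg (fun z : Tot k (Sing (B × ℝ)) => z n (smp τ)) hf
    simpa only [Tot.pull_apply, singMap_smp] using this
  have hadd : ∀ m : ℤ, (transl B ((m + 1 : ℤ) : ℝ)).comp τ =
      (transl B 1).comp ((transl B m).comp τ) := by
    intro m
    refine ContinuousMap.ext fun x => Prod.ext rfl ?_
    change (τ x).2 + ((m + 1 : ℤ) : ℝ) = (τ x).2 + m + 1
    push_cast; ring
  induction m using Int.induction_on with
  | zero =>
    congr 2
    refine ContinuousMap.ext fun x => Prod.ext rfl ?_
    change (τ x).2 + ((0 : ℤ) : ℝ) = (τ x).2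
    simp
  | succ i ih => rw [hadd, step, ih]
  | pred i ih =>
    rw [← ih, ← step ((transl B _).comp τ), ← hadd]
    congr 4
    push_cast; ring

/-- A closed cochain on a space is cohomologous to the pullback of its restriction to a retract, if
the retraction is a homotopy equivalence. -/
theorem exists_eq_pull_add_d {X Y : Type} [TopologicalSpace X] [TopologicalSpace Y] {p : C(X, Y)}
    {j : C(Y, X)} (h : (j.comp p).Homotopic (ContinuousMap.id X)) {z : Tot k (Sing X)}
    (hz : Tot.d z = 0) : ∃ w, z = Tot.pull (singMap p) (Tot.pull (singMap j) z) + Tot.d w := by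
  have h1 := hpull_eq_of_homotopic h.symm (TotCoh.cls z hz)
  rw [hpull_cls, hpull_cls, TotCoh.cls_eq_cls] at h1
  obtain ⟨w, hw⟩ := h1
  refine ⟨w, ?_⟩
  rw [hw, singMap_id, Tot.pull_pull, singMap_comp]
  exact (add_sub_cancel _ _).symm

/-- The cone of a trivial circle bundle `P` over `B`, given by a covering `B × ℝ → P`, is
acyclic. -/
theorem exists_coneD_eq {π : C(P, B)} {a : Tot k (Sing P)} {c : Tot k (Sing B)}
    (ha : Tot.d a = Tot.pull (singMap π) c) (q : C(B × ℝ, P))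
    (hπq : π.comp q = ContinuousMap.fst)
    (hlift : ∀ n (σ : C(Simp n, P)), ∃ τ, q.comp τ = σ)
    (huniq : ∀ n (τ τ' : C(Simp n, B × ℝ)), q.comp τ = q.comp τ' →
      ∃ m : ℤ, τ' = (transl B m).comp τ)
    (hper : q.comp (transl B 1) = q) {β : Tot k (Sing B)} {θ : Tot k (Sing (B × ℝ))}
    (hβ : Tot.pull (singMap q) a = Tot.pull (singMap ContinuousMap.fst) β + Tot.d θ)
    (hθ : Tot.pull (singMap (transl B 1)) θ = θ + 1) (x) (hx : coneD π a c x = 0) :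
    ∃ y, coneD π a c y = x := by
  obtain ⟨x, y, z⟩ := x
  rw [coneD_apply] at hx
  have h1 : Tot.d x + Tot.eps y * c = 0 := congrArg Prod.fst hx
  have h2 : Tot.d y = 0 := congrArg (fun w => w.2.1) hx
  have h3 : Tot.pull (singMap π) x + Tot.pull (singMap π) y * a - Tot.d z = 0 :=
    congrArg (fun w => w.2.2) hx
  clear hx
  let j₀ : C(B, B × ℝ) := ⟨fun b => (b, 0), by fun_prop⟩
  have hj₀ : (j₀.comp ContinuousMap.fst).Homotopic (ContinuousMap.id (B × ℝ)) :=
    ⟨⟨⟨fun p => (p.2.1, p.1 * p.2.2), by fun_prop⟩, fun p => by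
      change (p.1, (0 : ℝ) * p.2) = (p.1, 0); rw [zero_mul], fun p => by
      change (p.1, (1 : ℝ) * p.2) = p; rw [one_mul]⟩⟩
  set Q := Tot.pull (k := k) (singMap q)
  set T := Tot.pull (k := k) (singMap (transl B 1))
  set p := Tot.pull (k := k) (singMap (ContinuousMap.fst : C(B × ℝ, B)))
  set J := Tot.pull (k := k) (singMap j₀)
  set π' := Tot.pull (k := k) (singMap π)
  have Qd : ∀ w, Q (Tot.d w) = Tot.d (Q w) := Tot.pull_d _
  have Td : ∀ w, T (Tot.d w) = Tot.d (T w) := Tot.pull_d _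
  have pd : ∀ w, p (Tot.d w) = Tot.d (p w) := Tot.pull_d _
  have Jd : ∀ w, J (Tot.d w) = Tot.d (J w) := Tot.pull_d _
  have πd : ∀ w, π' (Tot.d w) = Tot.d (π' w) := Tot.pull_d _
  have Qπ : ∀ w, Q (π' w) = p w := fun w => by
    simp only [Q, π', p]; rw [Tot.pull_pull, ← singMap_comp, hπq]
  have TQ : ∀ w, T (Q w) = Q w := fun w => by
    simp only [Q, T]; rw [Tot.pull_pull, ← singMap_comp, hper]
  have Tp : ∀ w, T (p w) = p w := fun w => by
    simp only [p, T]; rw [Tot.pull_pull, ← singMap_comp]; rfl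
  have Jp : ∀ w, J (p w) = w := fun w => by
    simp only [p, J]; rw [Tot.pull_pull, ← singMap_comp]; rfl
  have peps : ∀ w, p (Tot.eps w) = Tot.eps (p w) := fun w => rfl
  have πeps : ∀ w, π' (Tot.eps w) = Tot.eps (π' w) := fun w => rfl
  have Qinj : Function.Injective Q := by
    intro u v h
    refine tot_ext fun n σ => ?_
    obtain ⟨τ, rfl⟩ := hlift n σ
    have := congrArg (fun z : Tot k (Sing (B × ℝ)) => z n (smp τ)) h
    simpa only [Q, Tot.pull_apply, singMap_smp] using this
  have Qinv : ∀ f, T f = f → ∃ w, Q w = f := by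
    intro f hf
    choose L hL using hlift
    refine ⟨⟨fun n σ => f n (smp (L n (smp.symm σ)))⟩, tot_ext fun n τ => ?_⟩
    simp only [Q]
    rw [Tot.pull_apply, singMap_smp]
    change f n (smp (L n (smp.symm (smp _)))) = _
    rw [Equiv.symm_apply_apply]
    obtain ⟨m, hm⟩ := huniq n τ (L n (q.comp τ)) (hL _ _).symm
    rw [hm, apply_transl_of_invariant hf]
  have Tsurj : ∀ f, ∃ h, T h - h = f := exists_transl_sub
  have split : ∀ w, Tot.d w = 0 → ∃ u, w = p (J w) + Tot.d u := fun w hw =>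
    exists_eq_pull_add_d hj₀ hw
  have hc : c = Tot.d β := by
    have : p c = p (Tot.d β) := by
      rw [← Qπ, ← ha, Qd, hβ, map_add, Tot.d_d, add_zero, pd]
    rw [← Jp c, this, Jp]
  -- restriction to the slice makes `x + y β` exact
  have hpy : Tot.d (p y) = 0 := by rw [← pd, h2, map_zero]
  have hx' : p (x + y * β) = Tot.d (Q z - Tot.eps (p y) * θ) := by
    have h4 : Tot.d (Tot.eps (p y) * θ) = p y * Tot.d θ := by
      rw [Tot.d_mul, d_eps_of_closed hpy, zero_mul, zero_add, Tot.eps_eps]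
    have h5 : Q (π' x + π' y * a) = Q (Tot.d z) := by rw [sub_eq_zero.1 h3]
    rw [map_add, map_mul, Qπ, Qπ, hβ, Qd] at h5
    rw [map_sub, h4, ← h5, map_add, map_mul, mul_add]
    abel
  obtain ⟨x₂, hx₂⟩ : ∃ x₂, x₂ = J (Q z - Tot.eps (p y) * θ) := ⟨_, rfl⟩
  have hdx₂ : Tot.d x₂ = x + y * β := by rw [hx₂, ← Jd, ← hx', Jp]
  -- `f` is closed and its translation difference is `± y`, so `y` is exact
  obtain ⟨y₂, hy₂⟩ : ∃ y₂, Tot.d y₂ = y := by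
    obtain ⟨f, hf⟩ : ∃ f, f = Tot.eps (p y) * θ - Q z + p x₂ := ⟨_, rfl⟩
    have hdf : Tot.d f = 0 := by
      have : f = p x₂ - (Q z - Tot.eps (p y) * θ) := by rw [hf]; abel
      rw [this, map_sub, ← hx', ← pd, hdx₂, sub_self]
    obtain ⟨w, hw⟩ := split f hdf
    have hT : T f - f = Tot.eps (p y) := by
      rw [hf, map_add, map_sub, map_mul, hθ, TQ, Tp, ← peps, Tp, mul_add, mul_one]
      abel
    have hT' : T f - f = Tot.d (T w - w) := by
      rw [hw, map_add, Tp, Td, map_sub]; abel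
    have h6 : Tot.eps y = Tot.d (J (T w - w)) := by
      rw [← Jd, ← hT', hT, ← peps, Jp]
    refine ⟨-Tot.eps (J (T w - w)), ?_⟩
    rw [map_neg, ← Tot.eps_d, ← h6, Tot.eps_eps]
  have hX : Tot.d (x₂ - y₂ * β) + Tot.eps y₂ * c = x := by
    rw [map_sub, Tot.d_mul, hdx₂, hy₂, hc]; abel
  -- a cochain with the first two components right; the error `z₁` in the third one is closed
  obtain ⟨X, hXdef⟩ : ∃ X, X = x₂ - y₂ * β := ⟨_, rfl⟩
  rw [← hXdef] at hX
  obtain ⟨z₁, hz₁⟩ : ∃ z₁, z₁ = π' X + π' y₂ * a - z := ⟨_, rfl⟩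
  have hdz₁ : Tot.d z₁ = 0 := by
    have h7 : Tot.d X = x - Tot.eps y₂ * c := by rw [← hX]; abel
    rw [hz₁, map_sub, map_add, Tot.d_mul, ← πd, ← πd, h7, hy₂, ha, map_sub, map_mul, πeps,
      ← sub_eq_zero.1 h3]
    abel
  -- closed cochains on `P` come from closed cochains `u` and `v` on the base; `v` is the translation
  -- difference of a primitive on `B × ℝ`, which turns invariant on subtracting `v θ`
  obtain ⟨u, v, w₄, hdu, hdv, hz₁'⟩ : ∃ u v w₄, Tot.d u = 0 ∧ Tot.d v = 0 ∧
      z₁ = π' (u - v * β) + π' v * a + Tot.d w₄ := by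
    have hQz : Tot.d (Q z₁) = 0 := by rw [← Qd, hdz₁, map_zero]
    obtain ⟨w, hw⟩ := split _ hQz
    have hdw : Tot.d (T w - w) = 0 := by
      rw [map_sub, ← Td]
      have : Tot.d w = Q z₁ - p (J (Q z₁)) := by
        nth_rewrite 1 [hw]; abel
      rw [this, map_sub, TQ, Tp, sub_self]
    obtain ⟨w₁, hw₁⟩ := split _ hdw
    obtain ⟨w₃, hw₃⟩ := Tsurj w₁
    obtain ⟨v, hv⟩ : ∃ v, v = J (T w - w) := ⟨_, rfl⟩
    have hdv : Tot.d v = 0 := by rw [hv, ← Jd, hdw, map_zero]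
    rw [← hv] at hw₁
    obtain ⟨w₄, hw₄⟩ := Qinv (w - p v * θ - Tot.d w₃) (by
      have e : T w = w + (p v + Tot.d w₁) := by rw [← hw₁]; abel
      rw [map_sub, map_sub, map_mul, hθ, Tp, Td, e, ← hw₃, mul_add, mul_one, map_sub]
      abel)
    refine ⟨J (Q z₁), Tot.eps v, w₄, by rw [← Jd, hQz, map_zero], d_eps_of_closed hdv,
      Qinj ?_⟩
    rw [map_add, map_add, map_mul, Qπ, Qπ, hβ, Qd, hw₄, map_sub, map_sub, map_sub, Tot.d_d,
      Tot.d_mul, ← pd, hdv, map_zero, zero_mul, map_mul, peps, mul_add]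
    nth_rewrite 1 [hw]
    abel
  refine ⟨(X - (u - v * β), y₂ - v, w₄), ?_⟩
  rw [coneD_apply]
  refine Prod.ext ?_ (Prod.ext ?_ ?_)
  · change Tot.d (X - (u - v * β)) + Tot.eps (y₂ - v) * c = x
    rw [map_sub, map_sub, map_sub, Tot.d_mul, hdu, hdv, sub_mul, ← hc, ← hX]
    rw [zero_mul, zero_add, zero_sub]
    abel
  · change Tot.d (y₂ - v) = y
    rw [map_sub, hdv, hy₂, sub_zero]
  · change π' (X - (u - v * β)) + π' (y₂ - v) * a - Tot.d w₄ = z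
    have h8 : z = π' X + π' y₂ * a - z₁ := by rw [hz₁]; abel
    rw [h8, hz₁', map_sub, map_sub π' y₂ v, sub_mul]
    abel

end Cone
end SingCoh
end

noncomputable section

/-! ### The Gysin sequence of the universal circle bundle -/

namespace SingCoh

open Topology

section ConeVan
variable {k : Type*} [CommRing k] {B P : Type} [TopologicalSpace B] [TopologicalSpace P]

/-- The elements of the cone complex which vanish on the simplices over `W`. -/
def coneVan (k : Type*) [CommRing k] (π : C(P, B)) (W : Set B) :
    Submodule k (Tot k (Sing B) × Tot k (Sing B) × Tot k (Sing P)) :=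
  (van k W).prod ((van k W).prod (van k (π ⁻¹' W)))

theorem mem_coneVan {π : C(P, B)} {W : Set B} {x y : Tot k (Sing B)} {z : Tot k (Sing P)} :
    (x, y, z) ∈ coneVan k π W ↔ x ∈ van k W ∧ y ∈ van k W ∧ z ∈ van k (π ⁻¹' W) := Iff.rfl

theorem coneVan_anti {π : C(P, B)} {U W : Set B} (h : U ⊆ W) :
    coneVan k π W ≤ coneVan k π U := fun _ hx =>
  ⟨van_anti h hx.1, van_anti h hx.2.1, van_anti (Set.preimage_mono h) hx.2.2⟩

theorem van_pull {π : C(P, B)} {W : Set B} {x : Tot k (Sing B)} (hx : x ∈ van k W) :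
    Tot.pull (singMap π) x ∈ van k (π ⁻¹' W) := by
  intro n σ hσ
  rw [Tot.pull_apply, singMap_smp]
  exact hx n _ hσ

theorem coneD_mem_coneVan {π : C(P, B)} {a : Tot k (Sing P)} {c : Tot k (Sing B)} {W : Set B} {x}
    (hx : x ∈ coneVan k π W) : coneD π a c x ∈ coneVan k π W := by
  obtain ⟨x, y, z⟩ := x
  obtain ⟨h1, h2, h3⟩ := mem_coneVan.1 hx
  exact ⟨add_mem (van_d h1) (van_mul (van_eps h2) _), van_d h2,
    sub_mem (add_mem (van_pull h1) (van_mul (van_pull h2) _)) (van_d h3)⟩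

/-- The cone complex is acyclic over the image of an embedding if it is so after restriction. -/
theorem acyclicMod_coneVan_of_exact {π : C(P, B)} {a : Tot k (Sing P)} {c : Tot k (Sing B)}
    {B' P' : Type} [TopologicalSpace B'] [TopologicalSpace P'] {jB : C(B', B)} {jP : C(P', P)}
    {π' : C(P', B')} (hjB : IsEmbedding jB) (hjP : IsEmbedding jP)
    (hcomm : π.comp jP = jB.comp π') (hrange : Set.range jP = π ⁻¹' Set.range jB)
    (hex : ∀ x, coneD π' (Tot.pull (singMap jP) a) (Tot.pull (singMap jB) c) x = 0 →
      ∃ y, coneD π' (Tot.pull (singMap jP) a) (Tot.pull (singMap jB) c) y = x) :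
    AcyclicMod (coneD π a c) (coneVan k π (Set.range jB)) := by
  have hmem : ∀ x y z, (x, y, z) ∈ coneVan k π (Set.range jB) ↔ Tot.pull (singMap jB) x = 0 ∧
      Tot.pull (singMap jB) y = 0 ∧ Tot.pull (singMap jP) z = 0 := by
    intro x y z
    rw [mem_coneVan, ← hrange, mem_van_range_iff hjB, mem_van_range_iff hjB, mem_van_range_iff hjP]
  have hπ : ∀ w : Tot k (Sing B), Tot.pull (singMap jP) (Tot.pull (singMap π) w) =
      Tot.pull (singMap π') (Tot.pull (singMap jB) w) := by
    intro w
    rw [Tot.pull_pull, Tot.pull_pull, ← singMap_comp, ← singMap_comp, hcomm]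
  rintro ⟨x, y, z⟩ hx
  rw [coneD_apply, hmem, map_add, map_sub, map_add, map_mul, map_mul, Tot.pull_d, Tot.pull_d,
    Tot.pull_d, Tot.pull_eps, hπ, hπ] at hx
  obtain ⟨⟨X, Y, Z⟩, h⟩ := hex (Tot.pull (singMap jB) x, Tot.pull (singMap jB) y,
    Tot.pull (singMap jP) z) (by
      rw [coneD_apply, hx.1, hx.2.1, hx.2.2]; rfl)
  obtain ⟨X, rfl⟩ := pull_surjective_of_isEmbedding hjB X
  obtain ⟨Y, rfl⟩ := pull_surjective_of_isEmbedding hjB Y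
  obtain ⟨Z, rfl⟩ := pull_surjective_of_isEmbedding hjP Z
  rw [coneD_apply] at h
  refine ⟨(X, Y, Z), ?_⟩
  rw [coneD_apply, Prod.mk_sub_mk, Prod.mk_sub_mk, hmem, map_sub, map_sub, map_sub, map_sub,
    map_add, map_add, map_mul, map_mul, Tot.pull_d, Tot.pull_d, Tot.pull_d, Tot.pull_eps, hπ, hπ,
    sub_eq_zero, sub_eq_zero, sub_eq_zero]
  exact ⟨(congrArg Prod.fst h).symm, (congrArg (fun w => w.2.1) h).symm,
    (congrArg (fun w => w.2.2) h).symm⟩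

/-- The Mayer–Vietoris property of the cone complex. -/
theorem acyclicMod_coneVan_union {π : C(P, B)} {a : Tot k (Sing P)} {c : Tot k (Sing B)}
    (hc : Tot.d c = 0) (ha : Tot.d a = Tot.pull (singMap π) c) {U V : Set B} (hU : IsOpen U)
    (hV : IsOpen V) (h₁ : AcyclicMod (coneD π a c) (coneVan k π U))
    (h₂ : AcyclicMod (coneD π a c) (coneVan k π V))
    (h₁₂ : AcyclicMod (coneD π a c) (coneVan k π (U ∩ V))) :
    AcyclicMod (coneD π a c) (coneVan k π (U ∪ V)) := by
  refine AcyclicMod.inf (coneD_coneD hc ha) h₁ h₂ h₁₂ (fun _ => coneD_mem_coneVan)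
    (fun _ => coneD_mem_coneVan) (coneVan_anti Set.inter_subset_left)
    (coneVan_anti Set.inter_subset_right) ?_ (coneVan_anti Set.subset_union_left)
    (coneVan_anti Set.subset_union_right) ?_
  · rintro ⟨x, y, z⟩ ⟨hx, hy, hz⟩
    obtain ⟨x₁, hx₁, x₂, hx₂, hx⟩ := Submodule.mem_sup.1 (van_inter _ _ hx)
    obtain ⟨y₁, hy₁, y₂, hy₂, hy⟩ := Submodule.mem_sup.1 (van_inter _ _ hy)
    obtain ⟨z₁, hz₁, z₂, hz₂, hz⟩ := Submodule.mem_sup.1 (van_inter (π ⁻¹' U) (π ⁻¹' V) hz)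
    refine Submodule.mem_sup.2 ⟨(x₁, y₁, z₁), ⟨hx₁, hy₁, hz₁⟩, (x₂, y₂, z₂), ⟨hx₂, hy₂, hz₂⟩, ?_⟩
    exact Prod.ext hx (Prod.ext hy hz)
  · -- the three components are corrected one after the other
    rintro x ⟨hxU, hxV⟩ hx
    have both : ∀ {x}, x ∈ coneVan k π U → x ∈ coneVan k π V → ∀ {w}, w ∈ coneVan k π U →
        w ∈ coneVan k π V → x - coneD π a c w ∈ coneVan k π U ∧
          x - coneD π a c w ∈ coneVan k π V := fun h1 h2 _ h3 h4 =>
      ⟨sub_mem h1 (coneD_mem_coneVan h3), sub_mem h2 (coneD_mem_coneVan h4)⟩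
    have cl : ∀ x w, coneD π a c (x - coneD π a c w) = coneD π a c x := fun x w => by
      rw [map_sub, coneD_coneD hc ha, sub_zero]
    obtain ⟨η, ⟨hηU, hηV⟩, hη⟩ := exists_primitive_of_van hU hV x.2.1 hxU.2.1 hxV.2.1 hx.2.1
    obtain ⟨x₁, hx₁⟩ : ∃ x₁, x₁ = x - coneD π a c (0, η, 0) := ⟨_, rfl⟩
    obtain ⟨h1U, h1V⟩ := both hxU hxV (w := (0, η, 0)) ⟨zero_mem _, hηU, zero_mem _⟩
      ⟨zero_mem _, hηV, zero_mem _⟩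
    have h1D : coneD π a c x₁ ∈ coneVan k π (U ∪ V) := by rw [hx₁, cl]; exact hx
    rw [← hx₁] at h1U h1V
    have h1y : x₁.2.1 ∈ van k (U ∪ V) := by rw [hx₁]; exact hη
    obtain ⟨ξ, ⟨hξU, hξV⟩, hξ⟩ := exists_primitive_of_van hU hV x₁.1 h1U.1 h1V.1 (by
      have := sub_mem h1D.1 (van_mul (van_eps h1y) c)
      have e : (coneD π a c x₁).1 - Tot.eps x₁.2.1 * c = Tot.d x₁.1 := add_sub_cancel_right _ _
      rwa [e] at this)
    obtain ⟨x₂, hx₂⟩ : ∃ x₂, x₂ = x₁ - coneD π a c (ξ, 0, 0) := ⟨_, rfl⟩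
    obtain ⟨h2U, h2V⟩ := both h1U h1V (w := (ξ, 0, 0)) ⟨hξU, zero_mem _, zero_mem _⟩
      ⟨hξV, zero_mem _, zero_mem _⟩
    have h2D : coneD π a c x₂ ∈ coneVan k π (U ∪ V) := by rw [hx₂, cl]; exact h1D
    rw [← hx₂] at h2U h2V
    have h2y : x₂.2.1 ∈ van k (U ∪ V) := by
      have e : x₂.2.1 = x₁.2.1 - Tot.d 0 := by rw [hx₂]; rfl
      rw [e, map_zero, sub_zero]; exact h1y
    have h2x : x₂.1 ∈ van k (U ∪ V) := by
      have e : x₂.1 = x₁.1 - (Tot.d ξ + Tot.eps 0 * c) := by rw [hx₂]; rfl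
      rw [e, map_zero, zero_mul, add_zero]; exact hξ
    obtain ⟨ζ, ⟨hζU, hζV⟩, hζ⟩ := exists_primitive_of_van (hU.preimage π.continuous)
      (hV.preimage π.continuous) x₂.2.2 h2U.2.2 h2V.2.2 (by
        have h := h2D.2.2
        have e : Tot.d x₂.2.2 = (Tot.pull (singMap π) x₂.1 + Tot.pull (singMap π) x₂.2.1 * a) -
          (coneD π a c x₂).2.2 := (sub_sub_cancel _ _).symm
        rw [e]
        exact sub_mem (add_mem (van_pull h2x) (van_mul (van_pull h2y) _)) h)
    refine ⟨(0, η, 0) + (ξ, 0, 0) + (0, 0, -ζ), ?_⟩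
    rw [map_add, map_add, ← sub_sub, ← sub_sub, ← hx₁, ← hx₂, coneD_apply]
    refine ⟨?_, ?_, ?_⟩
    · change x₂.1 - (Tot.d 0 + Tot.eps 0 * c) ∈ _
      rw [map_zero, map_zero, zero_mul, add_zero, sub_zero]; exact h2x
    · change x₂.2.1 - Tot.d 0 ∈ _
      rw [map_zero, sub_zero]; exact h2y
    · change x₂.2.2 - (Tot.pull (singMap π) 0 + Tot.pull (singMap π) 0 * a - Tot.d (-ζ)) ∈ _
      rw [map_zero, zero_mul, add_zero, zero_sub, map_neg, neg_neg]; exact hζ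

theorem exists_van_limit {W : ℕ → Set B} (hW : Monotone W) (y : ℕ → Tot k (Sing B))
    (hy : ∀ n, y (n + 1) - y n ∈ van k (W n)) : ∃ z, ∀ n, z - y n ∈ van k (W n) := by
  classical
  have hy' : ∀ n m, n ≤ m → y m - y n ∈ van k (W n) := by
    intro n m h
    induction m, h using Nat.le_induction with
    | base => rw [sub_self]; exact zero_mem _
    | succ m hm ih =>
      rw [← sub_add_sub_cancel (y (m + 1)) (y m)]
      exact add_mem (van_anti (hW hm) (hy m)) ih
  refine ⟨⟨fun q σ => if h : ∃ n, ∀ t, smp.symm σ t ∈ W n then y (Nat.find h) q σ else 0⟩,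
    fun n q σ hσ => ?_⟩
  have h : ∃ n, ∀ t, smp.symm (smp σ) t ∈ W n := ⟨n, by rw [Equiv.symm_apply_apply]; exact hσ⟩
  have h1 := hy' _ n (Nat.find_min' h (by rw [Equiv.symm_apply_apply]; exact hσ)) q σ (by
    have hs : smp.symm (smp σ) = σ := Equiv.symm_apply_apply _ _
    intro t
    have h2 := Nat.find_spec h t
    have e : smp.symm (smp σ) t = σ t := by rw [hs]
    rwa [e] at h2)
  rw [Tot.sub_apply] at h1 ⊢
  simp only
  rw [dif_pos h, ← neg_sub, h1, neg_zero]

theorem iInf_van {W : ℕ → Set B} (hW : Monotone W) (ho : ∀ n, IsOpen (W n))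
    (hu : ⋃ n, W n = Set.univ) {x : Tot k (Sing B)} (hx : ∀ n, x ∈ van k (W n)) : x = 0 := by
  refine tot_ext fun q σ => ?_
  obtain ⟨n, hn⟩ := (isCompact_range σ.continuous).elim_directed_cover W ho (by rw [hu]; simp)
    (directed_of_isDirected_le hW)
  exact hx n q σ fun t => hn ⟨t, rfl⟩

/-- The cone complex is acyclic if it is so over the members of an increasing open cover. -/
theorem coneD_exact_of_iUnion {π : C(P, B)} {a : Tot k (Sing P)} {c : Tot k (Sing B)}
    (hc : Tot.d c = 0) (ha : Tot.d a = Tot.pull (singMap π) c) {W : ℕ → Set B} (hW : Monotone W)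
    (ho : ∀ n, IsOpen (W n)) (hu : ⋃ n, W n = Set.univ)
    (h : ∀ n, AcyclicMod (coneD π a c) (coneVan k π (W n))) (x) (hx : coneD π a c x = 0) :
    ∃ y, coneD π a c y = x := by
  have hW' : Monotone fun n => π ⁻¹' W n := fun _ _ h => Set.preimage_mono (hW h)
  have := AcyclicMod.iInf (coneD_coneD hc ha) (fun n => coneVan_anti (hW (Nat.le_succ n))) h
    (fun n _ => coneD_mem_coneVan) (fun y hy => by
      obtain ⟨z₁, h₁⟩ := exists_van_limit hW (fun n => (y n).1) fun n => (hy n).1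
      obtain ⟨z₂, h₂⟩ := exists_van_limit hW (fun n => (y n).2.1) fun n => (hy n).2.1
      obtain ⟨z₃, h₃⟩ := exists_van_limit hW' (fun n => (y n).2.2) fun n => (hy n).2.2
      exact ⟨(z₁, z₂, z₃), fun n => ⟨h₁ n, h₂ n, h₃ n⟩⟩)
  obtain ⟨y, hy⟩ := this x (by rw [hx]; exact zero_mem _)
  rw [Submodule.mem_iInf] at hy
  refine ⟨y, (sub_eq_zero.1 (Prod.ext ?_ (Prod.ext ?_ ?_))).symm⟩
  · exact iInf_van hW ho hu fun n => (hy n).1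
  · exact iInf_van hW ho hu fun n => (hy n).2.1
  · exact iInf_van hW' (fun n => (ho n).preimage π.continuous)
      (by rw [← Set.preimage_iUnion, hu, Set.preimage_univ]) fun n => (hy n).2.2

end ConeVan
end SingCoh

namespace MomentAngle

open Topology SingCoh

section Gysin
variable {k : Type*} [CommRing k]

/-- The basis vectors, as points of the sphere. -/
def SInf.basis (i : ℕ) : SInf := SInf.mk (Finsupp.single i 1) (by simp [nsq])

theorem SInf.ip_basis (i : ℕ) (e : SInf) : SInf.ip (SInf.basis i) e = e i := by
  rw [SInf.ip, SInf.toHilb, SInf.toHilb, SInf.basis, SInf.mk_val, Finsupp.linearCombination_single,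
    one_smul, SInf.hilbBasis.orthonormal.inner_right_finsupp]

/-- The affine charts of projective space. -/
def CPInf.chart (i : ℕ) : Set CPInf := {b | CPInf.closeness (CPInf.mk (SInf.basis i)) b ≠ 0}

theorem CPInf.isOpen_chart (i : ℕ) : IsOpen (CPInf.chart i) :=
  have h : Continuous fun b => CPInf.closeness (CPInf.mk (SInf.basis i)) b :=
    CPInf.continuous_closeness.comp
      (f := fun b => (CPInf.mk (SInf.basis i), b)) (continuous_const.prodMk continuous_id)
  isOpen_ne.preimage h

theorem CPInf.iUnion_chart : ⋃ i, CPInf.chart i = Set.univ := by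
  refine Set.eq_univ_of_forall fun b => ?_
  obtain ⟨e, rfl⟩ := CPInf.mk_surjective b
  obtain ⟨i, hi⟩ := Finsupp.ne_iff.1 e.ne_zero
  refine Set.mem_iUnion.2 ⟨i, ?_⟩
  change CPInf.closeness _ _ ≠ 0
  rw [CPInf.closeness_mk, SInf.ip_basis, norm_ne_zero_iff]
  exact hi

variable (X : Type) [TopologicalSpace X]

/-- The universal circle bundle over `X × ℂP^∞`. -/
def prodProj : C(X × SInf, X × CPInf) := (ContinuousMap.id X).prodMap cpProj

variable (k)

/-- The connection cochain on `X × S^∞`. -/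
def prodConn : Tot k (Sing (X × SInf)) := Tot.pull (singMap ContinuousMap.snd) (connCochain k)

/-- The Euler cochain on `X × ℂP^∞`. -/
def prodEuler : Tot k (Sing (X × CPInf)) := Tot.pull (singMap ContinuousMap.snd) (eulerCochain k)

theorem d_prodEuler : Tot.d (prodEuler k X) = 0 := by
  rw [prodEuler, ← Tot.pull_d, d_eulerCochain, map_zero]

theorem d_prodConn : Tot.d (prodConn k X) = Tot.pull (singMap (prodProj X)) (prodEuler k X) := by
  rw [prodConn, prodEuler, ← Tot.pull_d, ← pull_eulerCochain, Tot.pull_pull, Tot.pull_pull,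
    ← singMap_comp, ← singMap_comp]
  rfl

variable {X}

/-- The bundle is trivial over the charts. -/
theorem acyclicMod_chart (i : ℕ) (W : Set CPInf) (hW : W ⊆ CPInf.chart i) :
    AcyclicMod (coneD (prodProj X) (prodConn k X) (prodEuler k X))
      (coneVan k (prodProj X) (Prod.snd ⁻¹' W)) := by
  let B' : Type := {b : X × CPInf // b.2 ∈ W}
  let P' : Type := {p : X × SInf // CPInf.mk p.2 ∈ W}
  let jB : C(B', X × CPInf) := ⟨Subtype.val, continuous_subtype_val⟩
  let jP : C(P', X × SInf) := ⟨Subtype.val, continuous_subtype_val⟩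
  let π' : C(P', B') := ⟨fun p => ⟨prodProj X p.1, p.2⟩,
    Continuous.subtype_mk ((prodProj X).continuous.comp continuous_subtype_val) _⟩
  have hrB : Set.range jB = Prod.snd ⁻¹' W := Subtype.range_val
  have hrP : Set.range jP = prodProj X ⁻¹' Set.range jB := by
    rw [hrB]; exact Subtype.range_val
  rw [← hrB]
  refine acyclicMod_coneVan_of_exact (π' := π') (jP := jP) IsEmbedding.subtypeVal
    IsEmbedding.subtypeVal rfl hrP ?_
  -- the section of the bundle over the chart
  let s : C(B', SInf) := ⟨fun b => CPInf.transport (SInf.basis i) b.1.2, by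
    refine continuous_iff_continuousAt.2 fun b => ?_
    have h1 : Filter.Tendsto (fun b : B' => (SInf.basis i, b.1.2)) (𝓝 b)
        (𝓝 (SInf.basis i, b.1.2)) :=
      (continuous_const.prodMk (continuous_snd.comp continuous_subtype_val)).tendsto b
    exact Filter.Tendsto.comp (CPInf.continuousAt_transport _ _ (hW b.2)) h1⟩
  have hs : ∀ b, CPInf.mk (s b) = b.1.2 := fun b => CPInf.mk_transport _ _
  let q : C(B' × ℝ, P') := ⟨fun p => ⟨(p.1.1.1, expt p.2 • s p.1), by
      rw [CPInf.mk_smul, hs]; exact p.1.2⟩, by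
    refine Continuous.subtype_mk (Continuous.prodMk ?_ ?_) _
    · exact continuous_fst.comp (continuous_subtype_val.comp continuous_fst)
    · exact (expt.continuous.comp continuous_snd).smul (s.continuous.comp continuous_fst)⟩
  have hπq : π'.comp q = ContinuousMap.fst := by
    refine ContinuousMap.ext fun p => Subtype.ext (Prod.ext rfl ?_)
    change CPInf.mk (expt p.2 • s p.1) = _
    rw [CPInf.mk_smul, hs]; rfl
  refine exists_coneD_eq (β := Tot.pull (singMap s) (connCochain k))
    (θ := pointCochain k fun p : B' × ℝ => (turn p.2 (s p.1) : k)) ?_ q hπq ?_ ?_ ?_ ?_ ?_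
  · rw [← Tot.pull_d, d_prodConn, Tot.pull_pull, Tot.pull_pull, ← singMap_comp, ← singMap_comp]
    rfl
  · intro n σ
    obtain ⟨t, ht⟩ := exists_angle (ContinuousMap.snd.comp (jP.comp σ)) (s.comp (π'.comp σ))
      fun x => (hs (π' (σ x))).symm
    refine ⟨(π'.comp σ).prodMk t, ContinuousMap.ext fun x => Subtype.ext (Prod.ext rfl ?_)⟩
    exact (ht x).symm
  · intro n τ τ' h
    have h1 : ∀ x, (τ' x).1 = (τ x).1 := by
      intro x
      have e1 := DFunLike.congr_fun hπq (τ x)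
      have e2 := DFunLike.congr_fun hπq (τ' x)
      have e3 := congrArg π' (DFunLike.congr_fun h x)
      exact (e2.symm.trans (e3.symm.trans e1))
    obtain ⟨m, hm⟩ := exists_int_of_expt_eq (ContinuousMap.snd.comp τ')
      (ContinuousMap.snd.comp τ) fun x => by
        have e := congrArg (fun p : P' => p.1.2) (DFunLike.congr_fun h x)
        change expt (τ x).2 • s (τ x).1 = expt (τ' x).2 • s (τ' x).1 at e
        rw [h1] at e
        exact (smul_right_inj_circle e).symm
    exact ⟨m, ContinuousMap.ext fun x => Prod.ext (h1 x) (hm x)⟩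
  · refine ContinuousMap.ext fun p => Subtype.ext (Prod.ext rfl ?_)
    change expt (p.2 + 1) • s p.1 = expt p.2 • s p.1
    rw [show expt (p.2 + 1) = expt p.2 from expt_eq_expt_iff.2 ⟨1, by simp⟩]
  · rw [prodConn, Tot.pull_pull, Tot.pull_pull, Tot.pull_pull, ← singMap_comp, ← singMap_comp,
      ← singMap_comp]
    exact pull_connCochain_rotate k _ _ ContinuousMap.snd fun p => rfl
  · rw [pull_pointCochain, ← pointCochain_add_one]
    congr 1
    funext p
    change (turn (p.2 + 1) (s p.1) : k) = _
    have := turn_add_int p.2 1 (s p.1)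
    rw [Int.cast_one] at this
    rw [this]; push_cast; rfl

theorem coneD_prodProj_exact (x)
    (hx : coneD (prodProj X) (prodConn k X) (prodEuler k X) x = 0) :
    ∃ y, coneD (prodProj X) (prodConn k X) (prodEuler k X) y = x := by
  let V : ℕ → Set CPInf := fun n => ⋃ i ∈ Set.Iio n, CPInf.chart i
  have hV : Monotone V := fun n m h =>
    Set.biUnion_subset_biUnion_left fun i hi => lt_of_lt_of_le hi h
  have hVo : ∀ n, IsOpen (V n) := fun n => isOpen_biUnion fun i _ => CPInf.isOpen_chart i
  have hsucc : ∀ n, V (n + 1) = V n ∪ CPInf.chart n := by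
    intro n
    ext b
    simp only [V, Set.mem_iUnion, Set.mem_Iio, Set.mem_union, Nat.lt_succ_iff_lt_or_eq]
    constructor
    · rintro ⟨i, hi | rfl, h⟩
      · exact Or.inl ⟨i, hi, h⟩
      · exact Or.inr h
    · rintro (⟨i, hi, h⟩ | h)
      · exact ⟨i, Or.inl hi, h⟩
      · exact ⟨n, Or.inr rfl, h⟩
  refine coneD_exact_of_iUnion (d_prodEuler k X) (d_prodConn k X)
    (W := fun n => Prod.snd ⁻¹' V n) (fun n m h => Set.preimage_mono (hV h))
    (fun n => (hVo n).preimage continuous_snd) ?_ (fun n => ?_) x hx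
  · refine Set.eq_univ_of_forall fun b => ?_
    obtain ⟨i, hi⟩ := Set.mem_iUnion.1 (CPInf.iUnion_chart ▸ Set.mem_univ b.2)
    exact Set.mem_iUnion.2 ⟨i + 1, Set.mem_biUnion (Set.mem_Iio.2 (Nat.lt_succ_self i)) hi⟩
  · induction n with
    | zero =>
      refine acyclicMod_chart k 0 _ ?_
      simp [V]
    | succ n ih =>
      simp only [hsucc, Set.preimage_union]
      refine acyclicMod_coneVan_union (d_prodEuler k X) (d_prodConn k X)
        ((hVo n).preimage continuous_snd) ((CPInf.isOpen_chart n).preimage continuous_snd) ih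
        (acyclicMod_chart k n _ subset_rfl) ?_
      rw [← Set.preimage_inter]
      exact acyclicMod_chart k n _ Set.inter_subset_right

/-! #### Contractibility of the infinite sphere -/

namespace SInf

theorem shift_ne_zero {v : ℕ →₀ ℂ} (h : v ≠ 0) : shift v ≠ 0 := by
  obtain ⟨j, hj⟩ := Finsupp.ne_iff.1 h
  exact Finsupp.ne_iff.2 ⟨j + 1, by simpa using hj⟩

theorem homotopic_of_vec {f : SInf × unitInterval → ℕ →₀ ℂ} (h0 : ∀ p, f p ≠ 0)
    (hf : ∀ n, FinCont fun p : FinSphere n × unitInterval => f (FinSphere.incl n p.1, p.2))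
    (f₀ f₁ : C(SInf, SInf)) (h₀ : ∀ e, f₀ e = nrm (f (e, 0))) (h₁ : ∀ e, f₁ e = nrm (f (e, 1))) :
    f₀.Homotopic f₁ := by
  have hc : Continuous fun p : SInf × unitInterval => nrm (f p) :=
    continuous_prod_of_finCont fun n => finCont_nrm (hf n) fun p => h0 _
  exact ⟨⟨⟨fun p => nrm (f (p.2, p.1)), hc.comp continuous_swap⟩, fun e => (h₀ e).symm,
    fun e => (h₁ e).symm⟩⟩

/-- The infinite sphere is contractible: it is shifted off the first basis vector and then
contracted to it. -/
theorem homotopic_const : (ContinuousMap.id SInf).Homotopic (ContinuousMap.const SInf e0) := by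
  have hshift : Continuous fun e : SInf => nrm (shift e.1) :=
    continuous_dom fun n => continuous_of_finCont
      (finCont_nrm (finCont_incl n).shift fun v => shift_ne_zero (ne_zero _))
  have hu : ∀ n, FinCont fun p : FinSphere n × unitInterval => (FinSphere.incl n p.1).1 :=
    fun n => (finCont_incl n).comp continuous_fst
  refine ContinuousMap.Homotopic.trans (g := ⟨_, hshift⟩)
    (homotopic_of_vec (f := fun p => ((1 - p.2 : ℝ) : ℂ) • p.1.1 + ((p.2 : ℝ) : ℂ) • shift p.1.1)
      ?_ ?_ _ _ ?_ ?_)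
    (homotopic_of_vec
      (f := fun p => ((1 - p.2 : ℝ) : ℂ) • shift p.1.1 + ((p.2 : ℝ) : ℂ) • e0.1) ?_ ?_ _ _ ?_ ?_)
  · rintro ⟨e, s⟩ h
    by_cases hs : (s : ℝ) = 0
    · simp only [hs] at h
      exact e.ne_zero (by simpa using h)
    · have key : ∀ j, e j = 0 := by
        intro j
        obtain ⟨N, hN⟩ := exists_bound e.1
        -- the last nonzero coordinate is only seen by the shift
        have : ∀ i j, N ≤ j + i → e j = 0 := by
          intro i
          induction i with
          | zero => exact fun j hj => hN j hj
          | succ i ih =>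
            intro j hj
            have h1 := DFunLike.congr_fun h (j + 1)
            simp only [Finsupp.add_apply, Finsupp.smul_apply, shift_apply_succ, smul_eq_mul,
              Finsupp.zero_apply] at h1
            rw [ih (j + 1) (by omega), mul_zero, zero_add, mul_eq_zero] at h1
            exact h1.resolve_left (by exact_mod_cast hs)
        exact this N j (by omega)
      exact e.ne_zero (Finsupp.ext key)
  · intro n
    exact ((hu n).smul (by fun_prop)).add ((hu n).shift.smul (by fun_prop))
  · intro e; simp [nrm_of_mem]
  · intro e; simp
  · rintro ⟨e, s⟩ h
    by_cases hs : (s : ℝ) = 0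
    · simp only [hs] at h
      exact shift_ne_zero e.ne_zero (by simpa using h)
    · have h1 := DFunLike.congr_fun h 0
      rw [e0_val] at h1
      simp only [Finsupp.add_apply, Finsupp.smul_apply, shift_apply_zero, smul_eq_mul,
        Finsupp.single_eq_same, Finsupp.zero_apply, mul_zero, mul_one, zero_add] at h1
      exact hs (by exact_mod_cast h1)
  · intro n
    refine ((hu n).shift.smul (by fun_prop)).add (FinCont.smul (by fun_prop) ?_)
    rw [e0_val]
    exact FinCont.single continuous_const 0
  · intro e; simp
  · intro e; simp [nrm_of_mem]

end SInf

variable (X) in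
theorem prod_sphere_retract : ((⟨fun x => (x, SInf.e0), by fun_prop⟩ : C(X, X × SInf)).comp
    (ContinuousMap.fst : C(X × SInf, X))).Homotopic (ContinuousMap.id _) :=
  ContinuousMap.Homotopic.prodMap (ContinuousMap.Homotopic.refl (ContinuousMap.id X))
    SInf.homotopic_const.symm

/-! #### The Gysin sequence -/

variable (X) in
/-- The Euler class of the circle bundle over `X × ℂP^∞`. -/
def prodEulerClass : HTop k (X × CPInf) := TotCoh.cls _ (d_prodEuler k X)

variable (X) in
/-- The inclusion of `X` in `X × ℂP^∞` over the base point. -/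
def atBase : C(X, X × CPInf) := ⟨fun x => (x, CPInf.base), by fun_prop⟩

/-- A class which restricts to zero on the slice over the base point is a multiple of the Euler
class. -/
theorem exists_eq_mul_eulerClass (x : HTop k (X × CPInf)) (hx : hpull k (atBase X) x = 0) :
    ∃ y, x = y * prodEulerClass k X := by
  obtain ⟨x, hdx, rfl⟩ := TotCoh.exists_rep x
  have h1 : hpull k (prodProj X) (TotCoh.cls x hdx) = 0 := by
    rw [← hpull_id (hpull k (prodProj X) (TotCoh.cls x hdx)),
      ← hpull_eq_of_homotopic (prod_sphere_retract X), hpull_comp, ← hpull_comp _ (prodProj X)]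
    change hpull k _ (hpull k (atBase X) _) = 0
    rw [hx, map_zero]
  rw [hpull_cls, TotCoh.cls_eq_zero] at h1
  obtain ⟨z, hz⟩ := h1
  obtain ⟨⟨x', y', z'⟩, h⟩ := coneD_prodProj_exact (k := k) (X := X) (x, 0, z) (by
    rw [coneD_apply, hdx, hz, map_zero, map_zero, map_zero]; simp)
  rw [coneD_apply] at h
  have hx' : Tot.d x' + Tot.eps y' * prodEuler k X = x := congrArg Prod.fst h
  have hy' : Tot.d y' = 0 := congrArg (fun w => w.2.1) h
  refine ⟨TotCoh.cls (Tot.eps y') (d_eps_of_closed hy'), ?_⟩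
  rw [prodEulerClass, TotCoh.cls_mul, TotCoh.cls_eq_cls]
  exact ⟨x', by rw [← hx']; abel⟩

/-- Multiplication by the Euler class is injective. -/
theorem eq_zero_of_mul_eulerClass (y : HTop k (X × CPInf)) (hy : y * prodEulerClass k X = 0) :
    y = 0 := by
  obtain ⟨y, hdy, rfl⟩ := TotCoh.exists_rep y
  rw [prodEulerClass, TotCoh.cls_mul, TotCoh.cls_eq_zero] at hy
  obtain ⟨x, hx⟩ := hy
  obtain ⟨x₀, hx₀⟩ : ∃ x₀, Tot.d x₀ + y * prodEuler k X = 0 := ⟨-x, by rw [map_neg, hx]; simp⟩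
  have hdey : Tot.d (Tot.eps y) = 0 := d_eps_of_closed hdy
  have hcl : Tot.d (Tot.pull (singMap (prodProj X)) x₀ +
      Tot.pull (singMap (prodProj X)) (Tot.eps y) * prodConn k X) = 0 := by
    rw [map_add, Tot.d_mul, ← Tot.pull_d, ← Tot.pull_d, hdey, d_prodConn, ← Tot.pull_eps,
      Tot.eps_eps, map_zero, zero_mul, zero_add, ← map_mul, ← map_add, hx₀, map_zero]
  obtain ⟨w, hw⟩ := exists_eq_pull_add_d (prod_sphere_retract X) hcl
  set u := Tot.pull (singMap (⟨fun x => (x, SInf.e0), by fun_prop⟩ : C(X, X × SInf)))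
    (Tot.pull (singMap (prodProj X)) x₀ +
      Tot.pull (singMap (prodProj X)) (Tot.eps y) * prodConn k X) with hu
  have hdu : Tot.d u = 0 := by rw [hu, ← Tot.pull_d, hcl, map_zero]
  obtain ⟨⟨x', y', z'⟩, h⟩ := coneD_prodProj_exact (k := k) (X := X)
    (x₀ - Tot.pull (singMap ContinuousMap.fst) u, Tot.eps y, w) (by
      rw [coneD_apply, hdey, Tot.eps_eps, map_sub, ← Tot.pull_d, hdu, map_zero, sub_zero, hx₀,
        map_sub, Tot.pull_pull, ← singMap_comp]
      refine Prod.ext rfl (Prod.ext rfl ?_)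
      change Tot.pull (singMap (prodProj X)) x₀ - Tot.pull (singMap ContinuousMap.fst) u +
        Tot.pull (singMap (prodProj X)) (Tot.eps y) * prodConn k X - Tot.d w = 0
      rw [sub_add_eq_add_sub, hw]; abel)
  have hy' : Tot.d y' = Tot.eps y := congrArg (fun w => w.2.1) h
  refine TotCoh.cls_eq_zero.2 ⟨-Tot.eps y', ?_⟩
  rw [map_neg, ← Tot.eps_d, hy', Tot.eps_eps]

end Gysin

end MomentAngle
end

noncomputable section

/-! ### Neighbourhoods of Stanley–Reisner spaces -/

namespace MomentAngle

open Topology SingCoh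

theorem SInf.e0_eq_basis : SInf.e0 = SInf.basis 0 := Subtype.ext SInf.e0_val

theorem CPInf.closeness_base_mk (e : SInf) : CPInf.closeness CPInf.base (CPInf.mk e) = ‖e 0‖ := by
  change CPInf.closeness (CPInf.mk SInf.e0) _ = _
  rw [SInf.e0_eq_basis, CPInf.closeness_mk, SInf.ip_basis]

namespace SInf

/-- The vector obtained from `e` by multiplying all coordinates but the first one by `l`. -/
def pushVec (e : SInf) (l : ℝ) : ℕ →₀ ℂ := (l : ℂ) • e.1 + Finsupp.single 0 ((1 - l) * e 0)

theorem pushVec_zero (e : SInf) (l : ℝ) : pushVec e l 0 = e 0 := by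
  change (l : ℂ) * e 0 + Finsupp.single 0 ((1 - l) * e 0) 0 = e 0
  rw [Finsupp.single_eq_same]; ring

theorem pushVec_of_ne (e : SInf) (l : ℝ) {j : ℕ} (hj : j ≠ 0) : pushVec e l j = l * e j := by
  change (l : ℂ) * e j + Finsupp.single 0 ((1 - l) * e 0) j = l * e j
  rw [Finsupp.single_eq_of_ne hj, add_zero]

theorem pushVec_smul (g : Circle) (e : SInf) (l : ℝ) :
    pushVec (g • e) l = (g : ℂ) • pushVec e l := by
  ext j
  rcases eq_or_ne j 0 with rfl | hj
  · rw [Finsupp.smul_apply, pushVec_zero, pushVec_zero]; rfl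
  · rw [Finsupp.smul_apply, pushVec_of_ne _ _ hj, pushVec_of_ne _ _ hj, smul_apply, smul_eq_mul]
    ring

theorem pushVec_one (e : SInf) : pushVec e 1 = e.1 := by
  rw [pushVec]; simp

/-- The factor of the homotopy which pushes the points near the base point to it. -/
def pushFactor (e : SInf) (s : unitInterval) : ℝ := 1 - s * min 1 (2 * ‖e 0‖)

theorem pushFactor_nonneg (e : SInf) (s : unitInterval) : 0 ≤ pushFactor e s := by
  have h1 := s.2.1
  have h2 := s.2.2
  have h3 : min 1 (2 * ‖e 0‖) ≤ 1 := min_le_left _ _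
  have h4 : 0 ≤ min 1 (2 * ‖e 0‖) := le_min zero_le_one (by positivity)
  rw [pushFactor]; nlinarith

theorem pushFactor_le_one (e : SInf) (s : unitInterval) : pushFactor e s ≤ 1 := by
  have h1 := s.2.1
  have h4 : 0 ≤ min 1 (2 * ‖e 0‖) := le_min zero_le_one (by positivity)
  rw [pushFactor]; nlinarith

theorem pushVec_ne_zero (e : SInf) (s : unitInterval) : pushVec e (pushFactor e s) ≠ 0 := by
  intro h
  have h0 : e 0 = 0 := by rw [← pushVec_zero e (pushFactor e s), h]; rfl
  have h1 : pushFactor e s = 1 := by rw [pushFactor, h0]; simp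
  rw [h1, pushVec_one] at h
  exact e.ne_zero h

theorem nsq_pushVec_le (e : SInf) (s : unitInterval) : nsq (pushVec e (pushFactor e s)) ≤ 1 := by
  obtain ⟨N, hN⟩ := exists_bound e.1
  have hle : ∀ j, ‖pushVec e (pushFactor e s) j‖ ≤ ‖e j‖ := by
    intro j
    rcases eq_or_ne j 0 with rfl | hj
    · rw [pushVec_zero]
    · rw [pushVec_of_ne _ _ hj, norm_mul, Complex.norm_real, Real.norm_eq_abs,
        abs_of_nonneg (pushFactor_nonneg e s)]
      exact mul_le_of_le_one_left (norm_nonneg _) (pushFactor_le_one e s)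
  rw [← nsq_val e, nsq_eq_sum hN, nsq_eq_sum (N := N) fun j hj => norm_le_zero_iff.1
    ((hle j).trans (by rw [show e j = 0 from hN j hj, norm_zero]))]
  exact Finset.sum_le_sum fun j _ => pow_le_pow_left₀ (norm_nonneg _) (hle j) 2

/-- The homotopy of `S^∞` which pushes the points near the first coordinate circle to it. -/
def push (e : SInf) (s : unitInterval) : SInf := nrm (pushVec e (pushFactor e s))

theorem push_smul (g : Circle) (e : SInf) (s : unitInterval) : push (g • e) s = g • push e s := by
  have h : pushFactor (g • e) s = pushFactor e s := by
    rw [pushFactor, pushFactor, smul_apply, norm_mul, Circle.norm_coe, one_mul]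
  rw [push, push, h, pushVec_smul, nrm_smul _ (pushVec_ne_zero e s)]

theorem push_zero (e : SInf) : push e 0 = e := by
  rw [push, show pushFactor e 0 = 1 by rw [pushFactor]; simp, pushVec_one, nrm_of_mem]

theorem push_apply (e : SInf) (s : unitInterval) (j : ℕ) : push e s j =
    ((√(nsq (pushVec e (pushFactor e s))))⁻¹ : ℂ) * pushVec e (pushFactor e s) j := by
  rw [push, nrm_val (pushVec_ne_zero e s)]
  rfl

theorem norm_le_norm_push (e : SInf) (s : unitInterval) : ‖e 0‖ ≤ ‖push e s 0‖ := by
  rw [push_apply, pushVec_zero, norm_mul, norm_inv, Complex.norm_real, Real.norm_eq_abs,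
    abs_of_nonneg (Real.sqrt_nonneg _)]
  refine le_mul_of_one_le_left (norm_nonneg _) ((one_le_inv₀ ?_).2 ?_)
  · exact Real.sqrt_pos.2 (nsq_pos (pushVec_ne_zero e s))
  · exact Real.sqrt_le_one.2 (nsq_pushVec_le e s)

theorem push_one_apply (e : SInf) (he : 1 / 2 ≤ ‖e 0‖) {j : ℕ} (hj : j ≠ 0) :
    push e 1 j = 0 := by
  have h : pushFactor e 1 = 0 := by
    rw [pushFactor, min_eq_left (by linarith)]; simp
  rw [push_apply, pushVec_of_ne _ _ hj, h]
  simp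

theorem continuous_push : Continuous fun p : SInf × unitInterval => push p.1 p.2 := by
  refine continuous_prod_of_finCont fun n => finCont_nrm ?_ fun p => pushVec_ne_zero _ _
  have h0 : Continuous fun p : FinSphere n × unitInterval => (FinSphere.incl n p.1) 0 :=
    (continuous_apply 0).comp ((continuous_incl n).comp continuous_fst)
  have hf : Continuous fun p : FinSphere n × unitInterval =>
      pushFactor (FinSphere.incl n p.1) p.2 := by
    unfold pushFactor
    fun_prop
  exact FinCont.add (FinCont.smul (by fun_prop) ((finCont_incl n).comp continuous_fst))
    (FinCont.single (by fun_prop) 0)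

theorem exists_smul_e0 (e : SInf) (he : ∀ j, j ≠ 0 → e j = 0) : ∃ g : Circle, e = g • e0 := by
  have hv : e.1 = Finsupp.single 0 (e 0) := by
    ext j
    rcases eq_or_ne j 0 with rfl | hj
    · rw [Finsupp.single_eq_same]
    · rw [Finsupp.single_eq_of_ne hj]; exact he j hj
  have h1 : ‖e 0‖ = 1 := by
    have h := nsq_val e
    rw [nsq_eq_sum (N := 1) fun j hj => he j (by omega), Finset.sum_range_one] at h
    exact (pow_eq_one_iff_of_nonneg (norm_nonneg _) two_ne_zero).1 h
  refine ⟨circleMk (e 0) h1, Subtype.ext ?_⟩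
  rw [smul_val, e0_val, Finsupp.smul_single, smul_eq_mul, mul_one]
  exact hv

end SInf

namespace CPInf

/-- The homotopy of `ℂP^∞` which pushes a neighbourhood of the base point to it. -/
def push : C(CPInf × unitInterval, CPInf) where
  toFun p := Quotient.lift (fun e => CPInf.mk (SInf.push e p.2)) (by
    rintro a b ⟨g, rfl⟩
    change CPInf.mk (SInf.push (g • b) p.2) = _
    rw [SInf.push_smul, mk_smul]) p.1
  continuous_toFun := by
    have hq : IsOpenQuotientMap (Prod.map CPInf.mk (id : unitInterval → unitInterval)) :=
      isOpenQuotientMap_mk.prodMap IsOpenQuotientMap.id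
    refine hq.isQuotientMap.continuous_iff.2 ?_
    exact isOpenQuotientMap_mk.continuous.comp SInf.continuous_push

theorem push_mk (e : SInf) (s : unitInterval) : push (mk e, s) = mk (SInf.push e s) := rfl

theorem push_zero (b : CPInf) : push (b, 0) = b := by
  obtain ⟨e, rfl⟩ := mk_surjective b
  rw [push_mk, SInf.push_zero]

theorem closeness_le_push (b : CPInf) (s : unitInterval) :
    closeness base b ≤ closeness base (push (b, s)) := by
  obtain ⟨e, rfl⟩ := mk_surjective b
  rw [push_mk, closeness_base_mk, closeness_base_mk]
  exact SInf.norm_le_norm_push e s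

theorem eq_base_of_apply (e : SInf) (he : ∀ j, j ≠ 0 → e j = 0) : mk e = base := by
  obtain ⟨g, rfl⟩ := SInf.exists_smul_e0 e he
  exact mk_smul _ _

theorem push_one (b : CPInf) (hb : 1 / 2 ≤ closeness base b) : push (b, 1) = base := by
  obtain ⟨e, rfl⟩ := mk_surjective b
  rw [closeness_base_mk] at hb
  exact eq_base_of_apply _ fun j hj => SInf.push_one_apply e hb hj

theorem push_base (s : unitInterval) : push (base, s) = base := by
  refine eq_base_of_apply (SInf.push SInf.e0 s) fun j hj => ?_
  rw [SInf.push_apply, SInf.pushVec_of_ne _ _ hj,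
    show SInf.e0 j = 0 from by rw [SInf.e0_val, Finsupp.single_eq_of_ne hj]]
  simp

/-- A neighbourhood of the base point which contracts to it. -/
def nearBase : Set CPInf := {b | 1 / 2 < closeness base b}

theorem base_mem_nearBase : base ∈ nearBase := by
  change 1 / 2 < closeness base base
  rw [closeness_self]; norm_num

theorem isOpen_nearBase : IsOpen nearBase := by
  have h : Continuous fun b => closeness base b :=
    continuous_closeness.comp (f := fun b => (base, b)) (continuous_const.prodMk continuous_id)
  exact isOpen_lt continuous_const h

theorem push_mem_nearBase {b : CPInf} (hb : b ∈ nearBase) (s : unitInterval) :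
    push (b, s) ∈ nearBase := lt_of_lt_of_le hb (closeness_le_push b s)

variable (X : Type) [TopologicalSpace X]

/-- The inclusion of `X` in `X × U`, for the neighbourhood `U` of the base point. -/
def atNearBase : C(X, X × nearBase) := ⟨fun x => (x, ⟨base, base_mem_nearBase⟩), by fun_prop⟩

theorem atNearBase_comp_fst_homotopic :
    ((atNearBase X).comp ContinuousMap.fst).Homotopic (ContinuousMap.id (X × nearBase)) := by
  refine ContinuousMap.Homotopic.symm ⟨⟨⟨fun p => (p.2.1, ⟨push (p.2.2.1, p.1),
    push_mem_nearBase p.2.2.2 p.1⟩), ?_⟩, fun p => ?_, fun p => ?_⟩⟩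
  · exact (by fun_prop : Continuous fun p : unitInterval × X × nearBase => p.2.1).prodMk
      (Continuous.subtype_mk (push.continuous.comp (by fun_prop)) _)
  · exact Prod.ext rfl (Subtype.ext (push_zero _))
  · exact Prod.ext rfl (Subtype.ext (push_one _ p.2.2.le))

end CPInf

section
variable {m : ℕ}

open Classical in
/-- The indices of the coordinates which are not near the base point. -/
def farCoords (b : BT m) : Finset (Fin m) := {i | b i ∉ CPInf.nearBase}

theorem mem_farCoords {b : BT m} {i : Fin m} : i ∈ farCoords b ↔ b i ∉ CPInf.nearBase := by
  simp [farCoords]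

/-- The neighbourhood of the Stanley–Reisner space, for a family of subsets of `[m]`. -/
def nearSR (F : Set (Finset (Fin m))) : Set (BT m) := {b | farCoords b ∈ F}

theorem isOpen_nearSR {F : Set (Finset (Fin m))} (hF : IsLowerSet F) : IsOpen (nearSR F) := by
  have : nearSR F = ⋃ I ∈ F, ⋂ i ∈ Iᶜ, (fun b : BT m => b i) ⁻¹' CPInf.nearBase := by
    ext b
    simp only [Set.mem_iUnion, Set.mem_iInter, Finset.mem_compl]
    constructor
    · exact fun h => ⟨_, h, fun i hi => by simpa [mem_farCoords] using hi⟩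
    · rintro ⟨I, hI, h⟩
      refine hF (fun i hi => ?_) hI
      by_contra hi'
      exact mem_farCoords.1 hi (h i hi')
  rw [this]
  exact isOpen_biUnion fun I _ => isOpen_biInter_finset fun i _ =>
    CPInf.isOpen_nearBase.preimage (continuous_apply i)

/-- The inclusion of the neighbourhood. -/
def nearSRIncl (F : Set (Finset (Fin m))) : C(nearSR F, BT m) :=
  ⟨Subtype.val, continuous_subtype_val⟩

variable (K : PreAbstractSimplicialComplex (Fin m))

theorem isLowerSet_simplices : IsLowerSet (simplices K) := by
  intro I J hJI hI
  rcases J.eq_empty_or_nonempty with rfl | hJ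
  · exact Or.inl rfl
  · rcases hI with rfl | hI
    · exact Or.inl (Finset.subset_empty.1 hJI)
    · exact Or.inr ((K.isRelLowerSet_faces hI).2 hJI hJ)

theorem farCoords_subset_of_base {b : BT m} {I : Finset (Fin m)}
    (h : ∀ i, i ∉ I → b i = CPInf.base) : farCoords b ⊆ I := by
  intro i hi
  by_contra hiI
  exact mem_farCoords.1 hi (h i hiI ▸ CPInf.base_mem_nearBase)

theorem stanleyReisnerSpace_subset_nearSR : stanleyReisnerSpace K ⊆ nearSR (simplices K) := by
  rintro b ⟨I, hI, h⟩
  exact isLowerSet_simplices K (farCoords_subset_of_base h) hI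

/-- The inclusion of the Stanley–Reisner space in its neighbourhood. -/
def SRToNear : C(stanleyReisnerSpace K, nearSR (simplices K)) :=
  ⟨fun b => ⟨b.1, stanleyReisnerSpace_subset_nearSR K b.2⟩, continuous_subtype_val.subtype_mk _⟩

theorem continuous_push_pi :
    Continuous fun p : unitInterval × BT m => fun i => CPInf.push (p.2 i, p.1) :=
  continuous_pi fun i => CPInf.push.continuous.comp (by fun_prop)

theorem farCoords_push_subset (b : BT m) (s : unitInterval) :
    farCoords (fun i => CPInf.push (b i, s)) ⊆ farCoords b := fun _ hi =>
  mem_farCoords.2 fun h => mem_farCoords.1 hi (CPInf.push_mem_nearBase h s)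

/-- The retraction of the neighbourhood to the Stanley–Reisner space. -/
def nearToSR : C(nearSR (simplices K), stanleyReisnerSpace K) :=
  ⟨fun b => ⟨fun i => CPInf.push (b.1 i, 1), farCoords b.1, b.2, fun i hi =>
    CPInf.push_one _ (le_of_lt (not_not.1 (fun h => hi (mem_farCoords.2 h))))⟩,
    Continuous.subtype_mk (continuous_push_pi.comp (f := fun b : nearSR (simplices K) =>
      ((1 : unitInterval), b.1)) (by fun_prop)) _⟩

theorem SRToNear_comp_nearToSR :
    ((SRToNear K).comp (nearToSR K)).Homotopic (ContinuousMap.id _) := by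
  refine ContinuousMap.Homotopic.symm ⟨⟨⟨fun p => ⟨fun i => CPInf.push (p.2.1 i, p.1),
    isLowerSet_simplices K (farCoords_push_subset _ _) p.2.2⟩, ?_⟩, fun p => ?_, fun p => rfl⟩⟩
  · exact Continuous.subtype_mk (continuous_push_pi.comp
      (f := fun p : unitInterval × nearSR (simplices K) => (p.1, p.2.1)) (by fun_prop)) _
  · exact Subtype.ext (funext fun i => CPInf.push_zero _)

theorem nearToSR_comp_SRToNear :
    ((nearToSR K).comp (SRToNear K)).Homotopic (ContinuousMap.id _) := by
  refine ContinuousMap.Homotopic.symm ⟨⟨⟨fun p => ⟨fun i => CPInf.push (p.2.1 i, p.1), by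
    obtain ⟨I, hI, h⟩ := p.2.2
    exact ⟨I, hI, fun i hi => by simp only [h i hi, CPInf.push_base]⟩⟩, ?_⟩, fun p => ?_, fun p => rfl⟩⟩
  · exact Continuous.subtype_mk (continuous_push_pi.comp
      (f := fun p : unitInterval × stanleyReisnerSpace K => (p.1, p.2.1)) (by fun_prop)) _
  · exact Subtype.ext (funext fun i => CPInf.push_zero _)

end
end MomentAngle
end

noncomputable section

/-! ### Polynomials in cohomology classes of degree two -/

namespace SingCoh

section
variable {k : Type*} [CommRing k] {S : SSet.{0}} {σ : Type*}

theorem TotCoh.commute_of_homogeneous_two {x y : TotCoh k S} (hx : x ∈ homogeneous k S 2)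
    (hy : y ∈ homogeneous k S 2) : x * y = y * x := by
  obtain ⟨x, hdx, hx, rfl⟩ := hx
  obtain ⟨y, hdy, hy, rfl⟩ := hy
  rw [cls_mul, cls_mul, cls_eq_cls]
  exact exists_d_eq_commutator x y hx hy hdx hdy

open scoped IsMulCommutative in
/-- The evaluation of polynomials in classes of degree two. The target is not commutative, but such
classes commute. -/
def TotCoh.evalTwo (x : σ → TotCoh k S) (hx : ∀ i, x i ∈ homogeneous k S 2) :
    MvPolynomial σ k →ₐ[k] TotCoh k S :=
  haveI := Algebra.isMulCommutative_adjoin k (s := Set.range x) (by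
    rintro _ ⟨i, rfl⟩ _ ⟨j, rfl⟩
    exact commute_of_homogeneous_two (hx i) (hx j))
  (Algebra.adjoin k (Set.range x)).val.comp
    (MvPolynomial.aeval fun i => ⟨x i, Algebra.subset_adjoin ⟨i, rfl⟩⟩)

theorem TotCoh.evalTwo_X (x : σ → TotCoh k S) (hx : ∀ i, x i ∈ homogeneous k S 2) (i : σ) :
    evalTwo x hx (MvPolynomial.X i) = x i := by
  simp [evalTwo]

theorem TotCoh.evalTwo_mem_homogeneous (x : σ → TotCoh k S) (hx : ∀ i, x i ∈ homogeneous k S 2)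
    {n : ℕ} {f : MvPolynomial σ k} (hf : f ∈ MvPolynomial.weightedHomogeneousSubmodule k
      (fun _ : σ => 2) n) : evalTwo x hx f ∈ homogeneous k S n := by
  have hmon : ∀ (s : σ →₀ ℕ) (a : k), evalTwo x hx (MvPolynomial.monomial s a) ∈
      homogeneous k S (Finsupp.weight (fun _ : σ => 2) s) := by
    intro s
    induction s using Finsupp.induction_linear with
    | zero =>
      intro a
      rw [map_zero, ← MvPolynomial.C_apply, ← MvPolynomial.algebraMap_eq, AlgHom.commutes,
        Algebra.algebraMap_eq_smul_one]
      exact Submodule.smul_mem _ _ one_mem_homogeneous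
    | add s t hs ht =>
      intro a
      rw [map_add, ← mul_one a, ← MvPolynomial.monomial_mul, map_mul]
      exact mul_mem_homogeneous (hs a) (ht 1)
    | single i p =>
      intro a
      induction p generalizing a with
      | zero =>
        rw [Finsupp.single_zero, map_zero, ← MvPolynomial.C_apply, ← MvPolynomial.algebraMap_eq,
          AlgHom.commutes, Algebra.algebraMap_eq_smul_one]
        exact Submodule.smul_mem _ _ one_mem_homogeneous
      | succ p ih =>
        rw [Finsupp.single_add, map_add, ← mul_one a, ← MvPolynomial.monomial_mul, map_mul]
        refine mul_mem_homogeneous (ih a) ?_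
        rw [← MvPolynomial.X, evalTwo_X, Finsupp.weight_single, one_smul]
        exact hx i
  rw [f.as_sum, map_sum]
  refine Submodule.sum_mem _ fun s hs => ?_
  rw [← hf (MvPolynomial.mem_support_iff.1 hs)]
  exact hmon s _

end

section Point
variable {k : Type*} [CommRing k] {X : Type} [TopologicalSpace X]

instance [Subsingleton X] (n : ℕ) : Subsingleton ((Sing X).obj (.op (.mk n))) :=
  smp.symm.subsingleton

theorem Tot.d_succ_of_subsingleton [Subsingleton X] (y : Tot k (Sing X)) (n : ℕ)
    (σ : (Sing X).obj (.op (.mk (n + 1)))) :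
    Tot.d y (n + 1) σ = if Even n then 0 else y n ((Sing X).δ 0 σ) := by
  have h : ∀ i, (Sing X).δ i σ = (Sing X).δ 0 σ := fun i => Subsingleton.elim _ _
  rw [Tot.d_apply]
  simp only [h, ← Finset.sum_mul, Fin.sum_neg_one_pow]
  by_cases hn : Even n <;> simp [hn, Nat.even_add]

/-- The cohomology of a point is concentrated in degree zero. -/
theorem Tot.exists_d_eq_sub_comp_zero [Subsingleton X] {x : Tot k (Sing X)} (hx : Tot.d x = 0) :
    ∃ y, Tot.d y = x - Tot.comp 0 x := by
  refine ⟨⟨fun n σ => x (n + 1) ((Sing X).σ 0 σ)⟩, Tot.ext fun n σ => ?_⟩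
  rw [Tot.sub_apply, Tot.comp_apply]
  cases n with
  | zero => rw [if_pos rfl, sub_self, Tot.d_zero_apply]; rfl
  | succ n =>
    rw [if_neg (Nat.succ_ne_zero n), Tot.d_succ_of_subsingleton]
    have h1 : x (n + 1) σ = x (n + 1) ((Sing X).σ 0 ((Sing X).δ 0 σ)) :=
      congrArg _ (Subsingleton.elim _ _)
    split_ifs with hn
    · have h2 := congrArg (fun w : Tot k (Sing X) => w (n + 1 + 1) ((Sing X).σ 0 σ)) hx
      simp only [Tot.zero_apply] at h2
      rw [Tot.d_succ_of_subsingleton, if_neg (by simpa [Nat.even_add_one] using hn)] at h2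
      have h3 : x (n + 1) σ = x (n + 1) ((Sing X).δ 0 ((Sing X).σ 0 σ)) :=
        congrArg _ (Subsingleton.elim _ _)
      rw [h3, h2]
      simp
    · rw [h1]
      simp

theorem eq_zero_of_homogeneous_of_subsingleton [Subsingleton X] {n : ℕ} (hn : n ≠ 0)
    {h : HTop k X} (hh : h ∈ TotCoh.homogeneous k (Sing X) n) : h = 0 := by
  obtain ⟨x, hdx, hx, rfl⟩ := hh
  refine TotCoh.cls_eq_zero.2 ?_
  obtain ⟨y, hy⟩ := Tot.exists_d_eq_sub_comp_zero hdx
  refine ⟨y, hy.trans (sub_eq_self.2 (Tot.ext fun q σ => ?_))⟩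
  rw [Tot.comp_apply]
  split_ifs with h
  · rw [← hx, Tot.comp_apply, if_neg (by omega)]
    rfl
  · rfl

theorem algebraMap_eq_cls (a : k) : algebraMap k (HTop k X) a =
    TotCoh.cls (a • (1 : Tot k (Sing X))) (by rw [map_smul, Tot.d_one, smul_zero]) := by
  rw [Algebra.algebraMap_eq_smul_one]
  rfl

theorem exists_algebraMap_of_homogeneous_zero [Subsingleton X] [Nonempty X] {h : HTop k X}
    (hh : h ∈ TotCoh.homogeneous k (Sing X) 0) : ∃ a, algebraMap k _ a = h := by
  obtain ⟨x, hdx, hx, rfl⟩ := hh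
  obtain ⟨p⟩ := ‹Nonempty X›
  refine ⟨x 0 (smp (ContinuousMap.const _ p)), ?_⟩
  rw [algebraMap_eq_cls]
  congr 1
  refine Tot.ext fun n σ => ?_
  rw [← hx, Tot.smul_apply, Tot.one_apply, Tot.comp_apply, Tot.comp_apply, if_pos rfl]
  split_ifs with h
  · subst h
    rw [mul_one]
    exact congrArg _ (Subsingleton.elim _ _)
  · rw [mul_zero]; rfl

theorem algebraMap_injective_of_nonempty [Nonempty X] :
    Function.Injective (algebraMap k (HTop k X)) := by
  refine (injective_iff_map_eq_zero _).2 fun a ha => ?_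
  rw [algebraMap_eq_cls, TotCoh.cls_eq_zero] at ha
  obtain ⟨y, hy⟩ := ha
  obtain ⟨p⟩ := ‹Nonempty X›
  have h := congrArg (fun w : Tot k (Sing X) => w 0 (smp (ContinuousMap.const _ p))) hy
  simp only [Tot.smul_apply, Tot.one_apply, if_true, mul_one] at h
  rw [← h, Tot.d_zero_apply]
  rfl

theorem eq_zero_of_isEmpty [IsEmpty X] (h : HTop k X) : h = 0 := by
  obtain ⟨x, hdx, rfl⟩ := TotCoh.exists_rep h
  refine TotCoh.cls_eq_zero.2 ⟨0, tot_ext fun n σ => ?_⟩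
  exact isEmptyElim (σ (verts n 0))

end Point
end SingCoh
end

noncomputable section

/-! ### Characteristic classes of maps to `BT^m` -/

namespace MomentAngle

open Topology SingCoh

section
variable (k : Type*) [CommRing k]

/-- The generator of the second cohomology of `ℂP^∞`. -/
def eulerClass : HTop k CPInf := TotCoh.cls (eulerCochain k) (d_eulerCochain k)

theorem eulerClass_mem_homogeneous : eulerClass k ∈ TotCoh.homogeneous k (Sing CPInf) 2 :=
  ⟨_, _, comp_eulerCochain k, rfl⟩

theorem prodEulerClass_eq (X : Type) [TopologicalSpace X] :
    prodEulerClass k X = hpull k ContinuousMap.snd (eulerClass k) := rfl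

variable {X Y Z : Type} [TopologicalSpace X] [TopologicalSpace Y] [TopologicalSpace Z] {m : ℕ}

theorem hpull_const_eulerClass (b : CPInf) :
    hpull k (ContinuousMap.const Y b) (eulerClass k) = 0 := by
  have h : ContinuousMap.const Y b =
    (ContinuousMap.const PUnit b).comp (ContinuousMap.const Y PUnit.unit) := rfl
  rw [h, hpull_comp, eq_zero_of_homogeneous_of_subsingleton two_ne_zero
    (hpull_mem_homogeneous _ (eulerClass_mem_homogeneous k)), map_zero]

/-- The `i`-th coordinate of a map to `BT^m`. -/
def coordMap (φ : C(Y, BT m)) (i : Fin m) : C(Y, CPInf) :=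
  ⟨fun y => φ y i, (continuous_apply i).comp φ.continuous⟩

/-- The characteristic classes of a map to `BT^m`: polynomials evaluated at the pullbacks of the
generator along the coordinates. -/
def charMap (φ : C(Y, BT m)) : MvPolynomial (Fin m) k →ₐ[k] HTop k Y :=
  TotCoh.evalTwo (fun i => hpull k (coordMap φ i) (eulerClass k)) fun _ =>
    hpull_mem_homogeneous _ (eulerClass_mem_homogeneous k)

theorem charMap_X (φ : C(Y, BT m)) (i : Fin m) :
    charMap k φ (MvPolynomial.X i) = hpull k (coordMap φ i) (eulerClass k) :=
  TotCoh.evalTwo_X _ _ i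

theorem charMap_mem_homogeneous (φ : C(Y, BT m)) {n : ℕ} {f : MvPolynomial (Fin m) k}
    (hf : f ∈ MvPolynomial.weightedHomogeneousSubmodule k (fun _ : Fin m => 2) n) :
    charMap k φ f ∈ TotCoh.homogeneous k (Sing Y) n :=
  TotCoh.evalTwo_mem_homogeneous _ _ hf

theorem hpull_charMap (g : C(Z, Y)) (φ : C(Y, BT m)) (f : MvPolynomial (Fin m) k) :
    hpull k g (charMap k φ f) = charMap k (φ.comp g) f := by
  have h : (hpull k g).comp (charMap k φ) = charMap k (φ.comp g) :=
    MvPolynomial.algHom_ext fun i => by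
      rw [AlgHom.comp_apply, charMap_X, charMap_X, ← hpull_comp]
      rfl
  exact DFunLike.congr_fun h f

/-- The last `m` coordinates of a map to `BT^{m+1}`. -/
def tailMap (φ : C(Y, BT (m + 1))) : C(Y, BT m) :=
  ⟨fun y i => φ y i.succ, continuous_pi fun i => (continuous_apply i.succ).comp φ.continuous⟩

theorem charMap_rename_succ (φ : C(Y, BT (m + 1))) (f : MvPolynomial (Fin m) k) :
    charMap k φ (MvPolynomial.rename Fin.succ f) = charMap k (tailMap φ) f := by
  have h : (charMap k φ).comp (MvPolynomial.rename Fin.succ) = charMap k (tailMap φ) :=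
    MvPolynomial.algHom_ext fun i => by
      rw [AlgHom.comp_apply, MvPolynomial.rename_X, charMap_X, charMap_X]
      rfl
  exact DFunLike.congr_fun h f

/-- The coefficients of a polynomial, as a polynomial in the first variable. -/
abbrev coeffX (i : ℕ) (f : MvPolynomial (Fin (m + 1)) k) : MvPolynomial (Fin m) k :=
  (MvPolynomial.finSuccEquiv k m f).coeff i

variable {k}

theorem finSuccEquiv_rename_succ (f : MvPolynomial (Fin m) k) :
    MvPolynomial.finSuccEquiv k m (MvPolynomial.rename Fin.succ f) = Polynomial.C f := by
  have h : ((MvPolynomial.finSuccEquiv k m).toAlgHom.comp (MvPolynomial.rename Fin.succ)) =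
      (Polynomial.CAlgHom : _ →ₐ[MvPolynomial (Fin m) k] _).restrictScalars k :=
    MvPolynomial.algHom_ext fun i => by
      change MvPolynomial.finSuccEquiv k m (MvPolynomial.rename Fin.succ (MvPolynomial.X i)) =
        Polynomial.C (MvPolynomial.X i)
      rw [MvPolynomial.rename_X, MvPolynomial.finSuccEquiv_X_succ]
  exact DFunLike.congr_fun h f

/-- Division by the first variable. -/
theorem exists_eq_rename_add (f : MvPolynomial (Fin (m + 1)) k) :
    ∃ g, f = MvPolynomial.rename Fin.succ (coeffX k 0 f) + g * MvPolynomial.X 0 ∧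
      ∀ i, coeffX k i g = coeffX k (i + 1) f := by
  refine ⟨(MvPolynomial.finSuccEquiv k m).symm (MvPolynomial.finSuccEquiv k m f).divX, ?_,
    fun i => ?_⟩
  · apply (MvPolynomial.finSuccEquiv k m).injective
    rw [map_add, map_mul, AlgEquiv.apply_symm_apply, MvPolynomial.finSuccEquiv_X_zero,
      finSuccEquiv_rename_succ]
    exact ((add_comm _ _).trans (Polynomial.divX_mul_X_add _)).symm
  · rw [coeffX, AlgEquiv.apply_symm_apply, Polynomial.coeff_divX]

theorem coeffX_rename_succ_zero (f : MvPolynomial (Fin m) k) :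
    coeffX k 0 (MvPolynomial.rename Fin.succ f) = f := by
  rw [coeffX, finSuccEquiv_rename_succ, Polynomial.coeff_C_zero]

/-- Characteristic classes of a map whose first coordinate is constant. -/
theorem charMap_of_const (φ : C(Y, BT (m + 1))) (b : CPInf) (h : ∀ y, φ y 0 = b)
    (f : MvPolynomial (Fin (m + 1)) k) :
    charMap k φ f = charMap k (tailMap φ) (coeffX k 0 f) := by
  obtain ⟨g, hg, -⟩ := exists_eq_rename_add f
  have h0 : coordMap φ 0 = ContinuousMap.const Y b := ContinuousMap.ext h
  conv_lhs => rw [hg]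
  rw [map_add, map_mul, charMap_rename_succ, charMap_X, h0, hpull_const_eulerClass, mul_zero,
    add_zero]

/-! ### The product of a space with `ℂP^∞` -/

/-- The map `X × ℂP^∞ → BT^{m+1}` whose first coordinate is the second factor. -/
def consMap (φ : C(X, BT m)) : C(X × CPInf, BT (m + 1)) :=
  ⟨fun p => Fin.cons p.2 (φ p.1), by
    refine continuous_pi fun i => ?_
    refine Fin.cases ?_ (fun i => ?_) i
    · exact continuous_snd
    · exact (continuous_apply i).comp (φ.continuous.comp continuous_fst)⟩

theorem tailMap_consMap (φ : C(X, BT m)) : tailMap (consMap φ) = φ.comp ContinuousMap.fst := rfl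

theorem tailMap_consMap_atBase (φ : C(X, BT m)) :
    tailMap ((consMap φ).comp (atBase X)) = φ := rfl

theorem charMap_consMap_X_zero (φ : C(X, BT m)) :
    charMap k (consMap φ) (MvPolynomial.X 0) = prodEulerClass k X := by
  rw [charMap_X, prodEulerClass_eq]
  rfl

theorem hpull_atBase_charMap (φ : C(X, BT m)) (f : MvPolynomial (Fin (m + 1)) k) :
    hpull k (atBase X) (charMap k (consMap φ) f) = charMap k φ (coeffX k 0 f) := by
  rw [hpull_charMap, charMap_of_const _ CPInf.base (fun _ => rfl), tailMap_consMap_atBase]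

theorem charMap_consMap_rename (φ : C(X, BT m)) (f : MvPolynomial (Fin m) k) :
    charMap k (consMap φ) (MvPolynomial.rename Fin.succ f) =
      hpull k ContinuousMap.fst (charMap k φ f) := by
  rw [charMap_rename_succ, tailMap_consMap, hpull_charMap]

theorem charMap_consMap_eq_zero_iff (φ : C(X, BT m)) (f : MvPolynomial (Fin (m + 1)) k) :
    charMap k (consMap φ) f = 0 ↔ ∀ i, charMap k φ (coeffX k i f) = 0 := by
  constructor
  · intro h i
    have h0 : charMap k φ (coeffX k 0 f) = 0 := by
      rw [← hpull_atBase_charMap, h, map_zero]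
    induction i generalizing f with
    | zero => exact h0
    | succ i ih =>
      obtain ⟨g, hg, hc⟩ := exists_eq_rename_add f
      rw [hg, map_add, map_mul, charMap_consMap_rename, h0, map_zero, zero_add,
        charMap_consMap_X_zero] at h
      have h1 := eq_zero_of_mul_eulerClass k _ h
      rw [← hc]
      exact ih g h1 (by rw [← hpull_atBase_charMap, h1, map_zero])
  · intro h
    -- induction on the degree in the first variable
    obtain ⟨d, hd⟩ : ∃ d, ∀ i, d ≤ i → coeffX k i f = 0 :=
      ⟨_, fun i hi => Polynomial.coeff_eq_zero_of_natDegree_lt (Nat.lt_of_succ_le hi)⟩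
    induction d generalizing f with
    | zero =>
      have : f = 0 := (MvPolynomial.finSuccEquiv k m).injective
        (Polynomial.ext fun i => by rw [map_zero, Polynomial.coeff_zero]; exact hd i (Nat.zero_le i))
      rw [this, map_zero]
    | succ d ih =>
      obtain ⟨g, hg, hc⟩ := exists_eq_rename_add f
      rw [hg, map_add, map_mul, charMap_consMap_rename, h 0, map_zero, zero_add,
        ih g (fun i => by rw [hc]; exact h _)
          (fun i hi => by rw [hc]; exact hd _ (Nat.succ_le_succ hi)), zero_mul]

theorem rename_succ_mem_weightedHomogeneous {n : ℕ} {f : MvPolynomial (Fin m) k}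
    (hf : f ∈ MvPolynomial.weightedHomogeneousSubmodule k (fun _ : Fin m => 2) n) :
    MvPolynomial.rename Fin.succ f ∈
      MvPolynomial.weightedHomogeneousSubmodule k (fun _ : Fin (m + 1) => 2) n := by
  intro d hd
  obtain ⟨u, rfl, hu⟩ := MvPolynomial.coeff_rename_ne_zero _ _ _ hd
  rw [← hf hu, Finsupp.weight_apply, Finsupp.weight_apply]
  exact Finsupp.sum_mapDomain_index (h := fun _ c => c • 2) (fun _ => zero_smul _ _)
    fun _ _ _ => add_smul _ _ _

theorem mul_X_zero_mem_weightedHomogeneous {p n : ℕ} (h : p + 2 = n)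
    {f : MvPolynomial (Fin (m + 1)) k}
    (hf : f ∈ MvPolynomial.weightedHomogeneousSubmodule k (fun _ : Fin (m + 1) => 2) p) :
    f * MvPolynomial.X 0 ∈
      MvPolynomial.weightedHomogeneousSubmodule k (fun _ : Fin (m + 1) => 2) n := by
  subst h
  exact MvPolynomial.IsWeightedHomogeneous.mul hf (MvPolynomial.isWeightedHomogeneous_X k _ 0)

variable (k) in
/-- Every homogeneous class is the characteristic class of a homogeneous polynomial. -/
def CharSurjective (φ : C(Y, BT m)) : Prop :=
  ∀ n, ∀ h ∈ TotCoh.homogeneous k (Sing Y) n,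
    ∃ f ∈ MvPolynomial.weightedHomogeneousSubmodule k (fun _ : Fin m => 2) n, charMap k φ f = h

theorem prodEulerClass_mem_homogeneous :
    prodEulerClass k X ∈ TotCoh.homogeneous k (Sing (X × CPInf)) 2 :=
  hpull_mem_homogeneous _ (eulerClass_mem_homogeneous k)

theorem CharSurjective.consMap {φ : C(X, BT m)} (hφ : CharSurjective k φ) :
    CharSurjective k (consMap φ) := by
  intro n
  induction n using Nat.strong_induction_on with
  | _ n ih =>
    intro h hh
    obtain ⟨f₀, hf₀, e₀⟩ := hφ n _ (hpull_mem_homogeneous (atBase X) hh)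
    have hf₁ := rename_succ_mem_weightedHomogeneous hf₀
    obtain ⟨y, hy⟩ := exists_eq_mul_eulerClass k
      (h - charMap k (MomentAngle.consMap φ) (MvPolynomial.rename Fin.succ f₀)) (by
        rw [map_sub, hpull_atBase_charMap, coeffX_rename_succ_zero, e₀, sub_self])
    rcases TotCoh.exists_homogeneous_cofactor prodEulerClass_mem_homogeneous
      (sub_mem hh (charMap_mem_homogeneous k _ hf₁)) hy with ⟨-, h0⟩ | ⟨p, hp, y', hy', e⟩
    · exact ⟨_, hf₁, (sub_eq_zero.1 h0).symm⟩
    · obtain ⟨g, hg, rfl⟩ := ih p (by omega) y' hy'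
      refine ⟨_, add_mem hf₁ (mul_X_zero_mem_weightedHomogeneous hp hg), ?_⟩
      rw [map_add, map_mul, charMap_consMap_X_zero, ← e, add_sub_cancel]

end
end MomentAngle
end

noncomputable section

/-! ### The cohomology of the neighbourhoods -/

namespace MomentAngle

open Topology SingCoh

section
variable {m : ℕ}

/-- The deletion of the first vertex. -/
def deletion (F : Set (Finset (Fin (m + 1)))) : Set (Finset (Fin m)) :=
  {I | I.map (Fin.succEmb m) ∈ F}

/-- The link of the first vertex. -/
def link (F : Set (Finset (Fin (m + 1)))) : Set (Finset (Fin m)) :=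
  {I | insert 0 (I.map (Fin.succEmb m)) ∈ F}

variable {F : Set (Finset (Fin (m + 1)))}

theorem isLowerSet_deletion (hF : IsLowerSet F) : IsLowerSet (deletion F) :=
  fun _ _ h hI => hF (Finset.map_subset_map.2 h) hI

theorem isLowerSet_link (hF : IsLowerSet F) : IsLowerSet (link F) :=
  fun _ _ h hI => hF (Finset.insert_subset_insert _ (Finset.map_subset_map.2 h)) hI

theorem link_subset_deletion (hF : IsLowerSet F) : link F ⊆ deletion F :=
  fun _ hI => hF (Finset.subset_insert _ _) hI

/-- The last coordinates of a point of `BT^{m+1}`. -/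
abbrev tail (b : BT (m + 1)) : BT m := fun i => b i.succ

theorem farCoords_of_mem {b : BT (m + 1)} (h : b 0 ∈ CPInf.nearBase) :
    farCoords b = (farCoords (tail b)).map (Fin.succEmb m) := by
  ext i
  refine Fin.cases ?_ (fun i => ?_) i
  · simp [mem_farCoords, h]
  · simp [mem_farCoords]

theorem farCoords_of_notMem {b : BT (m + 1)} (h : b 0 ∉ CPInf.nearBase) :
    farCoords b = insert 0 ((farCoords (tail b)).map (Fin.succEmb m)) := by
  ext i
  refine Fin.cases ?_ (fun i => ?_) i
  · simp [mem_farCoords, h]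
  · simp [mem_farCoords]

theorem mem_nearSR_of_mem {b : BT (m + 1)} (h : b 0 ∈ CPInf.nearBase) :
    b ∈ nearSR F ↔ tail b ∈ nearSR (deletion F) := by
  change farCoords b ∈ F ↔ _
  rw [farCoords_of_mem h]; rfl

theorem mem_nearSR_of_notMem {b : BT (m + 1)} (h : b 0 ∉ CPInf.nearBase) :
    b ∈ nearSR F ↔ tail b ∈ nearSR (link F) := by
  change farCoords b ∈ F ↔ _
  rw [farCoords_of_notMem h]; rfl

theorem mem_nearSR_of_tail (hF : IsLowerSet F) {b : BT (m + 1)} (h : tail b ∈ nearSR (link F)) :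
    b ∈ nearSR F := by
  by_cases h0 : b 0 ∈ CPInf.nearBase
  · exact (mem_nearSR_of_mem h0).2 (link_subset_deletion hF h)
  · exact (mem_nearSR_of_notMem h0).2 h

theorem support_cons_zero (t : Fin m →₀ ℕ) :
    (Finsupp.cons 0 t).support = t.support.map (Fin.succEmb m) := by
  ext i
  refine Fin.cases ?_ (fun i => ?_) i
  · simp
  · simp

theorem support_cons_of_ne (t : Fin m →₀ ℕ) {i : ℕ} (hi : i ≠ 0) :
    (Finsupp.cons i t).support = insert 0 (t.support.map (Fin.succEmb m)) := by
  ext j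
  refine Fin.cases ?_ (fun j => ?_) j
  · simp [hi]
  · simp

/-! #### The cover by two open sets -/

variable (F)

/-- The part of the neighbourhood whose first coordinate is near the base point. -/
def delIncl : C(nearSR (deletion F) × CPInf.nearBase, nearSR F) :=
  ⟨fun p => ⟨Fin.cons p.2.1 p.1.1, (mem_nearSR_of_mem p.2.2).2 p.1.2⟩,
    Continuous.subtype_mk (continuous_pi fun i => by
      refine Fin.cases ?_ (fun i => ?_) i
      · exact continuous_subtype_val.comp continuous_snd
      · exact (continuous_apply i).comp (continuous_subtype_val.comp continuous_fst)) _⟩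

variable {F} (hF : IsLowerSet F)

/-- The part of the neighbourhood whose first coordinate is arbitrary. -/
def linkIncl : C(nearSR (link F) × CPInf, nearSR F) :=
  ⟨fun p => ⟨Fin.cons p.2 p.1.1, mem_nearSR_of_tail hF p.1.2⟩,
    Continuous.subtype_mk (consMap (nearSRIncl (link F))).continuous _⟩

theorem range_delIncl : Set.range (delIncl F) = {b | b.1 0 ∈ CPInf.nearBase} := by
  ext b
  constructor
  · rintro ⟨p, rfl⟩; exact p.2.2
  · intro h
    exact ⟨(⟨tail b.1, (mem_nearSR_of_mem h).1 b.2⟩, ⟨b.1 0, h⟩),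
      Subtype.ext (Fin.cons_self_tail b.1)⟩

theorem range_linkIncl : Set.range (linkIncl hF) = {b | tail b.1 ∈ nearSR (link F)} := by
  ext b
  constructor
  · rintro ⟨p, rfl⟩; exact p.1.2
  · intro h
    exact ⟨(⟨tail b.1, h⟩, b.1 0), Subtype.ext (Fin.cons_self_tail b.1)⟩

theorem continuous_tail : Continuous (tail : BT (m + 1) → BT m) :=
  continuous_pi fun i => continuous_apply i.succ

theorem isEmbedding_cons : IsEmbedding fun p : BT m × CPInf => (Fin.cons p.2 p.1 : BT (m + 1)) :=
  IsEmbedding.of_leftInverse (f := fun b : BT (m + 1) => (tail b, b 0)) (fun _ => rfl)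
    (continuous_tail.prodMk (continuous_apply 0))
    (consMap (ContinuousMap.id (BT m))).continuous

theorem isOpenEmbedding_delIncl : IsOpenEmbedding (delIncl F) := by
  refine ⟨IsEmbedding.of_comp (delIncl F).continuous continuous_subtype_val
    (isEmbedding_cons.comp (IsEmbedding.subtypeVal.prodMap IsEmbedding.subtypeVal)), ?_⟩
  rw [range_delIncl]
  exact CPInf.isOpen_nearBase.preimage ((continuous_apply 0).comp continuous_subtype_val)

theorem isOpenEmbedding_linkIncl : IsOpenEmbedding (linkIncl hF) := by
  refine ⟨IsEmbedding.of_comp (linkIncl hF).continuous continuous_subtype_val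
    (isEmbedding_cons.comp (IsEmbedding.subtypeVal.prodMap IsEmbedding.id)), ?_⟩
  rw [range_linkIncl]
  exact (isOpen_nearSR (isLowerSet_link hF)).preimage
    (continuous_tail.comp continuous_subtype_val)

variable (F) in
/-- The inclusion of the intersection. -/
def interIncl : C(nearSR (link F) × CPInf.nearBase, nearSR (link F) × CPInf) :=
  (ContinuousMap.id _).prodMap ⟨Subtype.val, continuous_subtype_val⟩

variable (F) in
/-- The slice over the base point. -/
def delSlice : C(nearSR (deletion F), nearSR F) := (delIncl F).comp (CPInf.atNearBase _)

variable (k : Type*) [CommRing k]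

theorem hpull_interIncl_surjective : Function.Surjective (hpull k (interIncl F)) := by
  intro w
  refine ⟨hpull k ContinuousMap.fst (hpull k (CPInf.atNearBase _) w), ?_⟩
  rw [← hpull_comp, ← hpull_comp]
  exact (hpull_eq_of_homotopic (CPInf.atNearBase_comp_fst_homotopic _) w).trans (hpull_id w)

/-- A class on the neighbourhood is determined by its restrictions to the deletion and to the
product of the link with `ℂP^∞`. -/
theorem eq_zero_of_restrict (x : HTop k (nearSR F)) (h₁ : hpull k (delSlice F) x = 0)
    (h₂ : hpull k (linkIncl hF) x = 0) : x = 0 := by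
  refine mayerVietoris_injective (delIncl F) (linkIncl hF) (interIncl F) isOpenEmbedding_delIncl
    (isOpenEmbedding_linkIncl hF) ?_ ?_ ?_ (hpull_interIncl_surjective k) x ?_ h₂
  · exact (isOpenEmbedding_linkIncl hF).isEmbedding.comp
      (IsEmbedding.id.prodMap IsEmbedding.subtypeVal)
  · rw [range_delIncl, range_linkIncl]
    refine Set.eq_univ_of_forall fun b => or_iff_not_imp_left.2 fun h => ?_
    exact (mem_nearSR_of_notMem h).1 b.2
  · rw [range_delIncl, range_linkIncl]
    ext b
    constructor
    · rintro ⟨p, rfl⟩; exact ⟨p.2.2, p.1.2⟩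
    · rintro ⟨h, h'⟩
      exact ⟨(⟨tail b.1, h'⟩, ⟨b.1 0, h⟩), Subtype.ext (Fin.cons_self_tail b.1)⟩
  · rw [delSlice, hpull_comp] at h₁
    exact hpull_injective_of_leftInverse (CPInf.atNearBase_comp_fst_homotopic _)
      (h₁.trans (map_zero _).symm)

theorem hpull_delSlice_charMap (f : MvPolynomial (Fin (m + 1)) k) :
    hpull k (delSlice F) (charMap k (nearSRIncl F) f) =
      charMap k (nearSRIncl (deletion F)) (coeffX k 0 f) := by
  rw [hpull_charMap, charMap_of_const _ CPInf.base fun _ => rfl]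
  rfl

theorem hpull_linkIncl_charMap (f : MvPolynomial (Fin (m + 1)) k) :
    hpull k (linkIncl hF) (charMap k (nearSRIncl F) f) =
      charMap k (consMap (nearSRIncl (link F))) f := by
  rw [hpull_charMap]
  rfl

end

section
variable (k : Type*) [CommRing k]

/-- The restriction of a class to the link over the base point factors through the deletion. -/
theorem hpull_atBase_linkIncl {m : ℕ} {F : Set (Finset (Fin (m + 1)))} (hF : IsLowerSet F)
    (x : HTop k (nearSR F)) (h : hpull k (delSlice F) x = 0) :
    hpull k (atBase _) (hpull k (linkIncl hF) x) = 0 := by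
  have e : (linkIncl hF).comp (atBase _) = (delSlice F).comp
      (⟨Set.inclusion fun _ hb => link_subset_deletion hF hb, continuous_inclusion _⟩ :
        C(nearSR (link F), nearSR (deletion F))) := rfl
  rw [← hpull_comp, e, hpull_comp, h, map_zero]

theorem nearSR_cohomology_zero (F : Set (Finset (Fin 0))) :
    (∀ f, charMap k (nearSRIncl F) f = 0 ↔ ∀ s ∈ f.support, s.support ∉ F) ∧
      CharSurjective k (nearSRIncl F) := by
  have hs : ∀ I : Finset (Fin 0), I = ∅ := fun I => Finset.eq_empty_of_isEmpty I
  by_cases hF : ∅ ∈ F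
  · have : Nonempty (nearSR F) := ⟨⟨fun i => i.elim0, by
      change farCoords _ ∈ F
      rw [hs (farCoords _)]; exact hF⟩⟩
    constructor
    · intro f
      have hc : ∀ a : k, charMap k (nearSRIncl F) (MvPolynomial.C a) = algebraMap k _ a :=
        fun a => (charMap k (nearSRIncl F)).commutes a
      obtain ⟨a, rfl⟩ := MvPolynomial.C_surjective (Fin 0) f
      rw [hc, map_eq_zero_iff _ algebraMap_injective_of_nonempty]
      constructor
      · rintro rfl; simp
      · intro h
        by_contra ha
        exact h 0 (by simp [ha]) (by simpa using hF)
    · intro n h hh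
      rcases eq_or_ne n 0 with rfl | hn
      · obtain ⟨a, rfl⟩ := exists_algebraMap_of_homogeneous_zero hh
        exact ⟨MvPolynomial.C a, MvPolynomial.isWeightedHomogeneous_C _ a,
          (charMap k (nearSRIncl F)).commutes a⟩
      · exact ⟨0, zero_mem _, by
          rw [map_zero, eq_zero_of_homogeneous_of_subsingleton hn hh]⟩
  · have : IsEmpty (nearSR F) := ⟨fun b => hF (by
      have h : farCoords b.1 ∈ F := b.2
      rwa [hs (farCoords b.1)] at h)⟩
    refine ⟨fun f => ⟨fun _ s _ => by rwa [hs s.support], fun _ => eq_zero_of_isEmpty _⟩,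
      fun n h _ => ⟨0, zero_mem _, ?_⟩⟩
    rw [eq_zero_of_isEmpty h, map_zero]

/-- The cohomology of the neighbourhood of a Stanley–Reisner space: the characteristic classes are
generated by the coordinate classes, and the monomials supported on non-simplices are the only
relations. -/
theorem nearSR_cohomology {m : ℕ} (F : Set (Finset (Fin m))) (hF : IsLowerSet F) :
    (∀ f, charMap k (nearSRIncl F) f = 0 ↔ ∀ s ∈ f.support, s.support ∉ F) ∧
      CharSurjective k (nearSRIncl F) := by
  induction m with
  | zero => exact nearSR_cohomology_zero k F
  | succ m ih =>
    obtain ⟨kd, sd⟩ := ih (deletion F) (isLowerSet_deletion hF)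
    obtain ⟨kl, sl⟩ := ih (link F) (isLowerSet_link hF)
    refine ⟨fun f => ⟨fun h s hs => ?_, fun h => ?_⟩, fun n h hh => ?_⟩
    · have h₁ := (kd _).1 ((hpull_delSlice_charMap k f).symm.trans (by rw [h, map_zero]))
      have h₂ := (charMap_consMap_eq_zero_iff _ f).1
        ((hpull_linkIncl_charMap hF k f).symm.trans (by rw [h, map_zero]))
      rw [← Finsupp.cons_tail s, MvPolynomial.mem_support_iff,
        ← MvPolynomial.finSuccEquiv_coeff_coeff, ← MvPolynomial.mem_support_iff] at hs
      by_cases h0 : s 0 = 0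
      · rw [← Finsupp.cons_tail s, h0, support_cons_zero]
        rw [h0] at hs
        exact h₁ _ hs
      · rw [← Finsupp.cons_tail s, support_cons_of_ne _ h0]
        exact (kl _).1 (h₂ (s 0)) _ hs
    · have hmem : ∀ i, ∀ t ∈ (coeffX k i f).support, (Finsupp.cons i t).support ∉ F := by
        intro i t ht
        refine h _ ?_
        rwa [MvPolynomial.mem_support_iff, ← MvPolynomial.finSuccEquiv_coeff_coeff,
          ← MvPolynomial.mem_support_iff]
      refine eq_zero_of_restrict hF k _ ?_ ?_
      · rw [hpull_delSlice_charMap, kd]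
        intro t ht
        have := hmem 0 t ht
        rwa [support_cons_zero] at this
      · rw [hpull_linkIncl_charMap, charMap_consMap_eq_zero_iff]
        intro i
        rw [kl]
        intro t ht htl
        refine hmem i t ht ?_
        rcases eq_or_ne i 0 with rfl | hi
        · rw [support_cons_zero]; exact link_subset_deletion hF htl
        · rw [support_cons_of_ne _ hi]; exact htl
    · obtain ⟨f₀, hf₀, e₀⟩ := sd n _ (hpull_mem_homogeneous (delSlice F) hh)
      have hf₁ := rename_succ_mem_weightedHomogeneous hf₀
      set h' := h - charMap k (nearSRIncl F) (MvPolynomial.rename Fin.succ f₀) with hh'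
      have hm : h' ∈ TotCoh.homogeneous k (Sing (nearSR F)) n :=
        sub_mem hh (charMap_mem_homogeneous k _ hf₁)
      have hd : hpull k (delSlice F) h' = 0 := by
        rw [hh', map_sub, hpull_delSlice_charMap, coeffX_rename_succ_zero, e₀, sub_self]
      obtain ⟨y, hy⟩ := exists_eq_mul_eulerClass k _ (hpull_atBase_linkIncl k hF h' hd)
      rcases TotCoh.exists_homogeneous_cofactor prodEulerClass_mem_homogeneous
        (hpull_mem_homogeneous _ hm) hy with ⟨-, h0⟩ | ⟨p, hp, y', hy', e⟩
      · exact ⟨_, hf₁, (sub_eq_zero.1 (eq_zero_of_restrict hF k h' hd h0)).symm⟩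
      · obtain ⟨g, hg, rfl⟩ := sl.consMap p y' hy'
        refine ⟨_, add_mem hf₁ (mul_X_zero_mem_weightedHomogeneous hp hg), ?_⟩
        have key : h' - charMap k (nearSRIncl F) (g * MvPolynomial.X 0) = 0 := by
          refine eq_zero_of_restrict hF k _ ?_ ?_
          · have h0 : coeffX k 0 (g * MvPolynomial.X 0) = 0 := by
              rw [coeffX, map_mul, MvPolynomial.finSuccEquiv_X_zero, Polynomial.coeff_mul_X_zero]
            rw [map_sub, hd, hpull_delSlice_charMap, h0, map_zero, sub_zero]
          · rw [map_sub, hpull_linkIncl_charMap, map_mul, charMap_consMap_X_zero, e, sub_self]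
        rw [map_add, ← sub_eq_zero.1 key, hh', add_sub_cancel]

end
end MomentAngle
end

noncomputable section

/-! ### Graded cohomology in the total cohomology ring -/

namespace SingCoh

section
variable {k : Type*} [CommRing k] {S : SSet.{0}}

open Classical in
/-- A cochain of degree `n` as an element of the total complex. -/
def Tot.single (n : ℕ) : Cochain k S n →ₗ[k] Tot k S where
  toFun f := ⟨Pi.single n f⟩
  map_add' f g := congrArg Tot.mk (Pi.single_add n f g)
  map_smul' c f := congrArg Tot.mk (Pi.single_smul n c f)

theorem Tot.single_apply_self (n : ℕ) (f : Cochain k S n) : Tot.single n f n = f := by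
  classical exact Pi.single_eq_same (M := fun n => Cochain k S n) n f

theorem Tot.single_apply_of_ne {n q : ℕ} (h : q ≠ n) (f : Cochain k S n) :
    Tot.single n f q = 0 := by
  classical exact Pi.single_eq_of_ne (M := fun n => Cochain k S n) h f

theorem Tot.comp_eq_self_iff {n : ℕ} {x : Tot k S} : Tot.comp n x = x ↔ x = Tot.single n (x n) := by
  constructor
  · intro h
    refine Tot.ext_deg fun q => ?_
    rcases eq_or_ne q n with rfl | hq
    · rw [Tot.single_apply_self]
    · rw [Tot.single_apply_of_ne hq, Tot.apply_eq_zero_of_ne h hq]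
  · intro h
    refine Tot.ext_deg fun q => ?_
    rw [Tot.comp_apply]
    split_ifs with hq
    · rfl
    · rw [h, Tot.single_apply_of_ne hq]

theorem Tot.comp_single (n : ℕ) (f : Cochain k S n) :
    Tot.comp n (Tot.single n f) = Tot.single n f :=
  Tot.comp_eq_self_iff.2 (by rw [Tot.single_apply_self])

theorem Tot.d_single (n : ℕ) (f : Cochain k S n) :
    Tot.d (Tot.single n f) = Tot.single (n + 1) (coboundary k n f) := by
  have h : Tot.comp (n + 1) (Tot.d (Tot.single n f)) = Tot.d (Tot.single n f) := by
    rw [Tot.comp_d, Tot.comp_single]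
  rw [Tot.comp_eq_self_iff.1 h, Tot.d_succ_apply, Tot.single_apply_self]

theorem Tot.single_mul_single {p q : ℕ} (f : Cochain k S p) (g : Cochain k S q) :
    Tot.single p f * Tot.single q g = Tot.single (p + q) (cup rfl f g) := by
  have h : Tot.comp (p + q) (Tot.single p f * Tot.single q g) =
      Tot.single p f * Tot.single q g := by
    rw [Tot.comp_mul_of_homogeneous (Tot.comp_single q g), Tot.comp_single]
  rw [Tot.comp_eq_self_iff.1 h]
  congr 1
  funext σ
  rw [Tot.mul_apply_of_homogeneous rfl (Tot.comp_single p f), Tot.single_apply_self,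
    Tot.single_apply_self]

theorem Tot.single_closed {n : ℕ} (f : cocycles k S n) : Tot.d (Tot.single n f.1) = 0 := by
  have hf : coboundary k n f.1 = 0 := f.2
  rw [Tot.d_single, hf, map_zero]

theorem Tot.single_exact_iff {n : ℕ} (f : Cochain k S n) :
    (∃ y, Tot.d y = Tot.single n f) ↔ f ∈ coboundaries k S n := by
  constructor
  · rintro ⟨y, hy⟩
    have h : Tot.d y n = f := by rw [hy, Tot.single_apply_self]
    cases n with
    | zero => exact h.symm
    | succ n => exact ⟨y n, h⟩
  · intro h
    cases n with
    | zero =>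
      have hf : f = 0 := h
      exact ⟨0, by rw [hf, map_zero, map_zero]⟩
    | succ n =>
      obtain ⟨g, rfl⟩ := h
      exact ⟨Tot.single n g, Tot.d_single n g⟩

namespace TotCoh

/-- The class of a cocycle of degree `n` in the total cohomology. -/
def ofCocycle (n : ℕ) : cocycles k S n →ₗ[k] TotCoh k S where
  toFun f := cls (Tot.single n f.1) (Tot.single_closed f)
  map_add' f g := by
    rw [cls_add]
    congr 1
    exact map_add (Tot.single n) f.1 g.1
  map_smul' c f := by
    have h : Tot.single n (c • f).1 = c • Tot.single n f.1 := map_smul (Tot.single n) c f.1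
    change Ideal.Quotient.mk _ _ = c • Ideal.Quotient.mk _ _
    exact congrArg (Ideal.Quotient.mk _) (Subtype.ext h)

theorem ofCocycle_apply {n : ℕ} (f : cocycles k S n) :
    ofCocycle n f = cls (Tot.single n f.1) (Tot.single_closed f) := rfl

theorem ofCocycle_eq_zero_iff {n : ℕ} (f : cocycles k S n) :
    ofCocycle n f = 0 ↔ f.1 ∈ coboundaries k S n := by
  rw [ofCocycle_apply, cls_eq_zero, Tot.single_exact_iff]

variable (k S) in
/-- The cohomology in degree `n` as a submodule of the total cohomology. -/
def ofDegree (n : ℕ) : Cohomology k S n →ₗ[k] TotCoh k S :=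
  Submodule.liftQ _ (ofCocycle n) fun f hf => (ofCocycle_eq_zero_iff f).2 hf

theorem ofDegree_mk {n : ℕ} (f : cocycles k S n) :
    ofDegree k S n (Submodule.Quotient.mk f) = cls (Tot.single n f.1) (Tot.single_closed f) := rfl

theorem ofDegree_injective (n : ℕ) : Function.Injective (ofDegree k S n) := by
  refine (injective_iff_map_eq_zero _).2 fun h hh => ?_
  obtain ⟨f, rfl⟩ := Submodule.Quotient.mk_surjective _ h
  exact (Submodule.Quotient.mk_eq_zero _).2 ((ofCocycle_eq_zero_iff f).1 hh)

theorem range_ofDegree (n : ℕ) : LinearMap.range (ofDegree k S n) = homogeneous k S n := by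
  ext h
  constructor
  · rintro ⟨h, rfl⟩
    obtain ⟨f, rfl⟩ := Submodule.Quotient.mk_surjective _ h
    exact ⟨_, Tot.single_closed f, Tot.comp_single _ _, rfl⟩
  · rintro ⟨x, hdx, hx, rfl⟩
    have hx' := Tot.comp_eq_self_iff.1 hx
    refine ⟨Submodule.Quotient.mk ⟨x n, congrArg (fun w : Tot k S => w (n + 1)) hdx⟩, ?_⟩
    rw [ofDegree_mk]
    congr 1
    exact hx'.symm

theorem ofDegree_cupProduct {p q : ℕ} (a : Cohomology k S p) (b : Cohomology k S q) :
    ofDegree k S (p + q) (cupProduct (k := k) (S := S) p q a b) = ofDegree k S p a * ofDegree k S q b := by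
  obtain ⟨f, rfl⟩ := Submodule.Quotient.mk_surjective _ a
  obtain ⟨g, rfl⟩ := Submodule.Quotient.mk_surjective _ b
  rw [ofDegree_mk, ofDegree_mk, cls_mul]
  change cls (Tot.single (p + q) (cup rfl f.1 g.1)) _ = _
  congr 1
  exact (Tot.single_mul_single f.1 g.1).symm

theorem ofDegree_oneClass : ofDegree k S 0 oneClass = 1 := by
  rw [oneClass, ofDegree_mk]
  change _ = cls 1 Tot.d_one
  congr 1
  refine Tot.ext_deg fun n => ?_
  rcases eq_or_ne n 0 with rfl | hn
  · rw [Tot.single_apply_self]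
    funext σ
    rw [Tot.one_apply, if_pos rfl]
  · rw [Tot.single_apply_of_ne hn]
    funext σ
    rw [Tot.one_apply, if_neg hn]
    rfl

end TotCoh
end
end SingCoh

/-! ### The face ring -/

namespace MomentAngle

open Topology SingCoh

section
variable (k : Type*) [CommRing k] {m : ℕ} (K : PreAbstractSimplicialComplex (Fin m))

/-- The characteristic classes of the Stanley–Reisner space are those of its neighbourhood. -/
theorem SR_cohomology :
    (∀ f, charMap k (stanleyReisnerIncl K) f = 0 ↔ ∀ s ∈ f.support, s.support ∉ simplices K) ∧
      CharSurjective k (stanleyReisnerIncl K) := by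
  obtain ⟨h₁, h₂⟩ := nearSR_cohomology k (simplices K) (isLowerSet_simplices K)
  have hc : ∀ f, hpull k (SRToNear K) (charMap k (nearSRIncl (simplices K)) f) =
      charMap k (stanleyReisnerIncl K) f := fun f => hpull_charMap k _ _ f
  have hinj : Function.Injective (hpull k (SRToNear K)) :=
    hpull_injective_of_leftInverse (SRToNear_comp_nearToSR K)
  refine ⟨fun f => ?_, fun n h hh => ?_⟩
  · rw [← hc, map_eq_zero_iff _ hinj, h₁]
  · obtain ⟨f, hf, e⟩ := h₂ n _ (hpull_mem_homogeneous (nearToSR K) hh)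
    refine ⟨f, hf, ?_⟩
    rw [← hc, e, ← hpull_comp, hpull_eq_of_homotopic (nearToSR_comp_SRToNear K), hpull_id]

/-- The cohomology of the Borel construction: that of the Stanley–Reisner space. -/
theorem borel_cohomology :
    (∀ f, charMap k (borelProj m (momentAngle K)) f = 0 ↔
        ∀ s ∈ f.support, s.support ∉ simplices K) ∧
      CharSurjective k (borelProj m (momentAngle K)) := by
  obtain ⟨h₁, h₂⟩ := SR_cohomology k K
  have hc : ∀ f, hpull k (emb K) (charMap k (borelProj m (momentAngle K)) f) =
      charMap k (stanleyReisnerIncl K) f := fun f => by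
    rw [hpull_charMap, borelProj_comp_emb]
  have hinj : Function.Injective (hpull k (emb K)) := by
    obtain ⟨H⟩ := homotopicRel_emb_comp_retr K
    exact hpull_injective_of_leftInverse (ContinuousMap.Homotopic.symm ⟨H.toHomotopy⟩)
  refine ⟨fun f => ?_, fun n h hh => ?_⟩
  · rw [← h₁, ← hc, map_eq_zero_iff _ hinj]
  · obtain ⟨f, hf, e⟩ := h₂ n _ (hpull_mem_homogeneous (emb K) hh)
    exact ⟨f, hf, hinj ((hc f).trans e)⟩

/-- The Stanley–Reisner ideal consists of the polynomials all of whose monomials are supported on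
non-simplices. -/
theorem mem_stanleyReisnerIdeal_iff (f : MvPolynomial (Fin m) k) :
    f ∈ stanleyReisnerIdeal k K ↔ ∀ s ∈ f.support, s.support ∉ simplices K := by
  constructor
  · have hle : stanleyReisnerIdeal k K ≤ RingHom.ker (charMap k (borelProj m (momentAngle K))) := by
      refine Ideal.span_le.2 ?_
      rintro _ ⟨I, hI, rfl⟩
      refine ((borel_cohomology k K).1 _).2 fun s hs => ?_
      have e : ∏ i ∈ I, (MvPolynomial.X i : MvPolynomial (Fin m) k) =
          MvPolynomial.monomial (∑ i ∈ I, Finsupp.single i 1) 1 := by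
        rw [MvPolynomial.monomial_sum_one]; rfl
      rw [e] at hs
      have hs' := Finset.mem_singleton.1 (MvPolynomial.support_monomial_subset hs)
      have hsupp : s.support = I := by
        ext i
        simp [hs', Finsupp.finsetSum_apply, Finsupp.single_apply]
      rwa [hsupp]
    exact fun hf => ((borel_cohomology k K).1 f).1 (hle hf)
  · intro h
    rw [f.as_sum]
    refine Ideal.sum_mem _ fun s hs => ?_
    have e : MvPolynomial.monomial s (f.coeff s) =
        MvPolynomial.monomial (s - ∑ i ∈ s.support, Finsupp.single i 1) (f.coeff s) *
          ∏ i ∈ s.support, MvPolynomial.X i := by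
      have e1 : ∏ i ∈ s.support, (MvPolynomial.X i : MvPolynomial (Fin m) k) =
          MvPolynomial.monomial (∑ i ∈ s.support, Finsupp.single i 1) 1 := by
        rw [MvPolynomial.monomial_sum_one]; rfl
      rw [e1, MvPolynomial.monomial_mul, mul_one, tsub_add_cancel_of_le]
      intro i
      by_cases hi : i ∈ s.support
      · have := Nat.one_le_iff_ne_zero.2 (Finsupp.mem_support_iff.1 hi)
        simpa [Finsupp.finsetSum_apply, Finsupp.single_apply, hi] using this
      · simp [Finsupp.finsetSum_apply, Finsupp.single_apply, hi]
    rw [e]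
    exact Ideal.mul_mem_left _ _ (Ideal.subset_span ⟨_, h s hs, rfl⟩)

theorem charMap_borelProj_eq_zero_iff (f : MvPolynomial (Fin m) k) :
    charMap k (borelProj m (momentAngle K)) f = 0 ↔ f ∈ stanleyReisnerIdeal k K := by
  rw [(borel_cohomology k K).1, mem_stanleyReisnerIdeal_iff]

/-- The homomorphism from the face ring to the total cohomology of the Borel construction. -/
def faceRingMap : FaceRing k K →ₐ[k] HTop k (Borel m (momentAngle K)) :=
  Ideal.Quotient.liftₐ _ (charMap k (borelProj m (momentAngle K))) fun f hf =>
    (charMap_borelProj_eq_zero_iff k K f).2 hf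

theorem faceRingMap_mk (f : MvPolynomial (Fin m) k) :
    faceRingMap k K (Ideal.Quotient.mk _ f) = charMap k (borelProj m (momentAngle K)) f := rfl

theorem faceRingMap_injective : Function.Injective (faceRingMap k K) := by
  refine (injective_iff_map_eq_zero _).2 fun a ha => ?_
  obtain ⟨f, rfl⟩ := Ideal.Quotient.mk_surjective a
  rw [faceRingMap_mk, charMap_borelProj_eq_zero_iff] at ha
  exact Ideal.Quotient.eq_zero_iff_mem.2 ha

theorem map_faceRingDegree (n : ℕ) :
    (faceRingDegree k K n).map (faceRingMap k K).toLinearMap =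
      LinearMap.range (TotCoh.ofDegree k (Sing (Borel m (momentAngle K))) n) := by
  rw [TotCoh.range_ofDegree]
  ext h
  constructor
  · rintro ⟨_, ⟨f, hf, rfl⟩, rfl⟩
    exact charMap_mem_homogeneous k _ hf
  · intro hh
    obtain ⟨f, hf, rfl⟩ := (borel_cohomology k K).2 n h hh
    exact ⟨_, ⟨f, hf, rfl⟩, rfl⟩

/-- The isomorphism from the face ring to the cohomology of the Borel construction, in degree
`n`. -/
def faceRingEquiv (n : ℕ) :
    faceRingDegree k K n ≃ₗ[k] SingularCohomology k (Borel m (momentAngle K)) n :=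
  (Submodule.equivMapOfInjective (faceRingMap k K).toLinearMap (faceRingMap_injective k K)
    (faceRingDegree k K n)).trans <|
    (LinearEquiv.ofEq _ _ (map_faceRingDegree k K n)).trans
      (LinearEquiv.ofInjective _ (TotCoh.ofDegree_injective n)).symm

theorem ofDegree_faceRingEquiv {n : ℕ} (a : faceRingDegree k K n) :
    TotCoh.ofDegree k (Sing (Borel m (momentAngle K))) n (faceRingEquiv k K n a) =
      faceRingMap k K a.1 :=
  congrArg Subtype.val ((LinearEquiv.ofInjective _ (TotCoh.ofDegree_injective n)).apply_symm_apply
    (LinearEquiv.ofEq _ _ (map_faceRingDegree k K n) (Submodule.equivMapOfInjective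
      (faceRingMap k K).toLinearMap (faceRingMap_injective k K) (faceRingDegree k K n) a)))

end
end MomentAngle
end

theorem theorem3p14 (m : ℕ) (K : PreAbstractSimplicialComplex (Fin m)) :
    -- the embedding `h` of `SR(K)` over `BT^m`, and the deformation retraction `r` onto it
    (∃ (h : C(MomentAngle.stanleyReisnerSpace K,
            MomentAngle.Borel m (MomentAngle.momentAngle K)))
        (r : C(MomentAngle.Borel m (MomentAngle.momentAngle K),
            MomentAngle.stanleyReisnerSpace K)),
      (MomentAngle.borelProj m (MomentAngle.momentAngle K)).comp h =
          MomentAngle.stanleyReisnerIncl K ∧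
      r.comp h = ContinuousMap.id _ ∧
      (ContinuousMap.id _).HomotopicRel (h.comp r) (Set.range h) ∧
      ((MomentAngle.stanleyReisnerIncl K).comp r).Homotopic
          (MomentAngle.borelProj m (MomentAngle.momentAngle K)) ∧
      -- `Z_K → SR(K) → BT^m` is a homotopy fibration, over every base point
      ∀ e : MomentAngle.ET m,
        ∃ φ : ContinuousMap.HomotopyEquiv (MomentAngle.momentAngle K)
            (MomentAngle.HomotopyFibre (MomentAngle.stanleyReisnerIncl K)
              (MomentAngle.universalProj m e)),
          ((MomentAngle.HomotopyFibre.proj (MomentAngle.stanleyReisnerIncl K)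
              (MomentAngle.universalProj m e)).comp φ.toFun).Homotopic
            (r.comp (MomentAngle.fibreIncl e))) ∧
    -- the cohomology algebra is the face ring, as a graded algebra
    ∀ (k : Type*) [CommRing k],
      ∃ Φ : ∀ n : ℕ, MomentAngle.faceRingDegree k K n ≃ₗ[k]
          SingCoh.SingularCohomology k (MomentAngle.Borel m (MomentAngle.momentAngle K)) n,
        Φ 0 ⟨1, SetLike.GradedOne.one_mem⟩ =
            SingCoh.singularOne k (MomentAngle.Borel m (MomentAngle.momentAngle K)) ∧
        ∀ (p q : ℕ) (a : MomentAngle.faceRingDegree k K p) (b : MomentAngle.faceRingDegree k K q),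
          Φ (p + q) ⟨a.1 * b.1, SetLike.GradedMul.mul_mem a.2 b.2⟩ =
            SingCoh.singularCup k (MomentAngle.Borel m (MomentAngle.momentAngle K)) p q
              (Φ p a) (Φ q b) := by
  refine ⟨⟨MomentAngle.emb K, MomentAngle.retr K, MomentAngle.borelProj_comp_emb K,
    MomentAngle.retr_comp_emb K, MomentAngle.homotopicRel_emb_comp_retr K,
    MomentAngle.incl_comp_retr_homotopic K, fun e => ⟨MomentAngle.fibEquiv K e,
      ContinuousMap.Homotopic.refl _⟩⟩, fun k _ => ⟨MomentAngle.faceRingEquiv k K, ?_, ?_⟩⟩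
  · refine SingCoh.TotCoh.ofDegree_injective 0 ?_
    rw [MomentAngle.ofDegree_faceRingEquiv, SingCoh.singularOne, SingCoh.TotCoh.ofDegree_oneClass,
      map_one]
  · intro p q a b
    refine SingCoh.TotCoh.ofDegree_injective (p + q) ?_
    rw [MomentAngle.ofDegree_faceRingEquiv, SingCoh.singularCup,
      SingCoh.TotCoh.ofDegree_cupProduct, MomentAngle.ofDegree_faceRingEquiv,
      MomentAngle.ofDegree_faceRingEquiv, map_mul]
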